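/- **Setting.** Let $H=(H_0,H_1,H_2)\in(0,1)^3$, $c>0$ and $T>0$. Let $W$ be a white noise on $\mathbb R^3$, i.e. a centered Gaussian process indexed by the real space $L^2(\mathbb R^3)$ with $\mathbb E[W(f)W(g)]=\int fg$, defined on some probability space $(\Omega,\mathcal F,\mathbb P)$. Extend $W$ complex-linearly to $L^2(\mathbb R^3;\mathbb C)$ and let $\widehat W(f)=W(\mathcal Ff)$, where $\mathcal F$ is the unitary Fourier transform. For $n\ge 1$ let $B^n$ be the almost surely smooth process on $[0,T]\times\mathbb R^2$ such that, for all $t\in[0,T]$ and $x\in\mathbb R^2$, almost surely $$B^n_t(x_1,x_2)= c\int_{|\xi|\le 2^n}\int_{|\eta|\le 2^n}\widehat W(d\xi,d\eta)\,\frac{e^{i t\xi}-1}{|\xi|^{H_0+\frac12}}\,\frac{e^{i x_1\eta_1}-1}{|\eta_1|^{H_1+\frac12}}\,\frac{e^{i x_2\eta_2}-1}{|\eta_2|^{H_2+\frac12}}$$ (for a suitable $c=c_H$ this is the truncated harmonizable representation of a space-time fractional Brownian motion of Hurst index $H$). Almost surely, let $\Psi^n$ be the classical ($C^2$) solution on $[0,T]\times\mathbb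 R^2$ of $$\partial_t^2\Psi^n-\Delta\Psi^n=\partial_t\partial_{x_1}\partial_{x_2}B^n,\qquad \Psi^n(0,\cdot)=0,\quad \partial_t\Psi^n(0,\cdot)=0,$$ and let $\Psi^{2,n}(t,y)=\Psi^n(t,y)^2-\mathbb E[\Psi^n(t,y)^2]$ be its Wick square. For $s\in\mathbb R$ let $\mathcal W^{s,2}(\mathbb R^2)$ be the Bessel potential space of tempered distributions $g$ with finite norm $\|g\|_{\mathcal W^{s,2}(\mathbb R^2)}=\|\mathcal F^{-1}((1+|\cdot|^2)^{s/2}\mathcal Fg)\|_{L^2(\mathbb R^2)}$, where $\mathcal F g(\xi)=\int e^{-2\pi i\langle x,\xi\rangle}g(x)\,dx$. For a compact set $D\subset\mathbb R^2$ with non-empty interior let $\mathcal W^{s,2}(D)$ be the localized Sobolev space of restrictions, with norm $$\|f\|_{\mathcal W^{s,2}(D)}=\inf\{\|g\|_{\mathcal W^{s,2}(\mathbb R^2)}:\ g=f\text{ in the sense of distributions on the interior of }D\}.$$ **Proposition.** If $H_0+H_1+H_2\le 1$, then for every such $D$, every $\alpha>0$ and every $t\in(0,T]$, the quantity $\mathbb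 E\big[\|\Psi^{2,n}(t,\cdot)\|^2_{\mathcal W^{-2\alpha,2}(D)}\big]$ is finite for each $n\ge1$, and $$\mathbb E\Big[\|\Psi^{2,n}(t,\cdot)\|^2_{\mathcal W^{-2\alpha,2}(D)}\Big]\longrightarrow\infty\qquad (n\to\infty).$$ Since $T>0$ is arbitrary, this covers all $t>0$. -/

import Mathlib

open MeasureTheory ProbabilityTheory Filter Set
open scoped ENNReal Topology SchwartzMap FourierTransform Laplacian

noncomputable section

namespace FractionalWave

/-- The space `ℝ²` with its Euclidean norm. -/
abbrev Plane : Type := EuclideanSpace ℝ (Fin 2)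

/-- The space `ℝ³`. On the frequency side the point `ζ` stands for `(ξ, η)` with
`ξ = ζ 0` (time frequency) and `η = (ζ 1, ζ 2)` (space frequency). -/
abbrev SpaceTime : Type := EuclideanSpace ℝ (Fin 3)

/-! ### White noise and its Fourier transform -/

/-- `W` is a (real) white noise on `ℝ³`: a centered Gaussian process indexed by the real
space `L²(ℝ³)`, whose covariance is the `L²` inner product. -/
structure IsWhiteNoise {Ω : Type*} [MeasurableSpace Ω] (P : Measure Ω)
    (W : Lp ℝ 2 (volume : Measure SpaceTime) → Ω → ℝ) : Prop where
  gaussian : IsGaussianProcess W P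
  mean_zero : ∀ f, ∫ ω, W f ω ∂P = 0
  covariance : ∀ f g, ∫ ω, W f ω * W g ω ∂P = ∫ z, f z * g z

/-- The complex-linear extension of `W` to the complex space `L²(ℝ³; ℂ)`. -/
def complexNoise {Ω : Type*} (W : Lp ℝ 2 (volume : Measure SpaceTime) → Ω → ℝ)
    (f : Lp ℂ 2 (volume : Measure SpaceTime)) (ω : Ω) : ℂ :=
  (W (Complex.reCLM.compLp f) ω : ℂ) + Complex.I * (W (Complex.imCLM.compLp f) ω : ℂ)

/-- The Fourier transform of the noise, `Ŵ(f) = W(𝓕 f)`, where `𝓕` is the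
Fourier-Plancherel transform of `L²(ℝ³; ℂ)`; `Ŵ(f)` is the integral `∫ f(ζ) Ŵ(dζ)`. -/
def fourierNoise {Ω : Type*} (W : Lp ℝ 2 (volume : Measure SpaceTime) → Ω → ℝ)
    (f : Lp ℂ 2 (volume : Measure SpaceTime)) (ω : Ω) : ℂ :=
  complexNoise W (𝓕 f) ω

/-! ### The harmonizable kernel -/

/-- The one-dimensional kernel `(e^{iau} - 1) / |u|^{h + 1/2}`. -/
def harmonizableFactor (h a u : ℝ) : ℂ :=
  (Complex.exp (Complex.I * ((a * u : ℝ) : ℂ)) - 1) / ((|u| ^ (h + 1 / 2) : ℝ) : ℂ)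

/-- The frequencies `(ξ, η)` with `|ξ| ≤ 2ⁿ` and `|η| ≤ 2ⁿ`. -/
def freqCutoff (n : ℕ) : Set SpaceTime :=
  {ζ | |ζ 0| ≤ 2 ^ n ∧ Real.sqrt (ζ 1 ^ 2 + ζ 2 ^ 2) ≤ 2 ^ n}

/-- The truncated harmonizable kernel of the fractional sheet of Hurst index `H` at time `t`
and at the point `x`. -/
def sheetKernel (H : Fin 3 → ℝ) (n : ℕ) (t : ℝ) (x : Plane) : SpaceTime → ℂ :=
  (freqCutoff n).indicator fun ζ =>
    harmonizableFactor (H 0) t (ζ 0) * harmonizableFactor (H 1) (x 0) (ζ 1) *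
      harmonizableFactor (H 2) (x 1) (ζ 2)

lemma measurable_harmonizableFactor (h a : ℝ) : Measurable (harmonizableFactor h a) := by
  unfold harmonizableFactor
  fun_prop

lemma normSq_harmonizableFactor_le (h a u : ℝ) :
    ‖harmonizableFactor h a u‖ ^ 2 ≤ a ^ 2 * |u| ^ (1 - 2 * h) := by
  rcases eq_or_ne u 0 with rfl | hu
  · have h0 : harmonizableFactor h a 0 = 0 := by simp [harmonizableFactor]
    rw [h0]
    simp only [norm_zero, ne_eq, OfNat.ofNat_ne_zero, not_false_eq_true, zero_pow]
    positivity
  · have hu' : 0 < |u| := abs_pos.mpr hu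
    have h1 : ‖Complex.exp (Complex.I * ((a * u : ℝ) : ℂ)) - 1‖ ≤ |a| * |u| := by
      have := Real.norm_exp_I_mul_ofReal_sub_one_le (x := a * u)
      rwa [Real.norm_eq_abs, abs_mul] at this
    have h2 : ‖harmonizableFactor h a u‖ =
        ‖Complex.exp (Complex.I * ((a * u : ℝ) : ℂ)) - 1‖ / |u| ^ (h + 1 / 2) := by
      rw [harmonizableFactor, norm_div, Complex.norm_real, Real.norm_eq_abs,
        abs_of_nonneg (by positivity)]
    have h3 : ‖harmonizableFactor h a u‖ ≤ |a| * |u| ^ (1 / 2 - h) := by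
      rw [h2, div_le_iff₀ (by positivity), mul_assoc, ← Real.rpow_add hu']
      have h4 : 1 / 2 - h + (h + 1 / 2) = 1 := by ring
      rwa [h4, Real.rpow_one]
    calc ‖harmonizableFactor h a u‖ ^ 2 ≤ (|a| * |u| ^ (1 / 2 - h)) ^ 2 := by gcongr
      _ = a ^ 2 * |u| ^ (1 - 2 * h) := by
        rw [mul_pow, sq_abs, ← Real.rpow_natCast (|u| ^ (1 / 2 - h)), ← Real.rpow_mul hu'.le]
        congr 2
        push_cast
        ring

lemma integrable_factor {h : ℝ} (hh : h < 1) (a R : ℝ) :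
    Integrable ((Icc (-R) R).indicator fun u => ‖harmonizableFactor h a u‖ ^ 2) := by
  have h1 : IntegrableOn (fun u : ℝ => a ^ 2 * |u| ^ (1 - 2 * h)) (Icc (-R) R) := by
    apply Integrable.const_mul
    have hp : IntegrableOn (fun u : ℝ => |u| ^ (1 - 2 * h)) (Ioc 0 R) := by
      have := (intervalIntegral.intervalIntegrable_rpow' (a := 0) (b := R)
        (show (-1 : ℝ) < 1 - 2 * h by linarith)).1
      refine this.congr_fun (fun u hu => ?_) measurableSet_Ioc
      simp only [abs_of_pos hu.1]
    have hn : IntegrableOn (fun u : ℝ => |u| ^ (1 - 2 * h)) (Ico (-R) 0) := by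
      have := (Measure.measurePreserving_neg (volume : Measure ℝ)).integrableOn_comp_preimage
        (Homeomorph.neg ℝ).measurableEmbedding (f := fun u : ℝ => |u| ^ (1 - 2 * h))
        (s := Ioc 0 R)
      have h2 := this.2 hp
      refine (h2.congr_fun (g := fun u : ℝ => |u| ^ (1 - 2 * h)) ?_ ?_).mono_set ?_
      · intro u _
        simp
      · simp
      · intro u hu
        simp only [neg_preimage, neg_Ioc, neg_zero]
        exact hu
    refine ((hn.union hp).union (integrableOn_singleton (x := (0 : ℝ)) (by simp) (by simp))).mono_set ?_
    intro u hu
    rcases lt_trichotomy u 0 with h0 | h0 | h0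
    · exact Or.inl (Or.inl ⟨hu.1, h0⟩)
    · exact Or.inr h0
    · exact Or.inl (Or.inr ⟨h0, hu.2⟩)
  refine IntegrableOn.integrable_indicator ?_ measurableSet_Icc
  refine h1.mono' ?_ (ae_of_all _ fun u => ?_)
  · exact ((measurable_harmonizableFactor h a).norm.pow_const 2).aestronglyMeasurable
  · rw [Real.norm_of_nonneg (by positivity)]
    exact normSq_harmonizableFactor_le h a u

lemma measurableSet_freqCutoff (n : ℕ) : MeasurableSet (freqCutoff n) := by
  have hm : ∀ i : Fin 3, Measurable fun ζ : SpaceTime => ζ i := fun i => by fun_prop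
  exact (measurableSet_le (hm 0).abs measurable_const).inter
    (measurableSet_le (((hm 1).pow_const 2).add ((hm 2).pow_const 2)).sqrt measurable_const)

lemma memLp_sheetKernel (H : Fin 3 → ℝ) (hH : ∀ i, H i ∈ Ioo (0 : ℝ) 1) (n : ℕ) (t : ℝ)
    (x : Plane) : MemLp (sheetKernel H n t x) 2 (volume : Measure SpaceTime) := by
  have hm : ∀ i : Fin 3, Measurable fun ζ : SpaceTime => ζ i := fun i => by fun_prop
  have hmeas : Measurable (sheetKernel H n t x) := by
    refine Measurable.indicator ?_ (measurableSet_freqCutoff n)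
    exact (((measurable_harmonizableFactor _ _).comp (hm 0)).mul
      ((measurable_harmonizableFactor _ _).comp (hm 1))).mul
      ((measurable_harmonizableFactor _ _).comp (hm 2))
  rw [memLp_two_iff_integrable_sq_norm hmeas.aestronglyMeasurable]
  have hprod : Integrable fun z : Fin 3 → ℝ => ∏ i, (Icc (-(2 : ℝ) ^ n) (2 ^ n)).indicator
      (fun u => ‖harmonizableFactor (H i) (![t, x 0, x 1] i) u‖ ^ 2) (z i) :=
    Integrable.fintype_prod fun i => integrable_factor (hH i).2 _ _
  have hcomp := (PiLp.volume_preserving_ofLp (Fin 3)).integrable_comp_of_integrable hprod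
  refine hcomp.mono' (hmeas.norm.pow_const 2).aestronglyMeasurable (ae_of_all _ fun ζ => ?_)
  rw [Real.norm_of_nonneg (by positivity)]
  by_cases hζ : ζ ∈ freqCutoff n
  · have h1 : |ζ 1| ≤ 2 ^ n := (Real.abs_le_sqrt (by nlinarith [sq_nonneg (ζ 2)])).trans hζ.2
    have h2 : |ζ 2| ≤ 2 ^ n := (Real.abs_le_sqrt (by nlinarith [sq_nonneg (ζ 1)])).trans hζ.2
    have i0 : ζ 0 ∈ Icc (-(2 : ℝ) ^ n) (2 ^ n) := abs_le.mp hζ.1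
    have i1 : ζ 1 ∈ Icc (-(2 : ℝ) ^ n) (2 ^ n) := abs_le.mp h1
    have i2 : ζ 2 ∈ Icc (-(2 : ℝ) ^ n) (2 ^ n) := abs_le.mp h2
    simp only [Function.comp_apply, Fin.prod_univ_three]
    rw [indicator_of_mem i0, indicator_of_mem i1, indicator_of_mem i2, sheetKernel,
      indicator_of_mem hζ, norm_mul, norm_mul, mul_pow, mul_pow]
    simp
  · rw [sheetKernel, indicator_of_notMem hζ]
    simp only [norm_zero, ne_eq, OfNat.ofNat_ne_zero, not_false_eq_true, zero_pow]
    exact Finset.prod_nonneg fun i _ => indicator_nonneg (fun u _ => by positivity) _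

/-- The truncated harmonizable kernel as an element of `L²(ℝ³; ℂ)`. -/
def sheetKernelLp (H : Fin 3 → ℝ) (hH : ∀ i, H i ∈ Ioo (0 : ℝ) 1) (n : ℕ) (t : ℝ)
    (x : Plane) : Lp ℂ 2 (volume : Measure SpaceTime) :=
  (memLp_sheetKernel H hH n t x).toLp (sheetKernel H n t x)

/-- `b` is the (almost surely smooth) process on `[0, T] × ℝ²` given by the harmonizable
formula truncated at the frequency `2ⁿ`, with the normalizing constant `c`. -/
structure IsSheetApproximation {Ω : Type*} [MeasurableSpace Ω] (P : Measure Ω)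
    (W : Lp ℝ 2 (volume : Measure SpaceTime) → Ω → ℝ) (c : ℝ)
    (H : Fin 3 → ℝ) (hH : ∀ i, H i ∈ Ioo (0 : ℝ) 1) (n : ℕ) (T : ℝ)
    (b : Ω → ℝ → Plane → ℝ) : Prop where
  smooth : ∀ᵐ ω ∂P,
    ContDiffOn ℝ ((⊤ : ℕ∞) : WithTop ℕ∞) (fun p : ℝ × Plane => b ω p.1 p.2) (Icc 0 T ×ˢ univ)
  formula : ∀ t ∈ Icc 0 T, ∀ x : Plane, ∀ᵐ ω ∂P,
    (b ω t x : ℂ) = (c : ℂ) * fourierNoise W (sheetKernelLp H hH n t x) ω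

/-! ### The wave equation -/

/-- The mixed derivative `∂_t ∂_{x₁} ∂_{x₂} b` of a function on `[0, T] × ℝ²` (one-sided in
time at the end points). -/
def mixedDeriv (T : ℝ) (b : ℝ → Plane → ℝ) (t : ℝ) (x : Plane) : ℝ :=
  derivWithin (fun s => lineDeriv ℝ
    (fun y => lineDeriv ℝ (b s) y (EuclideanSpace.single 1 1)) x (EuclideanSpace.single 0 1))
    (Icc 0 T) t

/-- `u` is a classical solution on `[0, T] × ℝ²` of `∂²_t u - Δ u = f` with
`u(0, ·) = 0` and `∂_t u(0, ·) = 0`. -/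
structure IsWaveSolution (T : ℝ) (f u : ℝ → Plane → ℝ) : Prop where
  regular : ContDiffOn ℝ 2 (fun p : ℝ × Plane => u p.1 p.2) (Icc 0 T ×ˢ univ)
  equation : ∀ t ∈ Icc 0 T, ∀ x : Plane,
    iteratedDerivWithin 2 (fun s => u s x) (Icc 0 T) t - (Δ (u t)) x = f t x
  initial_value : ∀ x : Plane, u 0 x = 0
  initial_velocity : ∀ x : Plane, derivWithin (fun s => u s x) (Icc 0 T) 0 = 0

/-- The Wick square `ψ(t, y)² - 𝔼[ψ(t, y)²]`. -/
def wickSquare {Ω : Type*} [MeasurableSpace Ω] (P : Measure Ω) (ψ : Ω → ℝ → Plane → ℝ)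
    (ω : Ω) (t : ℝ) (y : Plane) : ℝ :=
  ψ ω t y ^ 2 - ∫ ω', ψ ω' t y ^ 2 ∂P

/-! ### Sobolev norms -/

/-- The norm of `𝒲^{s,2}(ℝ²)`, i.e. the `L²` norm of `𝓕⁻¹((1 + |·|²)^{s/2} 𝓕 g)`; it is `⊤` when
`g` is not in this space. -/
def sobolevNorm (s : ℝ) (g : 𝓢'(Plane, ℂ)) : ℝ≥0∞ :=
  ⨅ (k : Lp ℂ 2 (volume : Measure Plane))
    (_ : TemperedDistribution.besselPotential Plane ℂ s g = (k : 𝓢'(Plane, ℂ))), ‖k‖ₑ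

/-- The tempered distribution `g` coincides with the function `f` on the interior of `D`. -/
def AgreesOn (D : Set Plane) (g : 𝓢'(Plane, ℂ)) (f : Plane → ℝ) : Prop :=
  ∀ φ : 𝓢(Plane, ℂ), HasCompactSupport φ → tsupport φ ⊆ interior D →
    g φ = ∫ x, (f x : ℂ) * φ x

/-- The norm of the localized space `𝒲^{s,2}(D)` of restrictions to `D` of elements of
`𝒲^{s,2}(ℝ²)`: the infimum of the norms of the extensions of `f`; it is `⊤` when `f` has no
extension in `𝒲^{s,2}(ℝ²)`. -/
def localSobolevNorm (s : ℝ) (D : Set Plane) (f : Plane → ℝ) : ℝ≥0∞ :=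
  ⨅ (g : 𝓢'(Plane, ℂ)) (_ : AgreesOn D g f), sobolevNorm s g

end FractionalWave

end

open FractionalWave

/-! At a fixed time `t` the solution is a stationary Gaussian field in space, so the claim becomes a
statement about its spectral density. The noise passes linearly through the derivatives of the sheet
and through Kirchhoff's retarded integral, which represents every classical solution
(`IsWaveSolution.kirchhoff`). Hence Ψⁿ(t,x) = ∫ g(ζ) e^{i x·η} Ŵ(dζ) with g = c·S·γ. On the cutoff
|S| = ∏ |ζ_j|^{1/2 - H_j}, and with ρ = |η| ≠ 0 the multiplier is γ = ∫₀ᵗ ρ⁻¹ sin((t-s)ρ) e^{isξ} ds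
(`solution_isNoiseIntegral`, `waveMultiplier_eq_duhamel`).

By Wick's formula the Wick square has covariance 2 C(y,y')², where C(y,y') = ∫ |g|² cos((y-y')·η).
Expanding the square over two frequencies and dropping nonnegative terms bounds the variance of the
Wick square tested against φ from below by ∬ |g(ζ)|² |g(ζ')|² (∫ φ(y) cos((η-η')·y) dy)²
(`frequency_lower_bound`). If φ ≥ 0, two frequencies in a common small cube do not oscillate against
each other on the support of φ. So the variance is at least (½∫φ)² ∑_Q (∫_Q |g|²)² over disjoint
small cubes Q (`sum_sq_le_of_disjoint`).

Near the light cone ξ = ρ the wave equation resonates and |γ| is at least of order t/ρ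
(`norm_duhamel_ge`). There |g|² is at least of order x^{3 - 2(H₀+H₁+H₂)} x^{-2} ≥ 1/x at frequencies
of size x ≥ 1, exactly because H₀+H₁+H₂ ≤ 1. Cubes of a fixed side along the cone with first index j
have mass at least of order 1/j, and j of them are used. The sum of squared masses dominates ∑ j ·
j⁻², the harmonic series (`exists_finset_resonantCube`). Each finite collection of cubes lies in the
cutoff once `n` is large.

Testing against one fixed smooth bump supported inside `D` is controlled by a Sobolev norm of any
order, so no loss of regularity prevents the blow-up (`exists_enorm_integral_le_localSobolevNorm`).
Conversely, for fixed `n` a norm of nonpositive order is at most the L² norm on `D`, whose mean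
square is 2v²|D| with v the variance of the field; this gives finiteness. -/

noncomputable section

namespace FractionalWave

/-! ### Partial derivatives on the strip `[0, T] × ℝ²` -/

/-- The space-time strip `[0, T] × ℝ²`. -/
def strip (T : ℝ) : Set (ℝ × Plane) := Icc 0 T ×ˢ univ

/-- The time derivative on `[0, T]`, one-sided at the end points. -/
def timeD (T : ℝ) (u : ℝ → Plane → ℝ) (s : ℝ) (y : Plane) : ℝ :=
  derivWithin (fun σ => u σ y) (Icc 0 T) s

/-- The partial derivative in the `i`-th space coordinate. -/
def spaceD (i : Fin 2) (u : ℝ → Plane → ℝ) (s : ℝ) (y : Plane) : ℝ :=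
  lineDeriv ℝ (u s) y (EuclideanSpace.single i 1)

lemma uniqueDiffOn_strip {T : ℝ} (hT : 0 < T) : UniqueDiffOn ℝ (strip T) :=
  (uniqueDiffOn_Icc hT).prod uniqueDiffOn_univ

lemma mem_strip {T s : ℝ} {y : Plane} : (s, y) ∈ strip T ↔ s ∈ Icc 0 T := by simp [strip]

section
variable {T : ℝ} {u : ℝ → Plane → ℝ} {s : ℝ} {y : Plane}

lemma hasDerivWithinAt_time (hu : ContDiffOn ℝ 1 (fun p : ℝ × Plane => u p.1 p.2) (strip T))
    (hs : s ∈ Icc 0 T) : HasDerivWithinAt (fun σ => u σ y)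
      (fderivWithin ℝ (fun p : ℝ × Plane => u p.1 p.2) (strip T) (s, y) (1, 0)) (Icc 0 T) s := by
  have hd := ((hu.differentiableOn one_ne_zero) (s, y) (mem_strip.2 hs)).hasFDerivWithinAt
  have hp : HasDerivWithinAt (fun σ : ℝ => (σ, y)) ((1 : ℝ), (0 : Plane)) (Icc 0 T) s :=
    (hasDerivWithinAt_id _ _).prodMk (hasDerivWithinAt_const ..)
  exact hd.comp_hasDerivWithinAt s hp fun σ hσ => mem_strip.2 hσ

lemma timeD_eq (hT : 0 < T) (hu : ContDiffOn ℝ 1 (fun p : ℝ × Plane => u p.1 p.2) (strip T))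
    (hs : s ∈ Icc 0 T) :
    timeD T u s y = fderivWithin ℝ (fun p : ℝ × Plane => u p.1 p.2) (strip T) (s, y) (1, 0) :=
  (hasDerivWithinAt_time hu hs).derivWithin (uniqueDiffOn_Icc hT s hs)

lemma hasDerivWithinAt_timeD (hT : 0 < T)
    (hu : ContDiffOn ℝ 1 (fun p : ℝ × Plane => u p.1 p.2) (strip T)) (hs : s ∈ Icc 0 T) :
    HasDerivWithinAt (fun σ => u σ y) (timeD T u s y) (Icc 0 T) s := by
  rw [timeD_eq hT hu hs]
  exact hasDerivWithinAt_time hu hs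

lemma hasFDerivAt_space (hu : ContDiffOn ℝ 1 (fun p : ℝ × Plane => u p.1 p.2) (strip T))
    (hs : s ∈ Icc 0 T) : HasFDerivAt (u s)
      ((fderivWithin ℝ (fun p : ℝ × Plane => u p.1 p.2) (strip T) (s, y)).comp
        (ContinuousLinearMap.inr ℝ ℝ Plane)) y := by
  have hd := ((hu.differentiableOn one_ne_zero) (s, y) (mem_strip.2 hs)).hasFDerivWithinAt
  have := hd.comp (s := univ) y (hasFDerivAt_prodMk_right s y).hasFDerivWithinAt
    (fun z _ => mem_strip.2 hs)
  rwa [hasFDerivWithinAt_univ] at this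

lemma spaceD_eq (hu : ContDiffOn ℝ 1 (fun p : ℝ × Plane => u p.1 p.2) (strip T))
    (hs : s ∈ Icc 0 T) (i : Fin 2) :
    spaceD i u s y = fderivWithin ℝ (fun p : ℝ × Plane => u p.1 p.2) (strip T) (s, y)
      (0, EuclideanSpace.single i 1) := by
  rw [spaceD, ((hasFDerivAt_space hu hs).hasLineDerivAt _).lineDeriv]
  simp

lemma hasLineDerivAt_spaceD (hu : ContDiffOn ℝ 1 (fun p : ℝ × Plane => u p.1 p.2) (strip T))
    (hs : s ∈ Icc 0 T) (i : Fin 2) :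
    HasLineDerivAt ℝ (u s) (spaceD i u s y) y (EuclideanSpace.single i 1) := by
  have h := (hasFDerivAt_space (y := y) hu hs).hasLineDerivAt (EuclideanSpace.single i 1)
  rwa [← h.lineDeriv] at h

lemma contDiffOn_timeD (hT : 0 < T) {m n : WithTop ℕ∞} (hmn : m + 1 ≤ n)
    (hu : ContDiffOn ℝ n (fun p : ℝ × Plane => u p.1 p.2) (strip T)) :
    ContDiffOn ℝ m (fun p : ℝ × Plane => timeD T u p.1 p.2) (strip T) := by
  have h1 := (hu.fderivWithin (uniqueDiffOn_strip hT) hmn).clm_apply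
    (contDiffOn_const (c := ((1 : ℝ), (0 : Plane))))
  refine h1.congr fun p hp => ?_
  exact timeD_eq hT (hu.of_le (le_trans le_add_self hmn)) (mem_strip.1 hp)

lemma contDiffOn_spaceD (hT : 0 < T) {m n : WithTop ℕ∞} (hmn : m + 1 ≤ n) (i : Fin 2)
    (hu : ContDiffOn ℝ n (fun p : ℝ × Plane => u p.1 p.2) (strip T)) :
    ContDiffOn ℝ m (fun p : ℝ × Plane => spaceD i u p.1 p.2) (strip T) := by
  have h1 := (hu.fderivWithin (uniqueDiffOn_strip hT) hmn).clm_apply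
    (contDiffOn_const (c := ((0 : ℝ), (EuclideanSpace.single i 1 : Plane))))
  refine h1.congr fun p hp => ?_
  exact spaceD_eq (hu.of_le (le_trans le_add_self hmn)) (mem_strip.1 hp) i

lemma plane_eq_sum (v : Plane) :
    v = v 0 • EuclideanSpace.single 0 (1 : ℝ) + v 1 • EuclideanSpace.single 1 (1 : ℝ) := by
  ext i
  fin_cases i <;> simp

/-- The chain rule along a curve in the strip. -/
lemma hasDerivWithinAt_comp_curve (hT : 0 < T)
    (hu : ContDiffOn ℝ 1 (fun p : ℝ × Plane => u p.1 p.2) (strip T)) {I : Set ℝ} {a : ℝ → ℝ}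
    {γ : ℝ → Plane} {a' : ℝ} {γ' : Plane} {r : ℝ} (hr : r ∈ I) (ha : HasDerivWithinAt a a' I r)
    (hγ : HasDerivWithinAt γ γ' I r) (hI : MapsTo a I (Icc 0 T)) :
    HasDerivWithinAt (fun r => u (a r) (γ r))
      (a' * timeD T u (a r) (γ r) + (γ' 0 * spaceD 0 u (a r) (γ r) +
        γ' 1 * spaceD 1 u (a r) (γ r))) I r := by
  have hs : a r ∈ Icc 0 T := hI hr
  have hd := ((hu.differentiableOn one_ne_zero) (a r, γ r) (mem_strip.2 hs)).hasFDerivWithinAt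
  have h := hd.comp_hasDerivWithinAt r (ha.prodMk hγ) fun σ hσ => mem_strip.2 (hI hσ)
  convert! h using 1
  rw [timeD_eq hT hu hs, spaceD_eq hu hs, spaceD_eq hu hs]
  conv_rhs => rw [show (a', γ') = a' • ((1 : ℝ), (0 : Plane)) +
    (γ' 0 • ((0 : ℝ), (EuclideanSpace.single 0 1 : Plane)) +
      γ' 1 • ((0 : ℝ), (EuclideanSpace.single 1 1 : Plane))) by
        ext1
        · simp
        · simpa using plane_eq_sum γ']
  simp only [map_add, map_smul, smul_eq_mul]

lemma strip_mem_nhds (hs : s ∈ Ioo 0 T) : strip T ∈ 𝓝 (s, y) :=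
  prod_mem_nhds (Icc_mem_nhds hs.1 hs.2) univ_mem

/-- Time and space derivatives commute. -/
lemma timeD_spaceD_comm (hT : 0 < T)
    (hu : ContDiffOn ℝ 2 (fun p : ℝ × Plane => u p.1 p.2) (strip T)) (hs : s ∈ Ioo 0 T)
    (i : Fin 2) : timeD T (spaceD i u) s y = spaceD i (timeD T u) s y := by
  have hs' := Ioo_subset_Icc_self hs
  have hu1 := hu.of_le one_le_two
  have hn := strip_mem_nhds (y := y) hs
  have hat : ContDiffAt ℝ 2 (fun p : ℝ × Plane => u p.1 p.2) (s, y) := hu.contDiffAt hn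
  -- Symmetry of the second derivative needs a full neighbourhood of the point, hence the open time
  -- interval.
  have hsymm := hat.isSymmSndFDerivAt (by simp)
  have hdiff : DifferentiableAt ℝ (fderiv ℝ (fun p : ℝ × Plane => u p.1 p.2)) (s, y) :=
    (hat.fderiv_right (m := 1) (by norm_num)).differentiableAt one_ne_zero
  have key : ∀ (g : ℝ → Plane → ℝ) (v w : ℝ × Plane),
      (∀ z ∈ strip T, g z.1 z.2 = fderivWithin ℝ (fun p : ℝ × Plane => u p.1 p.2) (strip T) z v) →
      fderivWithin ℝ (fun p : ℝ × Plane => g p.1 p.2) (strip T) (s, y) w =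
        fderiv ℝ (fderiv ℝ (fun p : ℝ × Plane => u p.1 p.2)) (s, y) w v := by
    intro g v w hg
    rw [fderivWithin_of_mem_nhds hn]
    have : (fun p : ℝ × Plane => g p.1 p.2) =ᶠ[𝓝 (s, y)]
        fun z => fderiv ℝ (fun p : ℝ × Plane => u p.1 p.2) z v := by
      filter_upwards [eventually_mem_nhds_iff.2 hn] with z hz
      rw [hg z (mem_of_mem_nhds hz), fderivWithin_of_mem_nhds hz]
    rw [this.fderiv_eq, fderiv_clm_apply hdiff (differentiableAt_const _)]
    simp
  rw [timeD_eq hT (contDiffOn_spaceD hT (by norm_num) i hu) hs',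
    spaceD_eq (contDiffOn_timeD hT (by norm_num) hu) hs',
    key (spaceD i u) (0, EuclideanSpace.single i 1) (1, 0)
      fun z hz => spaceD_eq hu1 (mem_strip.1 hz) i,
    key (timeD T u) (1, 0) (0, EuclideanSpace.single i 1)
      fun z hz => timeD_eq hT hu1 (mem_strip.1 hz)]
  exact hsymm _ _

lemma contDiff_slice {n : WithTop ℕ∞}
    (hu : ContDiffOn ℝ n (fun p : ℝ × Plane => u p.1 p.2) (strip T)) (hs : s ∈ Icc 0 T) :
    ContDiff ℝ n (u s) := by
  have := hu.comp (s := univ) (f := fun y : Plane => (s, y)) (by fun_prop)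
    fun z _ => mem_strip.2 hs
  rwa [contDiffOn_univ] at this

/-- The Laplacian of a `C²` function on the plane as a sum of second partial derivatives. -/
lemma laplacian_eq_spaceD (hu : ContDiff ℝ 2 (u s)) :
    (Δ (u s)) y = spaceD 0 (spaceD 0 u) s y + spaceD 1 (spaceD 1 u) s y := by
  have h2 : ∀ i, spaceD i (spaceD i u) s y = fderiv ℝ (fderiv ℝ (u s)) y
      (EuclideanSpace.single i 1) (EuclideanSpace.single i 1) := by
    intro i
    have hd : DifferentiableAt ℝ (fderiv ℝ (u s)) y :=
      (hu.fderiv_right (m := 1) (by norm_num)).differentiable one_ne_zero y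
    have h1 : spaceD i u s = fun z => fderiv ℝ (u s) z (EuclideanSpace.single i 1) := by
      funext z
      exact ((hu.differentiable two_ne_zero z).hasFDerivAt.hasLineDerivAt _).lineDeriv
    rw [spaceD, h1]
    have h3 := ((hd.hasFDerivAt.clm_apply
      (hasFDerivAt_const (EuclideanSpace.single i (1 : ℝ)) y)).hasLineDerivAt
        (EuclideanSpace.single i 1)).lineDeriv
    rw [h3]
    simp
  rw [InnerProductSpace.laplacian_eq_iteratedFDeriv_orthonormalBasis (u s)
    (EuclideanSpace.basisFun (Fin 2) ℝ)]
  simp [Fin.sum_univ_two, h2, iteratedFDeriv_two_apply]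

lemma IsWaveSolution.equation' {f : ℝ → Plane → ℝ} (h : IsWaveSolution T f u)
    (hs : s ∈ Icc 0 T) :
    timeD T (timeD T u) s y - (spaceD 0 (spaceD 0 u) s y + spaceD 1 (spaceD 1 u) s y) = f s y := by
  rw [← h.equation s hs y, laplacian_eq_spaceD (contDiff_slice h.regular hs),
    iteratedDerivWithin_succ, iteratedDerivWithin_one]
  rfl

end

/-! ### Kirchhoff's formula -/

/-- The unit vector of the plane with angle `θ`. -/
def polarDir (θ : ℝ) : Plane := !₂[Real.cos θ, Real.sin θ]

/-- The projection to the plane of the point with spherical coordinates `(r, φ, θ)` around `x`. -/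
def spherePt (x : Plane) (r φ θ : ℝ) : Plane := x + (r * Real.sin φ) • polarDir θ

/-- The parameter domain of the ball of radius `t` in spherical coordinates. -/
def sphereBox (t : ℝ) : Set (ℝ × ℝ × ℝ) := Icc 0 t ×ˢ Icc 0 Real.pi ×ˢ Icc 0 (2 * Real.pi)

lemma isCompact_sphereBox (t : ℝ) : IsCompact (sphereBox t) :=
  isCompact_Icc.prod (isCompact_Icc.prod isCompact_Icc)

@[fun_prop]
lemma continuous_polarDir : Continuous polarDir := by
  unfold polarDir
  fun_prop

@[fun_prop]
lemma continuous_spherePt (x : Plane) :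
    Continuous fun z : ℝ × ℝ × ℝ => spherePt x z.1 z.2.1 z.2.2 := by
  unfold spherePt
  fun_prop

lemma hasDerivAt_polarDir (θ : ℝ) :
    HasDerivAt polarDir (!₂[-Real.sin θ, Real.cos θ] : Plane) θ := by
  have h : HasDerivAt (fun θ => (![Real.cos θ, Real.sin θ] : Fin 2 → ℝ))
      ![-Real.sin θ, Real.cos θ] θ := by
    rw [hasDerivAt_pi]
    intro i
    fin_cases i
    · exact Real.hasDerivAt_cos θ
    · exact Real.hasDerivAt_sin θ
  exact ((PiLp.continuousLinearEquiv 2 ℝ fun _ : Fin 2 => ℝ).symm.hasFDerivAt).comp_hasDerivAt θ h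

lemma hasDerivAt_spherePt_r (x : Plane) (r φ θ : ℝ) :
    HasDerivAt (fun r => spherePt x r φ θ) (Real.sin φ • polarDir θ) r := by
  have h := (((hasDerivAt_id r).mul_const (Real.sin φ)).smul_const (polarDir θ)).const_add x
  simpa [spherePt] using h

lemma hasDerivAt_spherePt_φ (x : Plane) (r φ θ : ℝ) :
    HasDerivAt (fun φ => spherePt x r φ θ) ((r * Real.cos φ) • polarDir θ) φ :=
  (((Real.hasDerivAt_sin φ).const_mul r).smul_const (polarDir θ)).const_add x

lemma hasDerivAt_spherePt_θ (x : Plane) (r φ θ : ℝ) :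
    HasDerivAt (fun θ => spherePt x r φ θ)
      ((r * Real.sin φ) • (!₂[-Real.sin θ, Real.cos θ] : Plane)) θ :=
  ((hasDerivAt_polarDir θ).const_smul (r * Real.sin φ)).const_add x

/-- Truncation of a time to `[0, t]`. -/
def clampTime (t s : ℝ) : ℝ := max 0 (min t s)

lemma clampTime_mem {t : ℝ} (ht : 0 ≤ t) (s : ℝ) : clampTime t s ∈ Icc 0 t :=
  ⟨le_max_left _ _, max_le ht (min_le_left _ _)⟩

lemma clampTime_of_mem {t s : ℝ} (hs : s ∈ Icc 0 t) : clampTime t s = s := by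
  rw [clampTime, min_eq_right hs.2, max_eq_right hs.1]

lemma continuous_clampTime (t : ℝ) : Continuous (clampTime t) := by
  unfold clampTime
  fun_prop

/-- The retarded value of `v` on the backward light cone with vertex `(t, x)`. -/
def retarded (v : ℝ → Plane → ℝ) (t : ℝ) (x : Plane) (z : ℝ × ℝ × ℝ) : ℝ :=
  v (clampTime t (t - z.1)) (spherePt x z.1 z.2.1 z.2.2)

/-- The clamp keeps the time argument in `[0, t]` for every `r`, so continuity of `v` on the strip
alone gives continuity on the whole parameter space, and Fubini and the fundamental theorem of
calculus apply without boundary cases. -/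
lemma continuous_retarded {T t : ℝ} {v : ℝ → Plane → ℝ} (ht : t ∈ Icc 0 T)
    (hv : ContinuousOn (fun p : ℝ × Plane => v p.1 p.2) (strip T)) (x : Plane) :
    Continuous (retarded v t x) := by
  refine hv.comp_continuous (f := fun z : ℝ × ℝ × ℝ =>
    (clampTime t (t - z.1), spherePt x z.1 z.2.1 z.2.2)) ?_ fun z => ?_
  · have := continuous_clampTime t
    fun_prop
  · exact mem_strip.2 ⟨(clampTime_mem ht.1 _).1, (clampTime_mem ht.1 _).2.trans ht.2⟩

lemma integrableOn_sphereBox {G : ℝ × ℝ × ℝ → ℝ} (hG : Continuous G) (t : ℝ) :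
    IntegrableOn G (sphereBox t) :=
  hG.continuousOn.integrableOn_compact (isCompact_sphereBox t)

lemma integral_sphereBox {G : ℝ × ℝ × ℝ → ℝ} (hG : Continuous G) {t : ℝ} (ht : 0 ≤ t) :
    ∫ z in sphereBox t, G z =
      ∫ r in 0..t, ∫ φ in 0..Real.pi, ∫ θ in 0..(2 * Real.pi), G (r, φ, θ) := by
  have hpi := Real.pi_pos.le
  rw [intervalIntegral.integral_of_le ht, ← integral_Icc_eq_integral_Ioc]
  have h1 := integrableOn_sphereBox hG t
  rw [sphereBox, Measure.volume_eq_prod] at h1 ⊢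
  rw [setIntegral_prod _ h1]
  congr 1
  funext r
  have h2 : IntegrableOn (fun w : ℝ × ℝ => G (r, w))
      (Icc 0 Real.pi ×ˢ Icc 0 (2 * Real.pi)) (volume.prod volume) :=
    (Continuous.continuousOn (by fun_prop)).integrableOn_compact
      (isCompact_Icc.prod isCompact_Icc)
  rw [Measure.volume_eq_prod, setIntegral_prod _ h2, intervalIntegral.integral_of_le hpi,
    ← integral_Icc_eq_integral_Ioc]
  congr 1
  funext φ
  rw [intervalIntegral.integral_of_le (by positivity), ← integral_Icc_eq_integral_Ioc]

lemma intervalIntegral_swap {F : ℝ × ℝ → ℝ} (hF : Continuous F) (a b c d : ℝ) :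
    ∫ x in a..b, ∫ y in c..d, F (x, y) = ∫ y in c..d, ∫ x in a..b, F (x, y) := by
  refine intervalIntegral_intervalIntegral_swap (F := fun x y => F (x, y)) ?_
  exact (hF.continuousOn.integrableOn_compact (isCompact_uIcc.prod isCompact_uIcc)).mono_set
    (prod_mono uIoc_subset_uIcc uIoc_subset_uIcc)

lemma continuous_intervalIntegral_of_continuous {X : Type*} [TopologicalSpace X]
    [FirstCountableTopology X] [LocallyCompactSpace X] {F : X × ℝ → ℝ} (hF : Continuous F)
    (a b : ℝ) : Continuous fun x => ∫ y in a..b, F (x, y) :=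
  intervalIntegral.continuous_parametric_intervalIntegral_of_continuous'
    (f := fun x y => F (x, y)) hF a b

lemma integral_sphereBox_zero_θ {G : ℝ × ℝ × ℝ → ℝ} (hG : Continuous G) {t : ℝ} (ht : 0 ≤ t)
    (h : ∀ r φ, ∫ θ in 0..(2 * Real.pi), G (r, φ, θ) = 0) : ∫ z in sphereBox t, G z = 0 := by
  simp [integral_sphereBox hG ht, h]

/-- Fubini makes `φ` the innermost variable; intended for `φ`-derivatives of functions vanishing at
both poles. -/
lemma integral_sphereBox_zero_φ {G : ℝ × ℝ × ℝ → ℝ} (hG : Continuous G) {t : ℝ} (ht : 0 ≤ t)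
    (h : ∀ r θ, ∫ φ in 0..Real.pi, G (r, φ, θ) = 0) : ∫ z in sphereBox t, G z = 0 := by
  rw [integral_sphereBox hG ht]
  have : ∀ r, ∫ φ in 0..Real.pi, ∫ θ in 0..(2 * Real.pi), G (r, φ, θ) = 0 := fun r => by
    rw [intervalIntegral_swap (F := fun w => G (r, w)) (by fun_prop)]
    simp [h]
  simp [this]

/-- Fubini makes `r` the innermost variable; the factor 4π is the area of the unit sphere, 2π from
`θ` times ∫ sin φ = 2. -/
lemma integral_sphereBox_r {G : ℝ × ℝ × ℝ → ℝ} (hG : Continuous G) {t : ℝ} (ht : 0 ≤ t)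
    {κ : ℝ} (h : ∀ φ θ, ∫ r in 0..t, G (r, φ, θ) = κ * Real.sin φ) :
    ∫ z in sphereBox t, G z = 4 * Real.pi * κ := by
  rw [integral_sphereBox hG ht]
  have h1 : ∫ r in 0..t, ∫ φ in 0..Real.pi, ∫ θ in 0..(2 * Real.pi), G (r, φ, θ) =
      ∫ φ in 0..Real.pi, ∫ r in 0..t, ∫ θ in 0..(2 * Real.pi), G (r, φ, θ) := by
    refine intervalIntegral_swap
      (F := fun w : ℝ × ℝ => ∫ θ in 0..(2 * Real.pi), G (w.1, w.2, θ)) ?_ _ _ _ _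
    exact continuous_intervalIntegral_of_continuous
      (F := fun q : (ℝ × ℝ) × ℝ => G (q.1.1, q.1.2, q.2)) (by fun_prop) _ _
  have h2 : ∀ φ, ∫ r in 0..t, ∫ θ in 0..(2 * Real.pi), G (r, φ, θ) =
      2 * Real.pi * (κ * Real.sin φ) := fun φ => by
    rw [intervalIntegral_swap (F := fun w => G (w.1, φ, w.2)) (by fun_prop)]
    simp only [h, intervalIntegral.integral_const, smul_eq_mul]
    ring
  rw [h1]
  simp only [h2, intervalIntegral.integral_const_mul, integral_sin]
  simp
  ring

/-- **Kirchhoff's formula** for the solution of the wave equation with vanishing initial data. -/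
theorem IsWaveSolution.kirchhoff {T : ℝ} {f u : ℝ → Plane → ℝ} (h : IsWaveSolution T f u)
    {t : ℝ} (ht : t ∈ Ioc 0 T) (x : Plane) :
    ∫ z in sphereBox t, z.1 * Real.sin z.2.1 * f (t - z.1) (spherePt x z.1 z.2.1 z.2.2) =
      4 * Real.pi * u t x := by
  have hT : 0 < T := ht.1.trans_le ht.2
  have ht0 : 0 ≤ t := ht.1.le
  have ht' : t ∈ Icc 0 T := ⟨ht0, ht.2⟩
  have hu2 : ContDiffOn ℝ 2 (fun p : ℝ × Plane => u p.1 p.2) (strip T) := h.regular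
  have hu1 := hu2.of_le one_le_two
  have hut := contDiffOn_timeD hT (m := 1) (by norm_num) hu2
  have hui := fun i => contDiffOn_spaceD hT (m := 1) (by norm_num) i hu2
  have hutt := contDiffOn_timeD hT (m := 0) (by norm_num) hut
  have hiut := fun i => contDiffOn_spaceD hT (m := 0) (by norm_num) i hut
  have htui := fun i => contDiffOn_timeD hT (m := 0) (by norm_num) (hui i)
  have hij := fun j i => contDiffOn_spaceD hT (m := 0) (by norm_num) j (hui i)
  have k0 := continuous_retarded ht' hu1.continuousOn x
  have kt := continuous_retarded ht' hut.continuousOn x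
  have ki := fun i => continuous_retarded ht' (hui i).continuousOn x
  have ktt := continuous_retarded ht' hutt.continuousOn x
  have kit := fun i => continuous_retarded ht' (hiut i).continuousOn x
  have kti := fun i => continuous_retarded ht' (htui i).continuousOn x
  have kij := fun j i => continuous_retarded ht' (hij j i).continuousOn x
  have ki0 := ki 0
  have ki1 := ki 1
  have kit0 := kit 0
  have kit1 := kit 1
  have kti0 := kti 0
  have kti1 := kti 1
  have k00 := kij 0 0
  have k01 := kij 0 1
  have k10 := kij 1 0
  have k11 := kij 1 1
  have hcl : ∀ s, clampTime t s ∈ Icc 0 T := fun s =>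
    ⟨(clampTime_mem ht0 s).1, (clampTime_mem ht0 s).2.trans ht.2⟩
  -- Extend `u` to three space variables, constant in the third, and put w(y) = u(t-|y|, x+y). The
  -- source over |y| is minus the divergence of ∇w/|y| + w y/|y|³ + 2 u_t y/|y|², with u_t at the
  -- retarded time. In spherical coordinates that divergence, times r² sin φ, is a + b + d, the
  -- `r`-, `φ`- and `θ`-derivatives of three fluxes. They are written out with all singular factors
  -- at r = 0 and sin φ = 0 cancelled.
  let a : ℝ × ℝ × ℝ → ℝ := fun z =>
    Real.sin z.2.1 * (-retarded (timeD T u) t x z +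
      Real.sin z.2.1 * (Real.cos z.2.2 * retarded (spaceD 0 u) t x z +
        Real.sin z.2.2 * retarded (spaceD 1 u) t x z) +
      (retarded (timeD T u) t x z + z.1 * (-retarded (timeD T (timeD T u)) t x z +
        Real.sin z.2.1 * (Real.cos z.2.2 * retarded (spaceD 0 (timeD T u)) t x z +
          Real.sin z.2.2 * retarded (spaceD 1 (timeD T u)) t x z))) +
      Real.sin z.2.1 * ((Real.cos z.2.2 * retarded (spaceD 0 u) t x z +
          Real.sin z.2.2 * retarded (spaceD 1 u) t x z) +
        z.1 * (Real.cos z.2.2 * (-retarded (timeD T (spaceD 0 u)) t x z +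
          Real.sin z.2.1 * (Real.cos z.2.2 * retarded (spaceD 0 (spaceD 0 u)) t x z +
            Real.sin z.2.2 * retarded (spaceD 1 (spaceD 0 u)) t x z)) +
         Real.sin z.2.2 * (-retarded (timeD T (spaceD 1 u)) t x z +
          Real.sin z.2.1 * (Real.cos z.2.2 * retarded (spaceD 0 (spaceD 1 u)) t x z +
            Real.sin z.2.2 * retarded (spaceD 1 (spaceD 1 u)) t x z)))))
  let b : ℝ × ℝ × ℝ → ℝ := fun z =>
    (Real.cos z.2.1 * Real.cos z.2.1 - Real.sin z.2.1 * Real.sin z.2.1) *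
        (Real.cos z.2.2 * retarded (spaceD 0 u) t x z +
        Real.sin z.2.2 * retarded (spaceD 1 u) t x z) +
      Real.sin z.2.1 * Real.cos z.2.1 * (z.1 * Real.cos z.2.1) *
       (Real.cos z.2.2 * (Real.cos z.2.2 * retarded (spaceD 0 (spaceD 0 u)) t x z +
            Real.sin z.2.2 * retarded (spaceD 1 (spaceD 0 u)) t x z) +
         Real.sin z.2.2 * (Real.cos z.2.2 * retarded (spaceD 0 (spaceD 1 u)) t x z +
            Real.sin z.2.2 * retarded (spaceD 1 (spaceD 1 u)) t x z))
  let d : ℝ × ℝ × ℝ → ℝ := fun z =>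
    -Real.cos z.2.2 * retarded (spaceD 0 u) t x z - Real.sin z.2.2 * retarded (spaceD 1 u) t x z +
      z.1 * Real.sin z.2.1 *
       (-Real.sin z.2.2 * (-Real.sin z.2.2 * retarded (spaceD 0 (spaceD 0 u)) t x z +
            Real.cos z.2.2 * retarded (spaceD 1 (spaceD 0 u)) t x z) +
         Real.cos z.2.2 * (-Real.sin z.2.2 * retarded (spaceD 0 (spaceD 1 u)) t x z +
            Real.cos z.2.2 * retarded (spaceD 1 (spaceD 1 u)) t x z))
  have ca : Continuous a := by fun_prop
  have cb : Continuous b := by fun_prop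
  have cd : Continuous d := by fun_prop
  have Ia : ∫ z in sphereBox t, a z = 4 * Real.pi * (-u t x) := by
    refine integral_sphereBox_r ca ht0 fun φ θ => ?_
    -- The radial flux r² sin φ · (∂_r w / r + w / r² + 2 u_t / r), where ∂_r w = -u_t + sin φ (cos
    -- θ ∂₀u + sin θ ∂₁u).
    let A : ℝ → ℝ := fun r => Real.sin φ * (u (t - r) (spherePt x r φ θ) +
      r * timeD T u (t - r) (spherePt x r φ θ) +
      Real.sin φ * (r * (Real.cos θ * spaceD 0 u (t - r) (spherePt x r φ θ) +
        Real.sin θ * spaceD 1 u (t - r) (spherePt x r φ θ))))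
    have hmaps : MapsTo (fun r => t - r) (Icc 0 t) (Icc 0 T) := fun r hr =>
      ⟨by linarith [hr.2], by linarith [hr.1, ht.2]⟩
    have hA : ∀ r ∈ Icc 0 t, HasDerivWithinAt A (a (r, φ, θ)) (Icc 0 t) r := by
      intro r hr
      have htime : HasDerivWithinAt (fun r => t - r) (-1) (Icc 0 t) r := by
        simpa using ((hasDerivAt_id r).const_sub t).hasDerivWithinAt
      have hch : ∀ v : ℝ → Plane → ℝ,
          ContDiffOn ℝ 1 (fun p : ℝ × Plane => v p.1 p.2) (strip T) →
          HasDerivWithinAt (fun r => v (t - r) (spherePt x r φ θ))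
            (-retarded (timeD T v) t x (r, φ, θ) +
              Real.sin φ * (Real.cos θ * retarded (spaceD 0 v) t x (r, φ, θ) +
                Real.sin θ * retarded (spaceD 1 v) t x (r, φ, θ))) (Icc 0 t) r := by
        intro v hv
        have := hasDerivWithinAt_comp_curve hT hv hr htime
          (hasDerivAt_spherePt_r x r φ θ).hasDerivWithinAt hmaps
        convert! this using 1
        simp only [retarded]
        rw [clampTime_of_mem ⟨by linarith [hr.2], by linarith [hr.1]⟩]
        simp [polarDir]
        ring
      have hid := hasDerivWithinAt_id r (Icc 0 t)
      have := (((hch u hu1).add (hid.mul (hch _ hut))).add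
        ((hid.mul (((hch _ (hui 0)).const_mul (Real.cos θ)).add
          ((hch _ (hui 1)).const_mul (Real.sin θ)))).const_mul (Real.sin φ))).const_mul (Real.sin φ)
      convert! this using 1
      simp only [a, retarded, id]
      rw [clampTime_of_mem ⟨by linarith [hr.2], by linarith [hr.1]⟩]
      simp
    rw [intervalIntegral.integral_eq_sub_of_hasDerivAt_of_le ht0
      (f := A) (fun r hr => (hA r hr).continuousWithinAt)
      (fun r hr => (hA r (Ioo_subset_Icc_self hr)).hasDerivAt (Icc_mem_nhds hr.1 hr.2))
      ((Continuous.intervalIntegrable (by fun_prop) _ _))]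
    -- At r = t the flux sees only the vanishing initial data; at r = 0 it is sin φ · u(t, x).
    have hz : (0 : ℝ) ∈ Icc 0 T := ⟨le_rfl, hT.le⟩
    have i0 : ∀ y, u 0 y = 0 := h.initial_value
    have it : ∀ y, timeD T u 0 y = 0 := h.initial_velocity
    have is : ∀ i y, spaceD i u 0 y = 0 := fun i y => by
      rw [spaceD, show u 0 = fun _ => (0 : ℝ) from funext i0]
      simp [lineDeriv]
    simp [A, i0, it, is, spherePt]
    ring
  have Ib : ∫ z in sphereBox t, b z = 0 := by
    refine integral_sphereBox_zero_φ cb ht0 fun r θ => ?_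
    have hB : ∀ φ, HasDerivAt (fun φ => Real.sin φ * Real.cos φ *
        (Real.cos θ * retarded (spaceD 0 u) t x (r, φ, θ) +
          Real.sin θ * retarded (spaceD 1 u) t x (r, φ, θ))) (b (r, φ, θ)) φ := by
      intro φ
      have hch : ∀ v : ℝ → Plane → ℝ,
          ContDiffOn ℝ 1 (fun p : ℝ × Plane => v p.1 p.2) (strip T) →
          HasDerivAt (fun φ => retarded v t x (r, φ, θ))
            ((r * Real.cos φ) * (Real.cos θ * retarded (spaceD 0 v) t x (r, φ, θ) +
                Real.sin θ * retarded (spaceD 1 v) t x (r, φ, θ))) φ := by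
        intro v hv
        have := hasDerivWithinAt_comp_curve hT hv (mem_univ φ)
          (hasDerivWithinAt_const φ univ (clampTime t (t - r)))
          (hasDerivAt_spherePt_φ x r φ θ).hasDerivWithinAt fun _ _ => hcl _
        rw [hasDerivWithinAt_univ] at this
        convert! this using 1
        simp [polarDir, retarded]
        ring
      have := ((Real.hasDerivAt_sin φ).mul (Real.hasDerivAt_cos φ)).mul
        (((hch _ (hui 0)).const_mul (Real.cos θ)).add ((hch _ (hui 1)).const_mul (Real.sin θ)))
      convert! this using 1
      simp only [b, Pi.add_apply, Pi.mul_apply]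
      ring
    rw [intervalIntegral.integral_eq_sub_of_hasDerivAt (fun φ _ => hB φ)
      (Continuous.intervalIntegrable (by fun_prop) _ _)]
    simp
  have Id : ∫ z in sphereBox t, d z = 0 := by
    refine integral_sphereBox_zero_θ cd ht0 fun r φ => ?_
    have hB : ∀ θ, HasDerivAt (fun θ =>
        -Real.sin θ * retarded (spaceD 0 u) t x (r, φ, θ) +
          Real.cos θ * retarded (spaceD 1 u) t x (r, φ, θ)) (d (r, φ, θ)) θ := by
      intro θ
      have hch : ∀ v : ℝ → Plane → ℝ,
          ContDiffOn ℝ 1 (fun p : ℝ × Plane => v p.1 p.2) (strip T) →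
          HasDerivAt (fun θ => retarded v t x (r, φ, θ))
            ((r * Real.sin φ) * (-Real.sin θ * retarded (spaceD 0 v) t x (r, φ, θ) +
                Real.cos θ * retarded (spaceD 1 v) t x (r, φ, θ))) θ := by
        intro v hv
        have := hasDerivWithinAt_comp_curve hT hv (mem_univ θ)
          (hasDerivWithinAt_const θ univ (clampTime t (t - r)))
          (hasDerivAt_spherePt_θ x r φ θ).hasDerivWithinAt fun _ _ => hcl _
        rw [hasDerivWithinAt_univ] at this
        convert! this using 1
        simp [retarded]
        ring
      have := ((Real.hasDerivAt_sin θ).neg.mul (hch _ (hui 0))).add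
        ((Real.hasDerivAt_cos θ).mul (hch _ (hui 1)))
      convert! this using 1
      simp only [d, Pi.neg_apply]
      ring
    rw [intervalIntegral.integral_eq_sub_of_hasDerivAt (fun θ _ => hB θ)
      (Continuous.intervalIntegrable (by fun_prop) _ _)]
    simp [retarded, spherePt, polarDir]
  have hid : ∀ z ∈ sphereBox t,
      z.1 * Real.sin z.2.1 * f (t - z.1) (spherePt x z.1 z.2.1 z.2.2) = -(a z + b z + d z) := by
    rintro ⟨r, φ, θ⟩ ⟨hr, -⟩
    let F : ℝ → ℝ := fun r => r * Real.sin φ * (retarded (timeD T (timeD T u)) t x (r, φ, θ) -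
      (retarded (spaceD 0 (spaceD 0 u)) t x (r, φ, θ) +
        retarded (spaceD 1 (spaceD 1 u)) t x (r, φ, θ)))
    have hF : Continuous F := by fun_prop
    have hG : Continuous fun r => -(a (r, φ, θ) + b (r, φ, θ) + d (r, φ, θ)) := by fun_prop
    -- The divergence identity uses commuting time and space derivatives, available only for 0 < t -
    -- r < T; the end points follow by continuity.
    have heq : EqOn F (fun r => -(a (r, φ, θ) + b (r, φ, θ) + d (r, φ, θ))) (Ioo 0 t) := by
      intro r hr
      have hcr : clampTime t (t - r) = t - r :=
        clampTime_of_mem ⟨by linarith [hr.2], by linarith [hr.1]⟩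
      have hsym : ∀ i, retarded (timeD T (spaceD i u)) t x (r, φ, θ) =
          retarded (spaceD i (timeD T u)) t x (r, φ, θ) := fun i => by
        simp only [retarded, hcr]
        exact timeD_spaceD_comm hT hu2 ⟨by linarith [hr.2], by linarith [hr.1, ht.2]⟩ i
      simp only [F, a, b, d, hsym]
      have h1 := Real.sin_sq_add_cos_sq φ
      have h2 := Real.sin_sq_add_cos_sq θ
      generalize Real.sin φ = S at *
      generalize Real.cos φ = C at *
      generalize Real.sin θ = s at *
      generalize Real.cos θ = c at *
      generalize retarded (timeD T (timeD T u)) t x (r, φ, θ) = vtt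
      generalize retarded (spaceD 0 (spaceD 0 u)) t x (r, φ, θ) = v00
      generalize retarded (spaceD 0 (spaceD 1 u)) t x (r, φ, θ) = v01
      generalize retarded (spaceD 1 (spaceD 0 u)) t x (r, φ, θ) = v10
      generalize retarded (spaceD 1 (spaceD 1 u)) t x (r, φ, θ) = v11
      generalize retarded (spaceD 0 u) t x (r, φ, θ) = v0
      generalize retarded (spaceD 1 u) t x (r, φ, θ) = v1
      -- The first relation cancels the first-order terms and merges the `r` and `φ` parts of the
      -- second derivative in the direction of `θ`; the second turns the two orthogonal second
      -- derivatives into the Laplacian.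
      linear_combination h1 * ((c * v0 + s * v1) +
        r * S * (c * (c * v00 + s * v10) + s * (c * v01 + s * v11))) +
        h2 * (r * S * (v00 + v11))
    have hcl' := heq.closure hF hG
    rw [closure_Ioo ht.1.ne] at hcl'
    have hcr : clampTime t (t - r) = t - r :=
      clampTime_of_mem ⟨by linarith [hr.2], by linarith [hr.1]⟩
    have hmem : t - r ∈ Icc 0 T := hcr ▸ hcl (t - r)
    refine Eq.trans ?_ (hcl' hr)
    simp only [F, retarded, hcr]
    rw [← h.equation' hmem]
  rw [setIntegral_congr_fun (isCompact_sphereBox t).measurableSet hid, integral_neg,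
    integral_add (f := fun z => a z + b z)
      (integrableOn_sphereBox (ca.add cb) t) (integrableOn_sphereBox cd t),
    integral_add (integrableOn_sphereBox ca t) (integrableOn_sphereBox cb t), Ia, Ib, Id]
  ring

/-! ### Random variables represented by the Fourier transform of the noise -/

section Noise
variable {Ω : Type*} [MeasurableSpace Ω] {P : Measure Ω}
  {W : Lp ℝ 2 (volume : Measure SpaceTime) → Ω → ℝ}

lemma IsWhiteNoise.memLp_two (hW : IsWhiteNoise P W) (f) : MemLp (W f) 2 P :=
  (hW.gaussian.hasGaussianLaw_eval f).memLp_two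

lemma IsWhiteNoise.covariance_inner (hW : IsWhiteNoise P W) (f g) :
    ∫ ω, W f ω * W g ω ∂P = inner ℝ f g := by
  rw [hW.covariance, L2.inner_def]
  exact integral_congr_ae (ae_of_all _ fun z => by simp [mul_comm])

/-- White noise is almost surely linear. -/
lemma IsWhiteNoise.linear (hW : IsWhiteNoise P W) (a b : ℝ) (f g) :
    W (a • f + b • g) =ᵐ[P] fun ω => a * W f ω + b * W g ω := by
  set h := a • f + b • g with hh
  have i1 := hW.memLp_two f
  have i2 := hW.memLp_two g
  have i3 := hW.memLp_two h
  have hm : ∀ u v, Integrable (fun ω => W u ω * W v ω) P := fun u v =>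
    (hW.memLp_two u).integrable_mul (hW.memLp_two v)
  have hL : MemLp (fun ω => W h ω - (a * W f ω + b * W g ω)) 2 P :=
    i3.sub ((i1.const_mul a).add (i2.const_mul b))
  -- Linearity follows from the covariance: the second moment of the defect is the squared L² norm
  -- of h - a f - b g, which is zero.
  have h0 : ∫ ω, (W h ω - (a * W f ω + b * W g ω)) ^ 2 ∂P = 0 := by
    have : (fun ω => (W h ω - (a * W f ω + b * W g ω)) ^ 2) = fun ω =>
        W h ω * W h ω + ((-2 * a) * (W h ω * W f ω) + ((-2 * b) * (W h ω * W g ω) +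
        (a ^ 2 * (W f ω * W f ω) + (2 * a * b * (W f ω * W g ω) + b ^ 2 * (W g ω * W g ω))))) := by
      funext ω
      ring
    rw [this, integral_add (hm _ _) (by fun_prop (disch := exact hm _ _)),
      integral_add ((hm _ _).const_mul _) (by fun_prop (disch := exact hm _ _)),
      integral_add ((hm _ _).const_mul _) (by fun_prop (disch := exact hm _ _)),
      integral_add ((hm _ _).const_mul _) (by fun_prop (disch := exact hm _ _)),
      integral_add ((hm _ _).const_mul _) ((hm _ _).const_mul _)]
    simp only [integral_const_mul, hW.covariance_inner]
    have hfg : inner ℝ g f = inner ℝ f g := real_inner_comm _ _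
    rw [hh]
    simp only [inner_add_left, inner_add_right, inner_smul_left, inner_smul_right, hfg]
    simp
    ring
  rw [integral_eq_zero_iff_of_nonneg (fun ω => sq_nonneg _) hL.integrable_sq] at h0
  filter_upwards [h0] with ω hω
  simp only [Pi.zero_apply] at hω
  nlinarith [pow_eq_zero_iff (two_ne_zero) |>.1 hω]

lemma compLp_lincomb (L : ℂ →L[ℝ] ℝ) (a b : ℝ) (f g : Lp ℂ 2 (volume : Measure SpaceTime)) :
    L.compLp (𝓕 ((a : ℂ) • f + (b : ℂ) • g)) = a • L.compLp (𝓕 f) + b • L.compLp (𝓕 g) := by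
  rw [FourierTransform.fourier_add, FourierTransform.fourier_smul, FourierTransform.fourier_smul]
  refine Lp.ext ?_
  filter_upwards [L.coeFn_compLp ((a : ℂ) • 𝓕 f + (b : ℂ) • 𝓕 g), L.coeFn_compLp (𝓕 f),
    L.coeFn_compLp (𝓕 g), Lp.coeFn_add ((a : ℂ) • 𝓕 f) ((b : ℂ) • 𝓕 g),
    Lp.coeFn_smul (a : ℂ) (𝓕 f), Lp.coeFn_smul (b : ℂ) (𝓕 g),
    Lp.coeFn_add (a • L.compLp (𝓕 f)) (b • L.compLp (𝓕 g)),
    Lp.coeFn_smul a (L.compLp (𝓕 f)), Lp.coeFn_smul b (L.compLp (𝓕 g))]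
    with z h1 h2 h3 h4 h5 h6 h7 h8 h9
  rw [h1, h7, Pi.add_apply, h8, h9, Pi.smul_apply, Pi.smul_apply, h2, h3, h4, Pi.add_apply, h5, h6,
    Pi.smul_apply, Pi.smul_apply, map_add]
  simp only [Complex.coe_smul, map_smul]

lemma IsWhiteNoise.fourierNoise_lincomb (hW : IsWhiteNoise P W) (a b : ℝ)
    (f g : Lp ℂ 2 (volume : Measure SpaceTime)) :
    fourierNoise W ((a : ℂ) • f + (b : ℂ) • g) =ᵐ[P]
      fun ω => a * fourierNoise W f ω + b * fourierNoise W g ω := by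
  filter_upwards [hW.linear a b (Complex.reCLM.compLp (𝓕 f)) (Complex.reCLM.compLp (𝓕 g)),
    hW.linear a b (Complex.imCLM.compLp (𝓕 f)) (Complex.imCLM.compLp (𝓕 g))] with ω h1 h2
  simp only [fourierNoise, complexNoise]
  rw [compLp_lincomb, compLp_lincomb, h1, h2]
  push_cast
  ring

lemma IsWhiteNoise.aemeasurable_fourierNoise (hW : IsWhiteNoise P W)
    (f : Lp ℂ 2 (volume : Measure SpaceTime)) : AEMeasurable (fourierNoise W f) P := by
  have h1 := hW.gaussian.aemeasurable (Complex.reCLM.compLp (𝓕 f))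
  have h2 := hW.gaussian.aemeasurable (Complex.imCLM.compLp (𝓕 f))
  unfold fourierNoise complexNoise
  fun_prop

lemma norm_sq_eq_integral {E : Type*} [NormedAddCommGroup E] [InnerProductSpace ℝ E]
    (f : Lp E 2 (volume : Measure SpaceTime)) : ‖f‖ ^ 2 = ∫ z, ‖f z‖ ^ 2 := by
  rw [← real_inner_self_eq_norm_sq, L2.inner_def]
  simp

/-- The isometry property of the noise. -/
lemma IsWhiteNoise.lintegral_fourierNoise (hW : IsWhiteNoise P W)
    (f : Lp ℂ 2 (volume : Measure SpaceTime)) :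
    ∫⁻ ω, ‖fourierNoise W f ω‖ₑ ^ 2 ∂P = ‖f‖ₑ ^ 2 := by
  set p := Complex.reCLM.compLp (𝓕 f) with hp
  set q := Complex.imCLM.compLp (𝓕 f) with hq
  have hn : ∀ ω, ‖fourierNoise W f ω‖ₑ ^ 2 = ENNReal.ofReal (W p ω * W p ω + W q ω * W q ω) := by
    intro ω
    rw [← ofReal_norm, ← ENNReal.ofReal_pow (norm_nonneg _), Complex.sq_norm, Complex.normSq_apply]
    simp [fourierNoise, complexNoise, hp, hq]
  have hm : ∀ u v, Integrable (fun ω => W u ω * W v ω) P := fun u v =>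
    (hW.memLp_two u).integrable_mul (hW.memLp_two v)
  simp_rw [hn]
  rw [← ofReal_integral_eq_lintegral_ofReal (f := fun ω => W p ω * W p ω + W q ω * W q ω)
    ((hm _ _).add (hm _ _))
    (ae_of_all _ fun ω => by dsimp only [Pi.zero_apply]; nlinarith [sq_nonneg (W p ω), sq_nonneg (W q ω)]),
    integral_add (hm _ _) (hm _ _), hW.covariance_inner, hW.covariance_inner,
    real_inner_self_eq_norm_sq, real_inner_self_eq_norm_sq, ← ofReal_norm,
    ← ENNReal.ofReal_pow (norm_nonneg _), ← Lp.norm_fourier_eq f]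
  congr 1
  simp_rw [norm_sq_eq_integral]
  rw [← integral_add]
  · refine integral_congr_ae ?_
    filter_upwards [Complex.reCLM.coeFn_compLp (𝓕 f), Complex.imCLM.coeFn_compLp (𝓕 f)]
      with z h1 h2
    rw [h1, h2, Complex.sq_norm (𝓕 f z), Complex.normSq_apply]
    simp
    ring
  · exact (Lp.memLp p).integrable_norm_pow two_ne_zero
  · exact (Lp.memLp q).integrable_norm_pow two_ne_zero

/-- The real random variable `X` is the integral `∫ k(ζ) Ŵ(dζ)`. -/
def IsNoiseIntegral (P : Measure Ω) (W : Lp ℝ 2 (volume : Measure SpaceTime) → Ω → ℝ)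
    (X : Ω → ℝ) (k : SpaceTime → ℂ) : Prop :=
  ∃ hk : MemLp k 2 (volume : Measure SpaceTime),
    ∀ᵐ ω ∂P, (X ω : ℂ) = fourierNoise W (hk.toLp k) ω

namespace IsNoiseIntegral
variable {X Y : Ω → ℝ} {k l : SpaceTime → ℂ}

lemma congr (h : IsNoiseIntegral P W X k) (hX : X =ᵐ[P] Y) : IsNoiseIntegral P W Y k := by
  obtain ⟨hk, h⟩ := h
  refine ⟨hk, ?_⟩
  filter_upwards [h, hX] with ω h1 h2
  rw [← h2, h1]

lemma lincomb (hW : IsWhiteNoise P W) (hX : IsNoiseIntegral P W X k)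
    (hY : IsNoiseIntegral P W Y l) (a b : ℝ) :
    IsNoiseIntegral P W (fun ω => a * X ω + b * Y ω) (fun ζ => a * k ζ + b * l ζ) := by
  obtain ⟨hk, hX⟩ := hX
  obtain ⟨hl, hY⟩ := hY
  refine ⟨(hk.const_mul a).add (hl.const_mul b), ?_⟩
  have : ((hk.const_mul (a : ℂ)).add (hl.const_mul (b : ℂ))).toLp _ =
    (a : ℂ) • hk.toLp k + (b : ℂ) • hl.toLp l := rfl
  filter_upwards [hX, hY, hW.fourierNoise_lincomb a b (hk.toLp k) (hl.toLp l)] with ω h1 h2 h3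
  have h4 : fourierNoise W (((hk.const_mul (a : ℂ)).add (hl.const_mul (b : ℂ))).toLp _) ω =
    a * fourierNoise W (hk.toLp k) ω + b * fourierNoise W (hl.toLp l) ω := by rw [this, h3]
  push_cast
  rw [h1, h2]
  exact h4.symm

lemma const_mul (hW : IsWhiteNoise P W) (hX : IsNoiseIntegral P W X k) (a : ℝ) :
    IsNoiseIntegral P W (fun ω => a * X ω) (fun ζ => a * k ζ) := by
  simpa using hX.lincomb hW hX a 0

lemma sum (hW : IsWhiteNoise P W) {ι : Type*} (s : Finset ι) (hs : s.Nonempty) (a : ι → ℝ)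
    {X : ι → Ω → ℝ} {k : ι → SpaceTime → ℂ} (h : ∀ i ∈ s, IsNoiseIntegral P W (X i) (k i)) :
    IsNoiseIntegral P W (fun ω => ∑ i ∈ s, a i * X i ω) (fun ζ => ∑ i ∈ s, a i * k i ζ) := by
  classical
  induction hs using Finset.Nonempty.cons_induction with
  | singleton i => simpa using (h i (by simp)).const_mul hW (a i)
  | cons i s hi hs ih =>
    have := (h i (by simp)).lincomb hW (ih fun j hj => h j (by simp [hj])) (a i) 1
    simpa only [Finset.sum_cons, one_mul, Complex.ofReal_one] using this

lemma aemeasurable (hW : IsWhiteNoise P W) (hX : IsNoiseIntegral P W X k) : AEMeasurable X P := by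
  obtain ⟨hk, hX⟩ := hX
  have h1 := Complex.measurable_re.comp_aemeasurable (hW.aemeasurable_fourierNoise (hk.toLp k))
  refine h1.congr ?_
  filter_upwards [hX] with ω h
  simp [← h]

/-- Since `X` is real it equals the real part of Ŵ(k), which is a single value W(Re 𝓕k) of the
Gaussian process. -/
lemma hasGaussianLaw (hW : IsWhiteNoise P W) (hX : IsNoiseIntegral P W X k) :
    HasGaussianLaw X P := by
  obtain ⟨hk, hX⟩ := hX
  refine (hW.gaussian.hasGaussianLaw_eval (Complex.reCLM.compLp (𝓕 (hk.toLp k)))).congr ?_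
  filter_upwards [hX] with ω h
  simpa [fourierNoise, complexNoise] using (congrArg Complex.re h).symm

lemma integral_eq_zero (hW : IsWhiteNoise P W) (hX : IsNoiseIntegral P W X k) :
    ∫ ω, X ω ∂P = 0 := by
  obtain ⟨hk, hX⟩ := hX
  rw [← hW.mean_zero (Complex.reCLM.compLp (𝓕 (hk.toLp k)))]
  refine integral_congr_ae ?_
  filter_upwards [hX] with ω h
  simpa [fourierNoise, complexNoise] using (congrArg Complex.re h)

lemma memLp_two (hW : IsWhiteNoise P W) (hX : IsNoiseIntegral P W X k) : MemLp X 2 P :=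
  (hX.hasGaussianLaw hW).memLp_two

lemma integral_sq (hW : IsWhiteNoise P W) (hX : IsNoiseIntegral P W X k) :
    ∫ ω, X ω ^ 2 ∂P = ∫ ζ, ‖k ζ‖ ^ 2 := by
  have hL := hX.memLp_two hW
  obtain ⟨hk, hX⟩ := hX
  have h1 := hW.lintegral_fourierNoise (hk.toLp k)
  rw [← ofReal_norm, ← ENNReal.ofReal_pow (norm_nonneg _), norm_sq_eq_integral] at h1
  have h2 : ∫⁻ ω, ‖fourierNoise W (hk.toLp k) ω‖ₑ ^ 2 ∂P = ∫⁻ ω, ENNReal.ofReal (X ω ^ 2) ∂P := by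
    refine lintegral_congr_ae ?_
    filter_upwards [hX] with ω h
    rw [← h, ← ofReal_norm, ← ENNReal.ofReal_pow (norm_nonneg _), Complex.norm_real,
      Real.norm_eq_abs, sq_abs]
  rw [h2, ← ofReal_integral_eq_lintegral_ofReal hL.integrable_sq
    (ae_of_all _ fun ω => sq_nonneg _), ENNReal.ofReal_eq_ofReal_iff
      (integral_nonneg fun _ => sq_nonneg _) (integral_nonneg fun _ => sq_nonneg _)] at h1
  rw [h1]
  refine integral_congr_ae ?_
  filter_upwards [hk.coeFn_toLp] with z hz
  rw [hz]

/-- The covariance of two noise integrals. -/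
lemma integral_mul (hW : IsWhiteNoise P W) (hX : IsNoiseIntegral P W X k)
    (hY : IsNoiseIntegral P W Y l) :
    ∫ ω, X ω * Y ω ∂P = ∫ ζ, (k ζ * (starRingEnd ℂ) (l ζ)).re := by
  have hp := (hX.lincomb hW hY 1 1).integral_sq hW
  have hm := (hX.lincomb hW hY 1 (-1)).integral_sq hW
  have hpi := ((hX.lincomb hW hY 1 1).memLp_two hW).integrable_sq
  have hmi := ((hX.lincomb hW hY 1 (-1)).memLp_two hW).integrable_sq
  obtain ⟨hpk, -⟩ := hX.lincomb hW hY 1 1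
  obtain ⟨hmk, -⟩ := hX.lincomb hW hY 1 (-1)
  -- Polarization on both sides reduces the covariance to the isometry for X + Y and X - Y.
  have e1 : ∫ ω, X ω * Y ω ∂P = (∫ ω, (1 * X ω + 1 * Y ω) ^ 2 ∂P -
      ∫ ω, (1 * X ω + (-1) * Y ω) ^ 2 ∂P) / 4 := by
    rw [← integral_sub hpi hmi, ← integral_div]
    congr 1
    funext ω
    ring
  rw [e1, hp, hm, ← integral_sub (hpk.integrable_norm_pow two_ne_zero)
    (hmk.integrable_norm_pow two_ne_zero), ← integral_div]
  congr 1
  funext ζ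
  simp only [Complex.sq_norm, Complex.normSq_apply]
  simp
  ring

/-- Stability of noise integrals under `L²`-convergence of the kernels. -/
lemma of_tendsto (hW : IsWhiteNoise P W) {X : ℕ → Ω → ℝ} {k : ℕ → SpaceTime → ℂ}
    (h : ∀ m, IsNoiseIntegral P W (X m) (k m)) (hl : MemLp l 2 (volume : Measure SpaceTime))
    (hkl : Tendsto (fun m => eLpNorm (fun ζ => k m ζ - l ζ) 2 (volume : Measure SpaceTime)) atTop
      (𝓝 0)) (hX : ∀ᵐ ω ∂P, Tendsto (fun m => X m ω) atTop (𝓝 (Y ω))) :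
    IsNoiseIntegral P W Y l := by
  refine ⟨hl, ?_⟩
  set Z := fourierNoise W (hl.toLp l) with hZ
  have hd : ∀ m, ∫⁻ ω, ‖(X m ω : ℂ) - Z ω‖ₑ ^ 2 ∂P =
      eLpNorm (fun ζ => k m ζ - l ζ) 2 (volume : Measure SpaceTime) ^ 2 := by
    intro m
    obtain ⟨hk, hX⟩ := h m
    have h1 := hW.fourierNoise_lincomb 1 (-1) (hk.toLp (k m)) (hl.toLp l)
    have h2 := hW.lintegral_fourierNoise
      (((1 : ℝ) : ℂ) • hk.toLp (k m) + ((-1 : ℝ) : ℂ) • hl.toLp l)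
    have h3 : ((1 : ℝ) : ℂ) • hk.toLp (k m) + ((-1 : ℝ) : ℂ) • hl.toLp l =
        (hk.sub hl).toLp _ := by
      rw [MemLp.toLp_sub hk hl, sub_eq_add_neg]
      simp
    rw [h3, Lp.enorm_toLp] at h2
    change _ = eLpNorm (k m - l) 2 _ ^ 2
    rw [← h2, ← h3]
    refine lintegral_congr_ae ?_
    filter_upwards [hX, h1] with ω h4 h5
    rw [h5, h4]
    simp [hZ, sub_eq_add_neg]
  have hZm := hW.aemeasurable_fourierNoise (hl.toLp l)
  have hmeas : ∀ m, AEMeasurable (fun ω => ‖(X m ω : ℂ) - Z ω‖ₑ ^ 2) P := fun m => by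
    have := (h m).aemeasurable hW
    fun_prop
  -- By the isometry `X m` converges in L² to the noise integral of `l`; Fatou's lemma identifies
  -- this limit with the almost sure limit `Y`.
  have hF := lintegral_liminf_le' (u := atTop) hmeas
  have h0 : liminf (fun m => ∫⁻ ω, ‖(X m ω : ℂ) - Z ω‖ₑ ^ 2 ∂P) atTop = 0 := by
    refine Tendsto.liminf_eq ?_
    simp_rw [hd]
    simpa using ENNReal.Tendsto.pow (n := 2) hkl
  have hY : AEMeasurable Y P :=
    aemeasurable_of_tendsto_metrizable_ae atTop (fun m => (h m).aemeasurable hW) hX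
  have hlim : ∀ᵐ ω ∂P, liminf (fun m => ‖(X m ω : ℂ) - Z ω‖ₑ ^ 2) atTop =
      ‖(Y ω : ℂ) - Z ω‖ₑ ^ 2 := by
    filter_upwards [hX] with ω h2
    refine Tendsto.liminf_eq ?_
    refine ENNReal.Tendsto.pow (Tendsto.enorm (Tendsto.sub_const ?_ _))
    exact (Complex.continuous_ofReal.tendsto _).comp h2
  rw [h0, nonpos_iff_eq_zero, lintegral_congr_ae hlim,
    lintegral_eq_zero_iff' (by fun_prop)] at hF
  filter_upwards [hF] with ω h1
  simpa [sub_eq_zero] using h1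

end IsNoiseIntegral

/-- Dominated convergence in `L²`. -/
lemma tendsto_eLpNorm_two_of_dominated {α : Type*} [MeasurableSpace α] {μ : Measure α}
    {k : ℕ → α → ℂ} {l : α → ℂ} {g : α → ℝ} (hk : ∀ m, AEStronglyMeasurable (k m) μ)
    (hl : AEStronglyMeasurable l μ)
    (hg : MemLp g 2 μ) (hkg : ∀ m z, ‖k m z‖ ≤ g z)
    (hkl : ∀ z, Tendsto (fun m => k m z) atTop (𝓝 (l z))) :
    Tendsto (fun m => eLpNorm (fun z => k m z - l z) 2 μ) atTop (𝓝 0) := by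
  have hlg : ∀ z, ‖l z‖ ≤ g z := fun z =>
    le_of_tendsto ((hkl z).norm) (Eventually.of_forall fun m => hkg m z)
  have h1 : Tendsto (fun m => ∫⁻ z, ‖k m z - l z‖ₑ ^ 2 ∂μ) atTop (𝓝 (∫⁻ _, 0 ∂μ)) := by
    -- Both terms are bounded by `g`, so the squared difference is at most (2g)².
    refine tendsto_lintegral_of_dominated_convergence' (fun z => ENNReal.ofReal (4 * g z ^ 2))
      (fun m => ((hk m).sub hl).enorm.pow_const 2) (fun m => ae_of_all _ fun z => ?_) ?_
      (ae_of_all _ fun z => ?_)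
    · dsimp only
      rw [← ofReal_norm, ← ENNReal.ofReal_pow (norm_nonneg _)]
      refine ENNReal.ofReal_le_ofReal ?_
      have := (norm_sub_le (k m z) (l z)).trans (add_le_add (hkg m z) (hlg z))
      nlinarith [norm_nonneg (k m z - l z)]
    · exact (hg.integrable_sq.const_mul 4).lintegral_lt_top.ne
    · have := (hkl z).sub_const (l z)
      simpa using ENNReal.Tendsto.pow (n := 2) this.enorm
  simp only [lintegral_zero] at h1
  have h2 : ∀ m, eLpNorm (fun z => k m z - l z) 2 μ =
      (∫⁻ z, ‖k m z - l z‖ₑ ^ 2 ∂μ) ^ (1 / 2 : ℝ) := fun m => by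
    rw [eLpNorm_eq_lintegral_rpow_enorm_toReal (by norm_num) (by norm_num)]
    simp
  simp_rw [h2]
  simpa using h1.ennrpow_const (1 / 2 : ℝ)

end Noise

/-! ### Integration of noise integrals over a compact parameter set -/

section Integrals
variable {Ω : Type*} [MeasurableSpace Ω] {P : Measure Ω}
  {W : Lp ℝ 2 (volume : Measure SpaceTime) → Ω → ℝ}

lemma integral_comp_simpleFunc {α E : Type*} [MeasurableSpace α] {ν : Measure α}
    [IsFiniteMeasure ν] [NormedAddCommGroup E] [NormedSpace ℝ E] [CompleteSpace E] {β : Type*}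
    (s : SimpleFunc α β) (g : β → E) :
    ∫ z, g (s z) ∂ν = ∑ y ∈ s.range, ν.real (s ⁻¹' {y}) • g y := by
  classical
  have h : ∀ z, g (s z) = ∑ y ∈ s.range, (s ⁻¹' {y}).indicator (fun _ => g y) z := by
    intro z
    rw [Finset.sum_eq_single (s z)]
    · simp
    · intro y _ hy
      exact indicator_of_notMem (fun h => hy (by simpa using h.symm)) _
    · simp
  simp_rw [h]
  rw [integral_finsetSum _ fun y _ =>
    (integrable_const (g y)).indicator (s.measurableSet_fiber y)]
  refine Finset.sum_congr rfl fun y _ => ?_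
  rw [integral_indicator_const _ (s.measurableSet_fiber y)]

/-- These are generalized Riemann sums: the identity is approximated by simple functions with values
in `K`, so that `g` is evaluated only where it is continuous and bounded. -/
lemma tendsto_integral_approxOn {E F : Type*} [PseudoEMetricSpace E] [MeasurableSpace E]
    [OpensMeasurableSpace E] [TopologicalSpace.SeparableSpace E] {ν : Measure E}
    {K : Set E} (hK : IsCompact K) (hKm : MeasurableSet K) (hν : ν K ≠ ⊤) {y₀ : E} (h₀ : y₀ ∈ K)
    [NormedAddCommGroup F] [NormedSpace ℝ F] {g : E → F} (hg : ContinuousOn g K) :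
    Tendsto (fun m => ∫ z in K, g (SimpleFunc.approxOn id measurable_id K y₀ h₀ m z) ∂ν) atTop
      (𝓝 (∫ z in K, g z ∂ν)) := by
  obtain ⟨C, hC⟩ := hK.exists_bound_of_continuousOn hg
  refine tendsto_integral_of_dominated_convergence (fun _ => C) (fun m => ?_) ?_ (fun m => ?_) ?_
  · exact ((SimpleFunc.approxOn id measurable_id K y₀ h₀ m).map g).stronglyMeasurable.aestronglyMeasurable
  · exact integrableOn_const hν
  · exact ae_of_all _ fun z => hC _ (SimpleFunc.approxOn_mem measurable_id h₀ m z)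
  · filter_upwards [ae_restrict_mem hKm] with z hz
    refine (hg z hz).tendsto.comp (tendsto_nhdsWithin_iff.2 ⟨?_, Eventually.of_forall fun m =>
      SimpleFunc.approxOn_mem measurable_id h₀ m z⟩)
    exact SimpleFunc.tendsto_approxOn measurable_id h₀ (subset_closure hz)

/-- Integrals over a compact parameter set of continuous families of noise integrals. -/
lemma IsNoiseIntegral.integral {E : Type*} [PseudoEMetricSpace E] [MeasurableSpace E]
    [OpensMeasurableSpace E] [TopologicalSpace.SeparableSpace E] {ν : Measure E}
    {K : Set E} (hK : IsCompact K) (hKm : MeasurableSet K) (hν : ν K ≠ ⊤) (hne : K.Nonempty)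
    (hW : IsWhiteNoise P W) {g : Ω → E → ℝ} (hg : ∀ᵐ ω ∂P, ContinuousOn (g ω) K)
    {M : SpaceTime → ℂ} (hM : MemLp M 2 (volume : Measure SpaceTime)) {q : E → SpaceTime → ℂ}
    {C : ℝ} (hqC : ∀ z ∈ K, ∀ ζ, ‖q z ζ‖ ≤ C) (hq : ∀ ζ, ContinuousOn (fun z => q z ζ) K)
    (h : ∀ z ∈ K, IsNoiseIntegral P W (fun ω => g ω z) (fun ζ => M ζ * q z ζ)) :
    IsNoiseIntegral P W (fun ω => ∫ z in K, g ω z ∂ν) (fun ζ => M ζ * ∫ z in K, q z ζ ∂ν) := by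
  obtain ⟨y₀, h₀⟩ := hne
  have : IsFiniteMeasure (ν.restrict K) := ⟨by simpa using hν.lt_top⟩
  let s := SimpleFunc.approxOn id measurable_id K y₀ h₀
  have hs : ∀ m, ∀ y ∈ (s m).range, y ∈ K := by
    intro m y hy
    obtain ⟨z, rfl⟩ := SimpleFunc.mem_range.1 hy
    exact SimpleFunc.approxOn_mem measurable_id h₀ m z
  have hmem : ∀ m z, s m z ∈ K := fun m z => SimpleFunc.approxOn_mem measurable_id h₀ m z
  have hsum : ∀ m, IsNoiseIntegral P W (fun ω => ∫ z in K, g ω (s m z) ∂ν)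
      (fun ζ => M ζ * ∫ z in K, q (s m z) ζ ∂ν) := by
    intro m
    -- A Riemann sum is a finite linear combination of noise integrals. The kernels are dominated by
    -- a multiple of |M|, so `of_tendsto` passes to the limit.
    have := IsNoiseIntegral.sum hW (s m).range ⟨s m y₀, SimpleFunc.mem_range_self _ _⟩
      (fun y => (ν.restrict K).real (s m ⁻¹' {y})) fun y hy => h y (hs m y hy)
    convert! this using 2 with ω ζ
    · rw [integral_comp_simpleFunc (s m) (g ω)]
      rfl
    · rename_i ζ
      rw [integral_comp_simpleFunc (s m) fun z => q z ζ, Finset.mul_sum]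
      refine Finset.sum_congr rfl fun y _ => ?_
      rw [Complex.real_smul]
      ring
  have hmeas : ∀ m, AEStronglyMeasurable (fun ζ => M ζ * ∫ z in K, q (s m z) ζ ∂ν)
      (volume : Measure SpaceTime) := fun m => (hsum m).1.1
  have hlim : ∀ ζ, Tendsto (fun m => M ζ * ∫ z in K, q (s m z) ζ ∂ν) atTop
      (𝓝 (M ζ * ∫ z in K, q z ζ ∂ν)) := fun ζ =>
    (tendsto_integral_approxOn hK hKm hν h₀ (hq ζ)).const_mul _
  have hmeas' : AEStronglyMeasurable (fun ζ => M ζ * ∫ z in K, q z ζ ∂ν)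
      (volume : Measure SpaceTime) :=
    aestronglyMeasurable_of_tendsto_ae atTop hmeas (ae_of_all _ hlim)
  have hb : ∀ (e : E → E), (∀ z ∈ K, e z ∈ K) → ∀ ζ, ‖M ζ * ∫ z in K, q (e z) ζ ∂ν‖ ≤
      ‖M ζ‖ * (C * (ν.restrict K).real univ) := by
    intro e he ζ
    rw [norm_mul]
    gcongr
    refine norm_integral_le_of_norm_le_const ?_
    filter_upwards [ae_restrict_mem hKm] with z hz
    exact hqC _ (he z hz) ζ
  have hdom : MemLp (fun ζ => ‖M ζ‖ * (C * (ν.restrict K).real univ)) 2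
      (volume : Measure SpaceTime) := hM.norm.mul_const _
  refine of_tendsto hW hsum (hdom.mono' hmeas' (ae_of_all _ (hb id fun z hz => hz))) ?_ ?_
  · exact tendsto_eLpNorm_two_of_dominated hmeas hmeas' hdom
      (fun m ζ => hb (s m) (fun z _ => hmem m z) ζ) hlim
  · filter_upwards [hg] with ω hω
    exact tendsto_integral_approxOn hK hKm hν h₀ hω

end Integrals

/-! ### The mixed derivative of the sheet as a noise integral -/

section Factor

/-- The derivative `i u e^{iau} / |u|^{h + 1/2}` of the one-dimensional kernel in `a`. -/
def harmonizableDeriv (h a u : ℝ) : ℂ :=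
  Complex.I * u * Complex.exp (Complex.I * ((a * u : ℝ) : ℂ)) / ((|u| ^ (h + 1 / 2) : ℝ) : ℂ)

lemma hasDerivAt_harmonizableFactor (h a u : ℝ) :
    HasDerivAt (fun a => harmonizableFactor h a u) (harmonizableDeriv h a u) a := by
  unfold harmonizableFactor harmonizableDeriv
  have h1 : HasDerivAt (fun a : ℝ => Complex.I * ((a * u : ℝ) : ℂ)) (Complex.I * u) a := by
    have := (((hasDerivAt_id a).mul_const u).ofReal_comp).const_mul Complex.I
    simpa using this
  have := (h1.cexp.sub_const 1).div_const ((|u| ^ (h + 1 / 2) : ℝ) : ℂ)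
  convert! this using 1
  ring

/-- One power of |u| is gained from the numerator: 1 - (h + 1/2) = 1/2 - h. At u = 0 the hypothesis
forces z = 0. -/
lemma norm_div_rpow_le {z : ℂ} {C u h : ℝ} (hz : ‖z‖ ≤ C * |u|) (hC : 0 ≤ C) :
    ‖z / ((|u| ^ (h + 1 / 2) : ℝ) : ℂ)‖ ≤ C * |u| ^ (1 / 2 - h) := by
  rcases eq_or_ne u 0 with rfl | hu
  · have : z = 0 := by simpa using hz
    rw [this]
    simp only [zero_div, norm_zero]
    positivity
  · have hu' : 0 < |u| := abs_pos.mpr hu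
    rw [norm_div, Complex.norm_real, Real.norm_eq_abs, abs_of_nonneg (by positivity),
      div_le_iff₀ (by positivity), mul_assoc, ← Real.rpow_add hu']
    have h4 : 1 / 2 - h + (h + 1 / 2) = 1 := by ring
    rwa [h4, Real.rpow_one]

lemma norm_exp_sub_exp_le (a b u : ℝ) :
    ‖Complex.exp (Complex.I * ((b * u : ℝ) : ℂ)) - Complex.exp (Complex.I * ((a * u : ℝ) : ℂ))‖ ≤
      |b - a| * |u| := by
  have h1 : Complex.exp (Complex.I * ((b * u : ℝ) : ℂ)) - Complex.exp (Complex.I * ((a * u : ℝ) : ℂ))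
      = Complex.exp (Complex.I * ((a * u : ℝ) : ℂ)) *
        (Complex.exp (Complex.I * (((b - a) * u : ℝ) : ℂ)) - 1) := by
    rw [mul_sub, ← Complex.exp_add]
    congr 2
    · push_cast
      ring
    · ring
  rw [h1, norm_mul, Complex.norm_exp_I_mul_ofReal, one_mul, ← abs_mul]
  exact Real.norm_exp_I_mul_ofReal_sub_one_le

lemma norm_harmonizableFactor_le (h a u : ℝ) :
    ‖harmonizableFactor h a u‖ ≤ |a| * |u| ^ (1 / 2 - h) := by
  refine norm_div_rpow_le ?_ (abs_nonneg a)
  simpa using norm_exp_sub_exp_le 0 a u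

lemma norm_harmonizableDeriv_le (h a u : ℝ) :
    ‖harmonizableDeriv h a u‖ ≤ |u| ^ (1 / 2 - h) := by
  have := norm_div_rpow_le (z := Complex.I * u * Complex.exp (Complex.I * ((a * u : ℝ) : ℂ)))
    (C := 1) (u := u) (h := h) (by simp [Complex.norm_exp_I_mul_ofReal, -Complex.ofReal_mul])
    zero_le_one
  rw [one_mul] at this
  exact this

/-- The bound does not depend on `a` or `b`, so it dominates all difference quotients when the
kernel is differentiated. -/
lemma norm_slope_harmonizableFactor_le (h a b u : ℝ) (hab : b ≠ a) :
    ‖(((b - a)⁻¹ : ℝ) : ℂ) * (harmonizableFactor h b u - harmonizableFactor h a u)‖ ≤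
      |u| ^ (1 / 2 - h) := by
  have hba : 0 < |b - a| := abs_pos.2 (sub_ne_zero.2 hab)
  have h1 : harmonizableFactor h b u - harmonizableFactor h a u =
      (Complex.exp (Complex.I * ((b * u : ℝ) : ℂ)) - Complex.exp (Complex.I * ((a * u : ℝ) : ℂ))) /
        ((|u| ^ (h + 1 / 2) : ℝ) : ℂ) := by
    unfold harmonizableFactor
    ring
  rw [h1, norm_mul, Complex.norm_real, Real.norm_eq_abs, abs_inv, inv_mul_le_iff₀ hba]
  exact norm_div_rpow_le (norm_exp_sub_exp_le a b u) (abs_nonneg _)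

lemma measurable_harmonizableDeriv (h a : ℝ) : Measurable (harmonizableDeriv h a) := by
  unfold harmonizableDeriv
  fun_prop

variable {Ω : Type*} [MeasurableSpace Ω] {P : Measure Ω}
  {W : Lp ℝ 2 (volume : Measure SpaceTime) → Ω → ℝ}

/-- Differentiation of noise integrals in a parameter of the harmonizable kernel. -/
lemma IsNoiseIntegral.deriv_factor (hW : IsWhiteNoise P W) {F : SpaceTime → ℂ} {j : Fin 3} {h : ℝ}
    (hF : AEStronglyMeasurable F (volume : Measure SpaceTime)) {g : SpaceTime → ℝ}
    (hg : MemLp g 2 (volume : Measure SpaceTime))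
    (hFg : ∀ ζ, ‖F ζ‖ * |ζ j| ^ (1 / 2 - h) ≤ g ζ) {X : ℝ → Ω → ℝ} {S : Set ℝ}
    (hX : ∀ a ∈ S, IsNoiseIntegral P W (X a) fun ζ => F ζ * harmonizableFactor h a (ζ j))
    {a : ℝ} (ha : a ∈ S) {b : ℕ → ℝ} (hbS : ∀ m, b m ∈ S) (hba : ∀ m, b m ≠ a)
    (hb : Tendsto b atTop (𝓝 a)) {Y : Ω → ℝ}
    (hY : ∀ᵐ ω ∂P, Tendsto (fun m => (b m - a)⁻¹ * (X (b m) ω - X a ω)) atTop (𝓝 (Y ω))) :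
    IsNoiseIntegral P W Y fun ζ => F ζ * harmonizableDeriv h a (ζ j) := by
  have hj : Measurable fun ζ : SpaceTime => ζ j := by fun_prop
  have h1 : ∀ m, IsNoiseIntegral P W (fun ω => (b m - a)⁻¹ * (X (b m) ω - X a ω))
      fun ζ => F ζ * ((((b m - a)⁻¹ : ℝ) : ℂ) *
        (harmonizableFactor h (b m) (ζ j) - harmonizableFactor h a (ζ j))) := by
    intro m
    have := (hX _ (hbS m)).lincomb hW (hX a ha) (b m - a)⁻¹ (-(b m - a)⁻¹)
    convert! this using 2
    · ring
    · push_cast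
      ring
  have hlim : ∀ ζ : SpaceTime, Tendsto (fun m => F ζ * ((((b m - a)⁻¹ : ℝ) : ℂ) *
        (harmonizableFactor h (b m) (ζ j) - harmonizableFactor h a (ζ j)))) atTop
      (𝓝 (F ζ * harmonizableDeriv h a (ζ j))) := by
    intro ζ
    refine Tendsto.const_mul _ ?_
    have h2 := (hasDerivAt_iff_tendsto_slope.1 (hasDerivAt_harmonizableFactor h a (ζ j))).comp
      (tendsto_nhdsWithin_iff.2 ⟨hb, Eventually.of_forall hba⟩)
    refine h2.congr fun m => ?_
    simp [slope, Complex.real_smul]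
  have hmeas : AEStronglyMeasurable (fun ζ : SpaceTime => F ζ * harmonizableDeriv h a (ζ j))
      (volume : Measure SpaceTime) :=
    hF.mul ((measurable_harmonizableDeriv h a).comp hj).aestronglyMeasurable
  refine of_tendsto hW h1 ?_ ?_ hY
  · refine hg.mono' hmeas (ae_of_all _ fun ζ => ?_)
    rw [norm_mul]
    exact (mul_le_mul_of_nonneg_left (norm_harmonizableDeriv_le _ _ _) (norm_nonneg _)).trans (hFg ζ)
  · refine tendsto_eLpNorm_two_of_dominated (fun m => (h1 m).1.1) hmeas hg (fun m ζ => ?_) hlim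
    rw [norm_mul]
    exact (mul_le_mul_of_nonneg_left (norm_slope_harmonizableFactor_le _ _ _ _ (hba m))
      (norm_nonneg _)).trans (hFg ζ)

end Factor

/-! ### The frequency side -/

/-- The weight `∏ |ζ_j|^{1/2 - H_j}` on the frequency cutoff. -/
def sheetWeight (H : Fin 3 → ℝ) (n : ℕ) : SpaceTime → ℝ :=
  (freqCutoff n).indicator fun ζ =>
    |ζ 0| ^ (1 / 2 - H 0) * |ζ 1| ^ (1 / 2 - H 1) * |ζ 2| ^ (1 / 2 - H 2)

/-- The symbol `∏ i ζ_j / |ζ_j|^{H_j + 1/2}` on the frequency cutoff. -/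
def sheetSymbol (H : Fin 3 → ℝ) (n : ℕ) : SpaceTime → ℂ :=
  (freqCutoff n).indicator fun ζ =>
    harmonizableDeriv (H 0) 0 (ζ 0) * harmonizableDeriv (H 1) 0 (ζ 1) *
      harmonizableDeriv (H 2) 0 (ζ 2)

/-- The phase `sξ + y·η`. -/
def phase (s : ℝ) (y : Plane) (ζ : SpaceTime) : ℝ := s * ζ 0 + y 0 * ζ 1 + y 1 * ζ 2

lemma integrable_abs_rpow {h : ℝ} (hh : h < 1) (R : ℝ) :
    Integrable ((Icc (-R) R).indicator fun u : ℝ => |u| ^ (1 - 2 * h)) := by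
  have hp : IntegrableOn (fun u : ℝ => |u| ^ (1 - 2 * h)) (Ioc 0 R) := by
    have := (intervalIntegral.intervalIntegrable_rpow' (a := 0) (b := R)
      (show (-1 : ℝ) < 1 - 2 * h by linarith)).1
    refine this.congr_fun (fun u hu => ?_) measurableSet_Ioc
    simp only [abs_of_pos hu.1]
  have hn : IntegrableOn (fun u : ℝ => |u| ^ (1 - 2 * h)) (Ico (-R) 0) := by
    have := ((Measure.measurePreserving_neg (volume : Measure ℝ)).integrableOn_comp_preimage
      (Homeomorph.neg ℝ).measurableEmbedding (f := fun u : ℝ => |u| ^ (1 - 2 * h))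
      (s := Ioc 0 R)).2 hp
    simpa [Function.comp_def] using this
  have h1 : IntegrableOn (fun u : ℝ => |u| ^ (1 - 2 * h)) (Icc (-R) R) := by
    refine ((hn.union hp).union
      (integrableOn_singleton (x := (0 : ℝ)) (by simp) (by simp))).mono_set fun u hu => ?_
    rcases lt_trichotomy u 0 with h0 | h0 | h0
    · exact Or.inl (Or.inl ⟨hu.1, h0⟩)
    · exact Or.inr h0
    · exact Or.inl (Or.inr ⟨h0, hu.2⟩)
  exact h1.integrable_indicator measurableSet_Icc

lemma measurable_coord (i : Fin 3) : Measurable fun ζ : SpaceTime => ζ i := by fun_prop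

lemma measurable_sheetWeight (H : Fin 3 → ℝ) (n : ℕ) : Measurable (sheetWeight H n) := by
  refine Measurable.indicator ?_ (measurableSet_freqCutoff n)
  have := measurable_coord
  fun_prop

/-- The squared weight is at most a product of the one-dimensional functions |u|^{1-2H_i} on a
bounded box containing the cutoff; each is integrable at 0 because H_i < 1. -/
lemma memLp_sheetWeight {H : Fin 3 → ℝ} (hH : ∀ i, H i ∈ Ioo (0 : ℝ) 1) (n : ℕ) :
    MemLp (sheetWeight H n) 2 (volume : Measure SpaceTime) := by
  rw [memLp_two_iff_integrable_sq (measurable_sheetWeight H n).aestronglyMeasurable]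
  have hprod : Integrable fun z : Fin 3 → ℝ => ∏ i, (Icc (-(2 : ℝ) ^ n) (2 ^ n)).indicator
      (fun u : ℝ => |u| ^ (1 - 2 * H i)) (z i) :=
    Integrable.fintype_prod fun i => integrable_abs_rpow (hH i).2 _
  have hcomp := (PiLp.volume_preserving_ofLp (Fin 3)).integrable_comp_of_integrable hprod
  refine hcomp.mono' ((measurable_sheetWeight H n).pow_const 2).aestronglyMeasurable
    (ae_of_all _ fun ζ => ?_)
  rw [Real.norm_of_nonneg (by positivity)]
  by_cases hζ : ζ ∈ freqCutoff n
  · have h1 : |ζ 1| ≤ 2 ^ n := (Real.abs_le_sqrt (by nlinarith [sq_nonneg (ζ 2)])).trans hζ.2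
    have h2 : |ζ 2| ≤ 2 ^ n := (Real.abs_le_sqrt (by nlinarith [sq_nonneg (ζ 1)])).trans hζ.2
    have i0 : ζ 0 ∈ Icc (-(2 : ℝ) ^ n) (2 ^ n) := abs_le.mp hζ.1
    have i1 : ζ 1 ∈ Icc (-(2 : ℝ) ^ n) (2 ^ n) := abs_le.mp h1
    have i2 : ζ 2 ∈ Icc (-(2 : ℝ) ^ n) (2 ^ n) := abs_le.mp h2
    have hsq : ∀ i, (|ζ i| ^ (1 / 2 - H i)) ^ 2 = |ζ i| ^ (1 - 2 * H i) := fun i => by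
      rw [← Real.rpow_natCast, ← Real.rpow_mul (abs_nonneg _)]
      congr 1
      push_cast
      ring
    simp only [Function.comp_apply, Fin.prod_univ_three]
    rw [indicator_of_mem i0, indicator_of_mem i1, indicator_of_mem i2, sheetWeight,
      indicator_of_mem hζ, mul_pow, mul_pow, hsq, hsq, hsq]
  · rw [sheetWeight, indicator_of_notMem hζ]
    simp only [ne_eq, OfNat.ofNat_ne_zero, not_false_eq_true, zero_pow]
    exact Finset.prod_nonneg fun i _ => indicator_nonneg (fun u _ => by positivity) _

lemma measurable_sheetSymbol (H : Fin 3 → ℝ) (n : ℕ) : Measurable (sheetSymbol H n) := by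
  refine Measurable.indicator ?_ (measurableSet_freqCutoff n)
  exact (((measurable_harmonizableDeriv _ _).comp (measurable_coord 0)).mul
    ((measurable_harmonizableDeriv _ _).comp (measurable_coord 1))).mul
      ((measurable_harmonizableDeriv _ _).comp (measurable_coord 2))

lemma norm_sheetSymbol_le (H : Fin 3 → ℝ) (n : ℕ) (ζ) :
    ‖sheetSymbol H n ζ‖ ≤ sheetWeight H n ζ := by
  by_cases hζ : ζ ∈ freqCutoff n
  · rw [sheetSymbol, sheetWeight, indicator_of_mem hζ, indicator_of_mem hζ, norm_mul, norm_mul]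
    gcongr <;> exact norm_harmonizableDeriv_le _ _ _
  · simp [sheetSymbol, sheetWeight, hζ]

lemma memLp_sheetSymbol {H : Fin 3 → ℝ} (hH : ∀ i, H i ∈ Ioo (0 : ℝ) 1) (n : ℕ) :
    MemLp (sheetSymbol H n) 2 (volume : Measure SpaceTime) :=
  (memLp_sheetWeight hH n).mono' (measurable_sheetSymbol H n).aestronglyMeasurable
    (ae_of_all _ (norm_sheetSymbol_le H n))

/-- After differentiation the parameter enters only through a unimodular factor; this makes the
driving noise and the solution stationary in space. -/
lemma harmonizableDeriv_eq (h a u : ℝ) : harmonizableDeriv h a u =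
    harmonizableDeriv h 0 u * Complex.exp (Complex.I * ((a * u : ℝ) : ℂ)) := by
  simp only [harmonizableDeriv]
  simp
  ring

/-! ### The driving noise and the solution as noise integrals -/

section Sheet
variable {Ω : Type*} [MeasurableSpace Ω] {P : Measure Ω}
  {W : Lp ℝ 2 (volume : Measure SpaceTime) → Ω → ℝ} {c : ℝ} {H : Fin 3 → ℝ}
  {hH : ∀ i, H i ∈ Ioo (0 : ℝ) 1} {n : ℕ} {T : ℝ} {b : Ω → ℝ → Plane → ℝ}

lemma IsSheetApproximation.isNoiseIntegral (hW : IsWhiteNoise P W) (hc : c ≠ 0)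
    (hb : IsSheetApproximation P W c H hH n T b) {s : ℝ} (hs : s ∈ Icc 0 T) (y : Plane) :
    IsNoiseIntegral P W (fun ω => b ω s y) fun ζ => c * sheetKernel H n s y ζ := by
  have h1 : IsNoiseIntegral P W (fun ω => c⁻¹ * b ω s y) (sheetKernel H n s y) := by
    refine ⟨memLp_sheetKernel H hH n s y, ?_⟩
    filter_upwards [hb.formula s hs y] with ω h
    push_cast
    rw [h, ← mul_assoc, inv_mul_cancel₀ (by exact_mod_cast hc), one_mul]
    rfl
  refine (h1.const_mul hW c).congr (ae_of_all _ fun ω => ?_)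
  simp only
  rw [mul_inv_cancel_left₀ hc]

/-- Space derivatives of a field of noise integrals. -/
lemma IsNoiseIntegral.spaceD (hW : IsWhiteNoise P W) {v : Ω → ℝ → Plane → ℝ} {s : ℝ} {i : Fin 2}
    {y : Plane} (hv : ∀ᵐ ω ∂P,
      HasLineDerivAt ℝ (v ω s) (spaceD i (v ω) s y) y (EuclideanSpace.single i 1))
    {F : SpaceTime → ℂ} {j : Fin 3} {h : ℝ}
    (hF : AEStronglyMeasurable F (volume : Measure SpaceTime)) {g : SpaceTime → ℝ}
    (hg : MemLp g 2 (volume : Measure SpaceTime))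
    (hFg : ∀ ζ, ‖F ζ‖ * |ζ j| ^ (1 / 2 - h) ≤ g ζ)
    (hX : ∀ a : ℝ, IsNoiseIntegral P W
      (fun ω => v ω s (y + (a - y i) • EuclideanSpace.single i 1))
      fun ζ => F ζ * harmonizableFactor h a (ζ j)) :
    IsNoiseIntegral P W (fun ω => FractionalWave.spaceD i (v ω) s y)
      fun ζ => F ζ * harmonizableDeriv h (y i) (ζ j) := by
  have hpos : ∀ m : ℕ, (0 : ℝ) < 1 / ((m : ℝ) + 1) := fun m => Nat.one_div_pos_of_nat
  refine IsNoiseIntegral.deriv_factor hW hF hg hFg (S := univ) (fun a _ => hX a) (mem_univ (y i))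
    (b := fun m : ℕ => y i + 1 / ((m : ℝ) + 1)) (fun _ => mem_univ _)
    (fun m => by simpa using (hpos m).ne') ?_ ?_
  · simpa using (tendsto_one_div_add_atTop_nhds_zero_nat (𝕜 := ℝ)).const_add (y i)
  · filter_upwards [hv] with ω hω
    have h1 := hasDerivAt_iff_tendsto_slope.1 hω
    have h2 := h1.comp (tendsto_nhdsWithin_iff.2
      ⟨tendsto_one_div_add_atTop_nhds_zero_nat (𝕜 := ℝ),
        Eventually.of_forall fun m => (hpos m).ne'⟩)
    refine h2.congr fun m => ?_
    simp [slope]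

/-- The time derivative is one-sided at the end points, so its difference quotients must use times
in `[0, T]`. Moving from `s` towards an end point different from `s` provides them. -/
lemma exists_seq_Icc_ne {T s : ℝ} (hT : 0 < T) (hs : s ∈ Icc 0 T) :
    ∃ b : ℕ → ℝ, (∀ m, b m ∈ Icc 0 T) ∧ (∀ m, b m ≠ s) ∧ Tendsto b atTop (𝓝 s) := by
  obtain ⟨p, hp, hps⟩ : ∃ p ∈ Icc 0 T, p ≠ s := by
    by_cases h : s = 0
    · exact ⟨T, ⟨hT.le, le_rfl⟩, by rw [h]; exact hT.ne'⟩
    · exact ⟨0, ⟨le_rfl, hT.le⟩, fun h' => h h'.symm⟩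
  have hpos : ∀ m : ℕ, (0 : ℝ) < 1 / ((m : ℝ) + 1) := fun m => Nat.one_div_pos_of_nat
  have hle : ∀ m : ℕ, 1 / ((m : ℝ) + 1) ≤ 1 := fun m => by
    rw [div_le_one (by positivity)]
    linarith [Nat.cast_nonneg (α := ℝ) m]
  refine ⟨fun m => s + 1 / ((m : ℝ) + 1) * (p - s), fun m => ?_, fun m => ?_, ?_⟩
  · have := (convex_Icc 0 T).add_smul_sub_mem hs hp ⟨(hpos m).le, hle m⟩
    simpa using this
  · simpa using ⟨Nat.cast_add_one_ne_zero m, sub_ne_zero.2 hps⟩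
  · have := ((tendsto_one_div_add_atTop_nhds_zero_nat (𝕜 := ℝ)).mul_const (p - s)).const_add s
    simpa using this

lemma IsSheetApproximation.smooth' (hb : IsSheetApproximation P W c H hH n T b) :
    ∀ᵐ ω ∂P, ContDiffOn ℝ 3 (fun p : ℝ × Plane => b ω p.1 p.2) (strip T) := by
  filter_upwards [hb.smooth] with ω h
  exact contDiffOn_infty.1 h 3

/-- The mixed derivative of the sheet as a noise integral. -/
lemma IsSheetApproximation.mixedDeriv_isNoiseIntegral (hW : IsWhiteNoise P W) (hc : c ≠ 0)
    (hT : 0 < T) (hb : IsSheetApproximation P W c H hH n T b) {s : ℝ} (hs : s ∈ Icc 0 T)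
    (y : Plane) :
    IsNoiseIntegral P W (fun ω => mixedDeriv T (b ω) s y)
      fun ζ => c * sheetSymbol H n ζ * Complex.exp (Complex.I * (phase s y ζ : ℂ)) := by
  -- The cutoff is split off so that the kernel becomes a product in which one factor at a time is
  -- differentiated, in the order of `mixedDeriv`: second space variable, first space variable,
  -- time.
  let χ : SpaceTime → ℂ := (freqCutoff n).indicator 1
  have hχ : Measurable χ := measurable_one.indicator (measurableSet_freqCutoff n)
  have mF : ∀ (i : Fin 3) a, Measurable fun ζ : SpaceTime => harmonizableFactor (H i) a (ζ i) :=
    fun i a => (measurable_harmonizableFactor _ _).comp (measurable_coord i)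
  have mD : ∀ (i : Fin 3) a, Measurable fun ζ : SpaceTime => harmonizableDeriv (H i) a (ζ i) :=
    fun i a => (measurable_harmonizableDeriv _ _).comp (measurable_coord i)
  have hχw : ∀ ζ, ‖χ ζ‖ * (|ζ 0| ^ (1 / 2 - H 0) * |ζ 1| ^ (1 / 2 - H 1) * |ζ 2| ^ (1 / 2 - H 2)) =
      sheetWeight H n ζ := by
    intro ζ
    by_cases hζ : ζ ∈ freqCutoff n <;> simp [χ, sheetWeight, hζ]
  have hA : ∀ s ∈ Icc 0 T, ∀ y : Plane, IsNoiseIntegral P W (fun ω => b ω s y)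
      fun ζ => c * χ ζ * harmonizableFactor (H 0) s (ζ 0) * harmonizableFactor (H 1) (y 0) (ζ 1) *
        harmonizableFactor (H 2) (y 1) (ζ 2) := by
    intro s hs y
    convert! hb.isNoiseIntegral hW hc hs y using 2 with ζ
    by_cases hζ : ζ ∈ freqCutoff n <;> simp [χ, sheetKernel, hζ]
    ring
  have hB : ∀ s ∈ Icc 0 T, ∀ y : Plane, IsNoiseIntegral P W (fun ω => spaceD 1 (b ω) s y)
      fun ζ => c * χ ζ * harmonizableFactor (H 0) s (ζ 0) * harmonizableFactor (H 1) (y 0) (ζ 1) *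
        harmonizableDeriv (H 2) (y 1) (ζ 2) := by
    intro s hs y
    refine IsNoiseIntegral.spaceD hW ?_ ?_
      ((memLp_sheetWeight hH n).const_mul (|c| * |s| * |y 0|)) (fun ζ => ?_) (fun a => ?_)
    · filter_upwards [hb.smooth'] with ω h
      exact hasLineDerivAt_spaceD (h.of_le (by norm_num)) hs 1
    · exact (((hχ.const_mul (c : ℂ)).mul (mF 0 s)).mul (mF 1 (y 0))).aestronglyMeasurable
    · rw [← hχw, norm_mul, norm_mul, norm_mul, Complex.norm_real, Real.norm_eq_abs]
      calc _ ≤ |c| * ‖χ ζ‖ * (|s| * |ζ 0| ^ (1 / 2 - H 0)) * (|y 0| * |ζ 1| ^ (1 / 2 - H 1)) *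
            |ζ 2| ^ (1 / 2 - H 2) := by
            gcongr <;> exact norm_harmonizableFactor_le _ _ _
        _ = _ := by ring
    · convert! hA s hs (y + (a - y 1) • EuclideanSpace.single 1 1) using 2
      simp
  have hC : ∀ s ∈ Icc 0 T, ∀ y : Plane,
      IsNoiseIntegral P W (fun ω => spaceD 0 (spaceD 1 (b ω)) s y)
      fun ζ => c * χ ζ * harmonizableFactor (H 0) s (ζ 0) * harmonizableDeriv (H 2) (y 1) (ζ 2) *
        harmonizableDeriv (H 1) (y 0) (ζ 1) := by
    intro s hs y
    refine IsNoiseIntegral.spaceD (v := fun ω => spaceD 1 (b ω)) hW ?_ ?_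
      ((memLp_sheetWeight hH n).const_mul (|c| * |s|)) (fun ζ => ?_) (fun a => ?_)
    · filter_upwards [hb.smooth'] with ω h
      exact hasLineDerivAt_spaceD (contDiffOn_spaceD hT (by norm_num) 1 h) hs 0
    · exact (((hχ.const_mul (c : ℂ)).mul (mF 0 s)).mul (mD 2 (y 1))).aestronglyMeasurable
    · rw [← hχw, norm_mul, norm_mul, norm_mul, Complex.norm_real, Real.norm_eq_abs]
      calc _ ≤ |c| * ‖χ ζ‖ * (|s| * |ζ 0| ^ (1 / 2 - H 0)) * |ζ 2| ^ (1 / 2 - H 2) *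
            |ζ 1| ^ (1 / 2 - H 1) := by
            gcongr
            · exact norm_harmonizableFactor_le _ _ _
            · exact norm_harmonizableDeriv_le _ _ _
        _ = _ := by ring
    · convert! hB s hs (y + (a - y 0) • EuclideanSpace.single 0 1) using 2
      simp
      ring
  obtain ⟨σ, hσ, hσs, hσl⟩ := exists_seq_Icc_ne hT hs
  have hD : IsNoiseIntegral P W (fun ω => timeD T (spaceD 0 (spaceD 1 (b ω))) s y)
      fun ζ => c * χ ζ * harmonizableDeriv (H 2) (y 1) (ζ 2) *
        harmonizableDeriv (H 1) (y 0) (ζ 1) * harmonizableDeriv (H 0) s (ζ 0) := by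
    refine IsNoiseIntegral.deriv_factor hW ?_ ((memLp_sheetWeight hH n).const_mul |c|)
      (fun ζ => ?_) (S := Icc 0 T) (X := fun s ω => spaceD 0 (spaceD 1 (b ω)) s y)
      (fun a ha => ?_) hs hσ hσs hσl ?_
    · exact (((hχ.const_mul (c : ℂ)).mul (mD 2 (y 1))).mul (mD 1 (y 0))).aestronglyMeasurable
    · rw [← hχw, norm_mul, norm_mul, norm_mul, Complex.norm_real, Real.norm_eq_abs]
      calc _ ≤ |c| * ‖χ ζ‖ * |ζ 2| ^ (1 / 2 - H 2) * |ζ 1| ^ (1 / 2 - H 1) *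
            |ζ 0| ^ (1 / 2 - H 0) := by
            gcongr <;> exact norm_harmonizableDeriv_le _ _ _
        _ = _ := by ring
    · convert! hC a ha y using 2
      ring
    · filter_upwards [hb.smooth'] with ω h
      have h1 : ContDiffOn ℝ 1 (fun p : ℝ × Plane => spaceD 0 (spaceD 1 (b ω)) p.1 p.2) (strip T) :=
        contDiffOn_spaceD hT (n := 2) (by norm_num) 0 (contDiffOn_spaceD hT (by norm_num) 1 h)
      have h2 := (hasDerivWithinAt_iff_tendsto_slope.1 (hasDerivWithinAt_timeD (y := y) hT h1 hs)).comp
        (tendsto_nhdsWithin_iff.2 ⟨hσl, Eventually.of_forall fun m => ⟨hσ m, hσs m⟩⟩)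
      refine h2.congr fun m => ?_
      simp [slope]
  convert! hD using 2
  rename_i ζ
  rw [harmonizableDeriv_eq (H 0) s, harmonizableDeriv_eq (H 1) (y 0), harmonizableDeriv_eq (H 2) (y 1)]
  have he : Complex.exp (Complex.I * (phase s y ζ : ℂ)) =
      Complex.exp (Complex.I * ((s * ζ 0 : ℝ) : ℂ)) * Complex.exp (Complex.I * ((y 0 * ζ 1 : ℝ) : ℂ))
        * Complex.exp (Complex.I * ((y 1 * ζ 2 : ℝ) : ℂ)) := by
    rw [← Complex.exp_add, ← Complex.exp_add, phase]
    congr 1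
    push_cast
    ring
  rw [he]
  by_cases hζ : ζ ∈ freqCutoff n
  · simp only [χ, sheetSymbol, indicator_of_mem hζ, Pi.one_apply]
    ring
  · simp [χ, sheetSymbol, hζ]

/-- The multiplier of the wave equation, applied to the plane wave of frequency `ζ`. -/
def waveMultiplier (t : ℝ) (ζ : SpaceTime) : ℂ :=
  ((1 / (4 * Real.pi) : ℝ) : ℂ) * ∫ z in sphereBox t, ((z.1 * Real.sin z.2.1 : ℝ) : ℂ) *
    Complex.exp (Complex.I * (phase (t - z.1) (spherePt 0 z.1 z.2.1 z.2.2) ζ : ℂ))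

/-- The solution of the wave equation as a noise integral. -/
lemma IsSheetApproximation.solution_isNoiseIntegral (hW : IsWhiteNoise P W) (hc : c ≠ 0)
    (hb : IsSheetApproximation P W c H hH n T b) {ψ : Ω → ℝ → Plane → ℝ}
    (hψ : ∀ᵐ ω ∂P, IsWaveSolution T (mixedDeriv T (b ω)) (ψ ω)) {t : ℝ} (ht : t ∈ Ioc 0 T)
    (x : Plane) :
    IsNoiseIntegral P W (fun ω => ψ ω t x) fun ζ =>
      c * sheetSymbol H n ζ * waveMultiplier t ζ * Complex.exp (Complex.I * (phase 0 x ζ : ℂ)) := by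
  have hT : 0 < T := ht.1.trans_le ht.2
  have hK := isCompact_sphereBox t
  have hsub : ∀ z ∈ sphereBox t, t - z.1 ∈ Icc 0 T := fun z hz =>
    ⟨by linarith [hz.1.2], by linarith [hz.1.1, ht.2]⟩
  have hcont : ∀ᵐ ω ∂P, ContinuousOn (fun z : ℝ × ℝ × ℝ => z.1 * Real.sin z.2.1 *
      mixedDeriv T (b ω) (t - z.1) (spherePt x z.1 z.2.1 z.2.2)) (sphereBox t) := by
    filter_upwards [hb.smooth'] with ω h
    have h1 : ContDiffOn ℝ 0 (fun p : ℝ × Plane => mixedDeriv T (b ω) p.1 p.2) (strip T) :=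
      contDiffOn_timeD hT (n := 1) (by norm_num) (contDiffOn_spaceD hT (n := 2) (by norm_num) 0
        (contDiffOn_spaceD hT (by norm_num) 1 h))
    have h2 : ContinuousOn (fun z : ℝ × ℝ × ℝ => (t - z.1, spherePt x z.1 z.2.1 z.2.2))
        (sphereBox t) := Continuous.continuousOn (by fun_prop)
    have h3 := h1.continuousOn.comp h2 fun z hz => mem_strip.2 (hsub z hz)
    exact (Continuous.continuousOn (by fun_prop)).mul h3
  -- Kirchhoff's integral of the driving noise; the weight r |sin φ| is at most `t`, hence the
  -- constant `C`.
  have hint := IsNoiseIntegral.integral (ν := volume) (K := sphereBox t) hK hK.measurableSet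
    hK.measure_lt_top.ne ⟨(0, 0, 0), by
      simp [sphereBox, ht.1.le, Real.pi_pos.le]⟩ hW hcont
    ((memLp_sheetSymbol hH n).const_mul (c : ℂ)) (C := t)
    (q := fun z ζ => ((z.1 * Real.sin z.2.1 : ℝ) : ℂ) *
      Complex.exp (Complex.I * (phase (t - z.1) (spherePt x z.1 z.2.1 z.2.2) ζ : ℂ)))
    (fun z hz ζ => ?_) (fun ζ => ?_) (fun z hz => ?_)
  · have hπ := (hint.const_mul hW (1 / (4 * Real.pi))).congr (Y := fun ω => ψ ω t x) (by
      filter_upwards [hψ] with ω h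
      rw [h.kirchhoff ht x]
      field_simp)
    convert! hπ using 2 with ζ
    have h1 : ∀ z : ℝ × ℝ × ℝ, ((z.1 * Real.sin z.2.1 : ℝ) : ℂ) *
        Complex.exp (Complex.I * (phase (t - z.1) (spherePt x z.1 z.2.1 z.2.2) ζ : ℂ)) =
        ((z.1 * Real.sin z.2.1 : ℝ) : ℂ) *
        Complex.exp (Complex.I * (phase (t - z.1) (spherePt 0 z.1 z.2.1 z.2.2) ζ : ℂ)) *
        Complex.exp (Complex.I * (phase 0 x ζ : ℂ)) := by
      intro z
      rw [mul_assoc, ← Complex.exp_add, ← mul_add, ← Complex.ofReal_add]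
      congr 4
      simp [phase, spherePt]
      ring
    simp_rw [h1, integral_mul_const, waveMultiplier]
    ring
  · rw [norm_mul, Complex.norm_exp_I_mul_ofReal, mul_one, Complex.norm_real, Real.norm_eq_abs,
      abs_mul, abs_of_nonneg hz.1.1]
    calc z.1 * |Real.sin z.2.1| ≤ t * 1 := mul_le_mul hz.1.2 (Real.abs_sin_le_one _)
          (abs_nonneg _) ht.1.le
      _ = t := mul_one t
  · refine Continuous.continuousOn ?_
    have : Continuous fun z : ℝ × ℝ × ℝ => phase (t - z.1) (spherePt x z.1 z.2.1 z.2.2) ζ := by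
      unfold phase
      have := continuous_spherePt x
      fun_prop
    fun_prop
  · convert! (hb.mixedDeriv_isNoiseIntegral hW hc hT (hsub z hz)
      (spherePt x z.1 z.2.1 z.2.2)).const_mul hW (z.1 * Real.sin z.2.1) using 2
    ring

end Sheet

/-! ### Plane waves -/

section PlaneWave

/-- The cosine integral `∫_0^t cos(sρ) e^{isξ} ds` of Duhamel's formula. -/
def duhamelCos (ξ ρ t : ℝ) : ℂ :=
  ∫ s in 0..t, (Real.cos (s * ρ) : ℂ) * Complex.exp (Complex.I * ((s * ξ : ℝ) : ℂ))

/-- The sine integral `∫_0^t sin(sρ) e^{isξ} ds` of Duhamel's formula. -/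
def duhamelSin (ξ ρ t : ℝ) : ℂ :=
  ∫ s in 0..t, (Real.sin (s * ρ) : ℂ) * Complex.exp (Complex.I * ((s * ξ : ℝ) : ℂ))

/-- The solution of `D'' + ρ² D = e^{itξ}`, `D(0) = D'(0) = 0`. -/
def duhamel (ξ ρ t : ℝ) : ℂ :=
  (Real.sin (t * ρ) * duhamelCos ξ ρ t - Real.cos (t * ρ) * duhamelSin ξ ρ t) / ρ

/-- The derivative of `duhamel`. -/
def duhamelDeriv (ξ ρ t : ℝ) : ℂ :=
  Real.cos (t * ρ) * duhamelCos ξ ρ t + Real.sin (t * ρ) * duhamelSin ξ ρ t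

variable {ξ ρ : ℝ}

lemma hasDerivAt_duhamelCos (t : ℝ) : HasDerivAt (duhamelCos ξ ρ)
    (Real.cos (t * ρ) * Complex.exp (Complex.I * ((t * ξ : ℝ) : ℂ))) t :=
  intervalIntegral.integral_hasDerivAt_right (Continuous.intervalIntegrable (by fun_prop) _ _)
    (Continuous.stronglyMeasurableAtFilter (by fun_prop) _ _)
    (Continuous.continuousAt (by fun_prop))

lemma hasDerivAt_duhamelSin (t : ℝ) : HasDerivAt (duhamelSin ξ ρ)
    (Real.sin (t * ρ) * Complex.exp (Complex.I * ((t * ξ : ℝ) : ℂ))) t :=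
  intervalIntegral.integral_hasDerivAt_right (Continuous.intervalIntegrable (by fun_prop) _ _)
    (Continuous.stronglyMeasurableAtFilter (by fun_prop) _ _)
    (Continuous.continuousAt (by fun_prop))

lemma hasDerivAt_sin_mul (ρ t : ℝ) : HasDerivAt (fun t : ℝ => (Real.sin (t * ρ) : ℂ))
    (ρ * Real.cos (t * ρ)) t := by
  have := ((hasDerivAt_id t).mul_const ρ).sin.ofReal_comp
  convert! this using 1
  simp
  ring

lemma hasDerivAt_cos_mul (ρ t : ℝ) : HasDerivAt (fun t : ℝ => (Real.cos (t * ρ) : ℂ))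
    (-(ρ * Real.sin (t * ρ))) t := by
  have := ((hasDerivAt_id t).mul_const ρ).cos.ofReal_comp
  convert! this using 1
  simp
  ring

lemma sin_sq_add_cos_sq_ofReal (x : ℝ) : (Real.sin x : ℂ) ^ 2 + (Real.cos x : ℂ) ^ 2 = 1 := by
  exact_mod_cast Real.sin_sq_add_cos_sq x

/-- Variation of constants: the terms from differentiating the two integrals, sin·cos·e^{itξ} and
cos·sin·e^{itξ}, cancel. -/
lemma hasDerivAt_duhamel (hρ : ρ ≠ 0) (t : ℝ) :
    HasDerivAt (duhamel ξ ρ) (duhamelDeriv ξ ρ t) t := by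
  have hρ' : (ρ : ℂ) ≠ 0 := by exact_mod_cast hρ
  have := (((hasDerivAt_sin_mul ρ t).mul (hasDerivAt_duhamelCos (ξ := ξ) (ρ := ρ) t)).sub
    ((hasDerivAt_cos_mul ρ t).mul (hasDerivAt_duhamelSin (ξ := ξ) (ρ := ρ) t))).div_const (ρ : ℂ)
  convert! this using 1
  rw [duhamelDeriv]
  field_simp
  ring

lemma hasDerivAt_duhamelDeriv (hρ : ρ ≠ 0) (t : ℝ) : HasDerivAt (duhamelDeriv ξ ρ)
    (-(ρ : ℂ) ^ 2 * duhamel ξ ρ t + Complex.exp (Complex.I * ((t * ξ : ℝ) : ℂ))) t := by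
  have hρ' : (ρ : ℂ) ≠ 0 := by exact_mod_cast hρ
  have := ((hasDerivAt_cos_mul ρ t).mul (hasDerivAt_duhamelCos (ξ := ξ) (ρ := ρ) t)).add
    ((hasDerivAt_sin_mul ρ t).mul (hasDerivAt_duhamelSin (ξ := ξ) (ρ := ρ) t))
  convert! this using 1
  rw [duhamel]
  have h1 := sin_sq_add_cos_sq_ofReal (t * ρ)
  field_simp
  linear_combination (-Complex.exp (Complex.I * ((t * ξ : ℝ) : ℂ))) * h1

lemma duhamel_zero : duhamel ξ ρ 0 = 0 := by simp [duhamel, duhamelSin]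

lemma duhamelDeriv_zero : duhamelDeriv ξ ρ 0 = 0 := by simp [duhamelDeriv, duhamelCos]

lemma contDiff_duhamel (hρ : ρ ≠ 0) : ContDiff ℝ 2 (duhamel ξ ρ) := by
  have hd : deriv (duhamel ξ ρ) = duhamelDeriv ξ ρ := funext fun t => (hasDerivAt_duhamel hρ t).deriv
  have hdd : deriv (duhamelDeriv ξ ρ) = fun t =>
      -(ρ : ℂ) ^ 2 * duhamel ξ ρ t + Complex.exp (Complex.I * ((t * ξ : ℝ) : ℂ)) :=
    funext fun t => (hasDerivAt_duhamelDeriv hρ t).deriv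
  have hc : Continuous (duhamel ξ ρ) := continuous_iff_continuousAt.2 fun t =>
    (hasDerivAt_duhamel hρ t).continuousAt
  have h1 : ContDiff ℝ 1 (duhamelDeriv ξ ρ) := by
    rw [contDiff_one_iff_deriv, hdd]
    exact ⟨fun t => (hasDerivAt_duhamelDeriv hρ t).differentiableAt, by fun_prop⟩
  rw [show (2 : WithTop ℕ∞) = 1 + 1 by norm_num, contDiff_succ_iff_deriv, hd]
  exact ⟨fun t => (hasDerivAt_duhamel hρ t).differentiableAt, by simp, h1⟩

/-- The field `Re (A e^{iy·η} D(s))`. -/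
def planeWave (A : ℂ) (ζ : SpaceTime) (D : ℝ → ℂ) (s : ℝ) (y : Plane) : ℝ :=
  (A * Complex.exp (Complex.I * (phase 0 y ζ : ℂ)) * D s).re

lemma contDiff_planeWave (A : ℂ) (ζ : SpaceTime) {D : ℝ → ℂ} (hD : ContDiff ℝ 2 D) :
    ContDiff ℝ 2 fun p : ℝ × Plane => planeWave A ζ D p.1 p.2 := by
  have h1 : ContDiff ℝ 2 fun p : ℝ × Plane => (phase 0 p.2 ζ : ℂ) := by
    have h : ContDiff ℝ 2 fun p : ℝ × Plane => phase 0 p.2 ζ := by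
      unfold phase
      fun_prop
    exact Complex.ofRealCLM.contDiff.comp h
  have h2 : ContDiff ℝ 2 fun p : ℝ × Plane =>
      A * Complex.exp (Complex.I * (phase 0 p.2 ζ : ℂ)) * D p.1 := by fun_prop
  exact Complex.reCLM.contDiff.comp h2

lemma hasDerivAt_planeWave {A : ℂ} {ζ : SpaceTime} {D : ℝ → ℂ} {D' : ℂ} {s : ℝ}
    (hD : HasDerivAt D D' s) (y : Plane) :
    HasDerivAt (fun s => planeWave A ζ D s y)
      (A * Complex.exp (Complex.I * (phase 0 y ζ : ℂ)) * D').re s :=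
  (Complex.reCLM.hasFDerivAt.comp_hasDerivAt s (hD.const_mul _))

lemma spaceD_planeWave (A : ℂ) (ζ : SpaceTime) (D : ℝ → ℂ) (i : Fin 2) :
    spaceD i (planeWave A ζ D) = planeWave (A * (Complex.I * ζ i.succ)) ζ D := by
  funext s y
  have h1 : HasDerivAt (fun τ : ℝ => ((phase 0 (y + τ • EuclideanSpace.single i 1) ζ : ℝ) : ℂ))
      (ζ i.succ : ℂ) 0 := by
    have h2 : ∀ τ : ℝ, phase 0 (y + τ • EuclideanSpace.single i 1) ζ =
        phase 0 y ζ + τ * ζ i.succ := by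
      intro τ
      fin_cases i <;> simp [phase] <;> ring
    simp_rw [h2]
    simpa using (((hasDerivAt_id (0 : ℝ)).mul_const (ζ i.succ)).const_add (phase 0 y ζ)).ofReal_comp
  have h3 := Complex.reCLM.hasFDerivAt.comp_hasDerivAt (0 : ℝ)
    ((((h1.const_mul Complex.I).cexp).const_mul A).mul_const (D s))
  have h4 : HasLineDerivAt ℝ (planeWave A ζ D s)
      (planeWave (A * (Complex.I * ζ i.succ)) ζ D s y) y (EuclideanSpace.single i 1) := by
    rw [HasLineDerivAt]
    convert! h3 using 1
    simp only [planeWave, zero_smul, add_zero, Complex.reCLM_apply]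
    congr 1
    ring
  exact h4.lineDeriv

/-- The plane wave solution of the wave equation. -/
lemma isWaveSolution_planeWave {T : ℝ} (hT : 0 < T) (A : ℂ) (ζ : SpaceTime) {ρ : ℝ} (hρ : ρ ≠ 0)
    (hζ : ρ ^ 2 = ζ 1 ^ 2 + ζ 2 ^ 2) :
    IsWaveSolution T (fun s y => (A * Complex.exp (Complex.I * (phase s y ζ : ℂ))).re)
      (planeWave A ζ (duhamel (ζ 0) ρ)) := by
  have hreg := contDiff_planeWave A ζ (contDiff_duhamel (ξ := ζ 0) hρ)
  have hu := uniqueDiffOn_Icc hT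
  have hd1 : ∀ s ∈ Icc 0 T, ∀ y, derivWithin (fun s => planeWave A ζ (duhamel (ζ 0) ρ) s y)
      (Icc 0 T) s = planeWave A ζ (duhamelDeriv (ζ 0) ρ) s y := fun s hs y =>
    ((hasDerivAt_planeWave (hasDerivAt_duhamel hρ s) y).hasDerivWithinAt).derivWithin (hu s hs)
  refine ⟨hreg.contDiffOn, fun s hs y => ?_, fun y => ?_, fun y => ?_⟩
  · rw [laplacian_eq_spaceD (contDiff_slice hreg.contDiffOn hs), iteratedDerivWithin_succ,
      iteratedDerivWithin_one, derivWithin_congr (fun σ hσ => hd1 σ hσ y) (hd1 s hs y),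
      ((hasDerivAt_planeWave (hasDerivAt_duhamelDeriv hρ s) y).hasDerivWithinAt).derivWithin
        (hu s hs), spaceD_planeWave, spaceD_planeWave, spaceD_planeWave, spaceD_planeWave]
    simp only [planeWave]
    rw [← Complex.add_re, ← Complex.sub_re]
    congr 1
    have hζ' : (ρ : ℂ) ^ 2 = (ζ 1 : ℂ) ^ 2 + (ζ 2 : ℂ) ^ 2 := by exact_mod_cast hζ
    have he : Complex.exp (Complex.I * (phase s y ζ : ℂ)) =
        Complex.exp (Complex.I * (phase 0 y ζ : ℂ)) *
          Complex.exp (Complex.I * ((s * ζ 0 : ℝ) : ℂ)) := by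
      rw [← Complex.exp_add, phase, phase]
      congr 1
      push_cast
      ring
    rw [he, hζ', show (0 : Fin 2).succ = (1 : Fin 3) from rfl,
      show (1 : Fin 2).succ = (2 : Fin 3) from rfl]
    linear_combination (-A * Complex.exp (Complex.I * (phase 0 y ζ : ℂ)) * duhamel (ζ 0) ρ s *
      ((ζ 1 : ℂ) ^ 2 + (ζ 2 : ℂ) ^ 2)) * Complex.I_sq
  · simp [planeWave, duhamel_zero]
  · rw [hd1 0 ⟨le_rfl, hT.le⟩]
    simp [planeWave, duhamelDeriv_zero]

/-- The wave multiplier is given by Duhamel's formula. -/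
lemma waveMultiplier_eq_duhamel {t : ℝ} (ht : 0 < t) (ζ : SpaceTime) {ρ : ℝ} (hρ : ρ ≠ 0)
    (hζ : ρ ^ 2 = ζ 1 ^ 2 + ζ 2 ^ 2) : waveMultiplier t ζ = duhamel (ζ 0) ρ t := by
  set Q : ℝ × ℝ × ℝ → ℂ := fun z => ((z.1 * Real.sin z.2.1 : ℝ) : ℂ) *
    Complex.exp (Complex.I * (phase (t - z.1) (spherePt 0 z.1 z.2.1 z.2.2) ζ : ℂ)) with hQ
  have hQc : Continuous Q := by
    have : Continuous fun z : ℝ × ℝ × ℝ => phase (t - z.1) (spherePt 0 z.1 z.2.1 z.2.2) ζ := by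
      unfold phase
      have := continuous_spherePt 0
      fun_prop
    fun_prop
  have hQi : ∀ A : ℂ, IntegrableOn (fun z => A * Q z) (sphereBox t) := fun A =>
    (Continuous.continuousOn (by fun_prop)).integrableOn_compact (isCompact_sphereBox t)
  -- No spherical integral is computed: Kirchhoff's formula is applied, with time horizon `t` and at
  -- the origin, to the explicit plane wave. Since that formula is real, the amplitudes A = 1 and A
  -- = -i recover the real and imaginary parts.
  have key : ∀ A : ℂ, (A * ∫ z in sphereBox t, Q z).re =
      (A * (4 * Real.pi * duhamel (ζ 0) ρ t)).re := by
    intro A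
    have h1 := (isWaveSolution_planeWave ht A ζ hρ hζ).kirchhoff ⟨ht, le_rfl⟩ 0
    rw [← integral_const_mul]
    have h2 : (∫ z in sphereBox t, A * Q z).re = ∫ z in sphereBox t, (A * Q z).re :=
      (Complex.reCLM.integral_comp_comm (hQi A)).symm
    rw [h2]
    calc _ = ∫ z in sphereBox t, z.1 * Real.sin z.2.1 *
          (A * Complex.exp (Complex.I *
            (phase (t - z.1) (spherePt 0 z.1 z.2.1 z.2.2) ζ : ℂ))).re := by
          congr 1
          funext z
          rw [← Complex.re_ofReal_mul, hQ]
          congr 1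
          ring
      _ = _ := by
          rw [h1, planeWave]
          have : phase 0 0 ζ = 0 := by simp [phase]
          rw [this, ← Complex.re_ofReal_mul]
          congr 1
          push_cast
          simp
          ring
  have h : ∫ z in sphereBox t, Q z = 4 * Real.pi * duhamel (ζ 0) ρ t := by
    refine Complex.ext ?_ ?_
    · simpa using key 1
    · simpa using key (-Complex.I)
  have hpi : (Real.pi : ℂ) ≠ 0 := by exact_mod_cast Real.pi_ne_zero
  rw [waveMultiplier, h]
  push_cast
  field_simp

/-- Lower bound for the wave multiplier near the light cone. -/
lemma norm_duhamel_ge {ξ ρ t : ℝ} (ht : 0 < t) (hρ : 8 / t ≤ ρ) (hξ : 0 ≤ ξ)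
    (hξρ : |ξ - ρ| * t ≤ 1) : t / (8 * ρ) ≤ ‖duhamel ξ ρ t‖ := by
  have hρ0 : 0 < ρ := lt_of_lt_of_le (by positivity) hρ
  let E : ℝ → ℝ → ℂ := fun a s => Complex.exp (Complex.I * ((s * a : ℝ) : ℂ))
  have hEi : ∀ a, IntervalIntegrable (E a) volume 0 t := fun a =>
    Continuous.intervalIntegrable (by fun_prop) _ _
  set Am := ∫ s in 0..t, E (ξ - ρ) s with hAm
  set Ap := ∫ s in 0..t, E (ξ + ρ) s with hAp
  have hexp : ∀ s, E (ξ - ρ) s = Complex.exp (Complex.I * ((s * ξ : ℝ) : ℂ)) *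
      (Real.cos (s * ρ) - Real.sin (s * ρ) * Complex.I) ∧
      E (ξ + ρ) s = Complex.exp (Complex.I * ((s * ξ : ℝ) : ℂ)) *
      (Real.cos (s * ρ) + Real.sin (s * ρ) * Complex.I) := by
    intro s
    have e1 : (Real.cos (s * ρ) + Real.sin (s * ρ) * Complex.I : ℂ) =
        Complex.exp (((s * ρ : ℝ) : ℂ) * Complex.I) := by
      rw [Complex.exp_mul_I]
      push_cast
      rfl
    have e2 : (Real.cos (s * ρ) - Real.sin (s * ρ) * Complex.I : ℂ) =
        Complex.exp (((-(s * ρ) : ℝ) : ℂ) * Complex.I) := by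
      rw [Complex.exp_mul_I, ← Complex.ofReal_cos, ← Complex.ofReal_sin, Real.cos_neg, Real.sin_neg]
      push_cast
      ring
    constructor
    · rw [e2, ← Complex.exp_add]
      simp only [E]
      congr 1
      push_cast
      ring
    · rw [e1, ← Complex.exp_add]
      simp only [E]
      congr 1
      push_cast
      ring
  have hcosA : duhamelCos ξ ρ t = (Ap + Am) / 2 := by
    rw [hAm, hAp, ← intervalIntegral.integral_add (hEi _) (hEi _), ← intervalIntegral.integral_div,
      duhamelCos]
    congr 1
    funext s
    rw [(hexp s).1, (hexp s).2]
    ring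
  have hsinA : duhamelSin ξ ρ t = (Ap - Am) / (2 * Complex.I) := by
    rw [hAm, hAp, ← intervalIntegral.integral_sub (hEi _) (hEi _), ← intervalIntegral.integral_div,
      duhamelSin]
    congr 1
    funext s
    rw [(hexp s).1, (hexp s).2]
    field_simp [Complex.I_ne_zero]
    ring
  -- Splitting the sine into exponentials separates a resonant part of frequency ξ - ρ from a
  -- non-resonant one of frequency ξ + ρ.
  have hD : duhamel ξ ρ t = (Complex.exp (((t * ρ : ℝ) : ℂ) * Complex.I) * Am -
      Complex.exp (((-(t * ρ) : ℝ) : ℂ) * Complex.I) * Ap) / (2 * Complex.I * ρ) := by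
    have hρ' : (ρ : ℂ) ≠ 0 := by exact_mod_cast hρ0.ne'
    rw [duhamel, hcosA, hsinA, Complex.exp_mul_I, Complex.exp_mul_I, ← Complex.ofReal_cos,
      ← Complex.ofReal_sin, ← Complex.ofReal_cos, ← Complex.ofReal_sin, Real.cos_neg, Real.sin_neg]
    push_cast
    field_simp [Complex.I_ne_zero]
    ring
  -- The non-resonant integral is explicit; its denominator ξ + ρ is at least ρ.
  have hAp' : ‖Ap‖ ≤ 2 / ρ := by
    have hne : Complex.I * ((ξ + ρ : ℝ) : ℂ) ≠ 0 :=
      mul_ne_zero Complex.I_ne_zero (by exact_mod_cast (by linarith : (0 : ℝ) < ξ + ρ).ne')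
    have h1 : Ap = ∫ s in 0..t, Complex.exp (Complex.I * ((ξ + ρ : ℝ) : ℂ) * s) := by
      rw [hAp]
      congr 1
      funext s
      simp only [E]
      congr 1
      push_cast
      ring
    rw [h1, integral_exp_mul_complex hne, norm_div, norm_mul, Complex.norm_I, one_mul,
      Complex.norm_real, Real.norm_of_nonneg (by linarith)]
    have h2 : ∀ s : ℝ, ‖Complex.exp (Complex.I * ((ξ + ρ : ℝ) : ℂ) * s)‖ = 1 := by
      intro s
      rw [mul_assoc, ← Complex.ofReal_mul, Complex.norm_exp_I_mul_ofReal]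
    have h3 := norm_sub_le (Complex.exp (Complex.I * ((ξ + ρ : ℝ) : ℂ) * t))
      (Complex.exp (Complex.I * ((ξ + ρ : ℝ) : ℂ) * ((0 : ℝ) : ℂ)))
    rw [h2, h2] at h3
    exact div_le_div₀ (by norm_num) (by linarith) hρ0 (by linarith)
  -- In the resonant integral the phase stays in [-1, 1], where cosine is at least 1/2.
  have hAm' : t / 2 ≤ ‖Am‖ := by
    refine le_trans ?_ (Complex.re_le_norm Am)
    have h1 : Am.re = ∫ s in 0..t, (E (ξ - ρ) s).re := by
      rw [hAm, intervalIntegral.integral_of_le ht.le, intervalIntegral.integral_of_le ht.le]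
      exact (Complex.reCLM.integral_comp_comm (hEi _).1).symm
    rw [h1]
    have h2 : ∫ _ in 0..t, (1 / 2 : ℝ) ≤ ∫ s in 0..t, (E (ξ - ρ) s).re := by
      refine intervalIntegral.integral_mono_on ht.le (by simp)
        (Continuous.intervalIntegrable (by fun_prop) _ _) fun s hs => ?_
      have h3 : (E (ξ - ρ) s).re = Real.cos (s * (ξ - ρ)) := by
        simp only [E]
        rw [mul_comm Complex.I, Complex.exp_ofReal_mul_I_re]
      rw [h3]
      have h4 : |s * (ξ - ρ)| ≤ 1 := by
        rw [abs_mul, abs_of_nonneg hs.1, mul_comm]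
        exact (mul_le_mul_of_nonneg_left hs.2 (abs_nonneg _)).trans hξρ
      have h5 := Real.one_sub_sq_div_two_le_cos (x := s * (ξ - ρ))
      have h6 : (s * (ξ - ρ)) ^ 2 ≤ 1 := by
        rw [← sq_abs]
        nlinarith [abs_nonneg (s * (ξ - ρ))]
      linarith
    refine le_trans (le_of_eq ?_) h2
    simp
    ring
  -- The condition ρ ≥ 8/t makes the non-resonant part at most half of the resonant lower bound t/2;
  -- dividing the remaining t/4 by 2ρ gives t/(8ρ).
  have h8 : 2 / ρ ≤ t / 4 := by
    rw [div_le_iff₀ ht] at hρ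
    rw [div_le_div_iff₀ hρ0 (by norm_num)]
    linarith
  rw [hD, norm_div]
  have hnum : t / 4 ≤ ‖Complex.exp (((t * ρ : ℝ) : ℂ) * Complex.I) * Am -
      Complex.exp (((-(t * ρ) : ℝ) : ℂ) * Complex.I) * Ap‖ := by
    refine le_trans ?_ (norm_sub_norm_le _ _)
    rw [norm_mul, norm_mul, Complex.norm_exp_ofReal_mul_I, Complex.norm_exp_ofReal_mul_I]
    linarith
  have hden : ‖(2 * Complex.I * ρ : ℂ)‖ = 2 * ρ := by
    simp [abs_of_pos hρ0]
  rw [hden, le_div_iff₀ (by positivity)]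
  calc t / (8 * ρ) * (2 * ρ) = t / 4 := by
        field_simp
        norm_num
    _ ≤ _ := hnum

end PlaneWave

/-! ### Gaussian moments -/

lemma deriv_mul_gaussianMgf (v : ℝ) {p p' : ℝ → ℝ} (hp : ∀ t, HasDerivAt p (p' t) t) :
    deriv (fun t => p t * Real.exp (v * t ^ 2 / 2)) =
      fun t => (p' t + v * t * p t) * Real.exp (v * t ^ 2 / 2) := by
  funext t
  have h1 : HasDerivAt (fun t : ℝ => v * t ^ 2 / 2) (v * t) t := by
    have := ((hasDerivAt_pow 2 t).const_mul v).div_const 2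
    convert! this using 1
    simp
    ring
  rw [HasDerivAt.deriv (f := fun t => p t * Real.exp (v * t ^ 2 / 2)) ((hp t).mul h1.exp)]
  ring

/-- The moment is the fourth derivative at 0 of exp(vt²/2). Each derivative is a polynomial times
that exponential, with p replaced by p' + v t p. -/
lemma integral_pow_four_gaussianReal (v : NNReal) :
    ∫ x, x ^ 4 ∂(gaussianReal 0 v) = 3 * (v : ℝ) ^ 2 := by
  have h := iteratedDeriv_mgf_zero (X := id) (μ := gaussianReal 0 v) (by
    simp [integrableExpSet_id_gaussianReal]) 4
  have h0 : mgf id (gaussianReal 0 v) = fun t => 1 * Real.exp (v * t ^ 2 / 2) := by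
    rw [mgf_id_gaussianReal]
    funext t
    simp
  have e1 := deriv_mul_gaussianMgf v (p := fun _ => 1) (p' := fun _ => 0)
    fun t => hasDerivAt_const t 1
  have e2 := deriv_mul_gaussianMgf v (p := fun t => 0 + v * t * 1) (p' := fun _ => v) fun t => by
    simpa using (hasDerivAt_id t).const_mul (v : ℝ)
  have e3 := deriv_mul_gaussianMgf v (p := fun t => v + v * t * (0 + v * t * 1))
    (p' := fun t => 2 * v ^ 2 * t) fun t => by
      have := ((hasDerivAt_pow 2 t).const_mul ((v : ℝ) ^ 2)).const_add (v : ℝ)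
      convert! this using 1
      · funext t
        ring
      · simp
        ring
  have e4 := deriv_mul_gaussianMgf v
    (p := fun t => 2 * v ^ 2 * t + v * t * (v + v * t * (0 + v * t * 1)))
    (p' := fun t => 3 * v ^ 2 + 3 * v ^ 3 * t ^ 2) fun t => by
      have := ((hasDerivAt_id t).const_mul (3 * (v : ℝ) ^ 2)).add
        ((hasDerivAt_pow 3 t).const_mul ((v : ℝ) ^ 3))
      convert! this using 1
      · funext t
        simp
        ring
      · simp
        ring
  rw [iteratedDeriv_succ', iteratedDeriv_succ', iteratedDeriv_succ', iteratedDeriv_succ',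
    iteratedDeriv_zero, h0, e1, e2, e3, e4] at h
  simpa using h.symm

/-! ### Wick's formula for noise integrals -/

section Wick
variable {Ω : Type*} [MeasurableSpace Ω] {P : Measure Ω}
  {W : Lp ℝ 2 (volume : Measure SpaceTime) → Ω → ℝ} {X Y : Ω → ℝ} {k l : SpaceTime → ℂ}

lemma IsNoiseIntegral.integral_pow_four (hW : IsWhiteNoise P W) (hX : IsNoiseIntegral P W X k) :
    ∫ ω, X ω ^ 4 ∂P = 3 * (∫ ω, X ω ^ 2 ∂P) ^ 2 := by
  have hG := hX.hasGaussianLaw hW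
  have hmap := hG.map_eq_gaussianReal
  have hprob := hG.isProbabilityMeasure
  have h0 := hX.integral_eq_zero hW
  have hvar : Var[X; P] = ∫ ω, X ω ^ 2 ∂P := variance_of_integral_eq_zero hG.aemeasurable h0
  rw [h0, hvar] at hmap
  have h1 : ∫ ω, X ω ^ 4 ∂P = ∫ x, x ^ 4 ∂(P.map X) :=
    (integral_map (f := fun x : ℝ => x ^ 4) hG.aemeasurable (by fun_prop)).symm
  rw [h1, hmap, integral_pow_four_gaussianReal, Real.coe_toNNReal _
    (integral_nonneg fun _ => sq_nonneg _)]

lemma IsNoiseIntegral.memLp_four (hW : IsWhiteNoise P W) (hX : IsNoiseIntegral P W X k) :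
    MemLp X 4 P := (hX.hasGaussianLaw hW).memLp (by norm_num)

lemma IsNoiseIntegral.integrable_pow_four (hW : IsWhiteNoise P W)
    (hX : IsNoiseIntegral P W X k) : Integrable (fun ω => X ω ^ 4) P := by
  have := (hX.memLp_four hW).integrable_norm_pow (p := 4) (by norm_num)
  refine this.congr (ae_of_all _ fun ω => ?_)
  simp only [Real.norm_eq_abs]
  exact Even.pow_abs (by decide) _

lemma integral_lincomb_four {f g h p : Ω → ℝ} (hf : Integrable f P) (hg : Integrable g P)
    (hh : Integrable h P) (hp : Integrable p P) (a b c d : ℝ) :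
    ∫ ω, a * f ω + b * g ω + c * h ω + d * p ω ∂P =
      a * ∫ ω, f ω ∂P + b * ∫ ω, g ω ∂P + c * ∫ ω, h ω ∂P + d * ∫ ω, p ω ∂P := by
  have h1 : Integrable (fun ω => a * f ω + b * g ω) P := (hf.const_mul a).add (hg.const_mul b)
  have h2 : Integrable (fun ω => a * f ω + b * g ω + c * h ω) P := h1.add (hh.const_mul c)
  rw [integral_add h2 (hp.const_mul d), integral_add h1 (hh.const_mul c),
    integral_add (hf.const_mul a) (hg.const_mul b)]
  simp only [integral_const_mul]

/-- Wick's formula for the covariance of squares. -/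
lemma IsNoiseIntegral.integral_wick (hW : IsWhiteNoise P W) (hX : IsNoiseIntegral P W X k)
    (hY : IsNoiseIntegral P W Y l) :
    ∫ ω, (X ω ^ 2 - ∫ ω', X ω' ^ 2 ∂P) * (Y ω ^ 2 - ∫ ω', Y ω' ^ 2 ∂P) ∂P =
      2 * (∫ ω, X ω * Y ω ∂P) ^ 2 := by
  have hprob := (hX.hasGaussianLaw hW).isProbabilityMeasure
  have hp := hX.lincomb hW hY 1 1
  have hm := hX.lincomb hW hY 1 (-1)
  have i1 := hX.integrable_pow_four hW
  have i2 := hY.integrable_pow_four hW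
  have i3 := hp.integrable_pow_four hW
  have i4 := hm.integrable_pow_four hW
  have j1 := (hX.memLp_two hW).integrable_sq
  have j2 := (hY.memLp_two hW).integrable_sq
  have j3 : Integrable (fun ω => X ω * Y ω) P := (hX.memLp_two hW).integrable_mul (hY.memLp_two hW)
  have q3 : ∫ ω, (1 * X ω + 1 * Y ω) ^ 2 ∂P =
      ∫ ω, X ω ^ 2 ∂P + 2 * ∫ ω, X ω * Y ω ∂P + ∫ ω, Y ω ^ 2 ∂P := by
    have h := integral_lincomb_four j1 j3 j2 (integrable_zero Ω ℝ P) 1 2 1 0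
    convert! h using 1
    · congr 1
      funext ω
      ring
    · ring
  have q4 : ∫ ω, (1 * X ω + (-1) * Y ω) ^ 2 ∂P =
      ∫ ω, X ω ^ 2 ∂P - 2 * ∫ ω, X ω * Y ω ∂P + ∫ ω, Y ω ^ 2 ∂P := by
    have h := integral_lincomb_four j1 j3 j2 (integrable_zero Ω ℝ P) 1 (-2) 1 0
    convert! h using 1
    · congr 1
      funext ω
      ring
    · ring
  have f1 := hX.integral_pow_four hW
  have f2 := hY.integral_pow_four hW
  have f3 := hp.integral_pow_four hW
  have f4 := hm.integral_pow_four hW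
  rw [q3] at f3
  rw [q4] at f4
  -- Polarization in degree four: 12 x²y² = (x+y)⁴ + (x-y)⁴ - 2x⁴ - 2y⁴. Only one-dimensional fourth
  -- moments are needed, since X ± Y are again noise integrals.
  have iXY : Integrable (fun ω => X ω ^ 2 * Y ω ^ 2) P := by
    have : (fun ω => X ω ^ 2 * Y ω ^ 2) = fun ω => ((1 * X ω + 1 * Y ω) ^ 4 +
        (1 * X ω + (-1) * Y ω) ^ 4 - 2 * X ω ^ 4 - 2 * Y ω ^ 4) / 12 := by
      funext ω
      ring
    rw [this]
    exact (((i3.add i4).sub (i1.const_mul 2)).sub (i2.const_mul 2)).div_const 12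
  have hXY : ∫ ω, X ω ^ 2 * Y ω ^ 2 ∂P = (∫ ω, (1 * X ω + 1 * Y ω) ^ 4 ∂P +
      ∫ ω, (1 * X ω + (-1) * Y ω) ^ 4 ∂P - 2 * ∫ ω, X ω ^ 4 ∂P - 2 * ∫ ω, Y ω ^ 4 ∂P) / 12 := by
    have h := integral_lincomb_four i3 i4 i1 i2 (1 / 12) (1 / 12) (-(1 / 6)) (-(1 / 6))
    convert! h using 1
    · congr 1
      funext ω
      ring
    · ring
  set a := ∫ ω, X ω ^ 2 ∂P with ha
  set b := ∫ ω, Y ω ^ 2 ∂P with hb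
  have h := integral_lincomb_four iXY j1 j2 (integrable_const (1 : ℝ)) 1 (-b) (-a) (a * b)
  have hexp : ∫ ω, (X ω ^ 2 - a) * (Y ω ^ 2 - b) ∂P =
      ∫ ω, 1 * (X ω ^ 2 * Y ω ^ 2) + -b * X ω ^ 2 + -a * Y ω ^ 2 + a * b * 1 ∂P := by
    congr 1
    funext ω
    ring
  rw [hexp, h, hXY, f1, f2, f3, f4, ← ha, ← hb]
  simp
  ring

end Wick

/-! ### The variance of the Wick square tested against a function -/

section Variance
variable {Ω : Type*} [MeasurableSpace Ω] {P : Measure Ω}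
  {W : Lp ℝ 2 (volume : Measure SpaceTime) → Ω → ℝ}

/-- An almost surely continuous field has a jointly measurable modification. -/
lemma exists_measurable_modification {Y : Ω → Plane → ℝ} (hY : ∀ᵐ ω ∂P, Continuous (Y ω))
    (hm : ∀ y, AEMeasurable (fun ω => Y ω y) P) :
    ∃ Z : Ω → Plane → ℝ, Measurable (fun p : Ω × Plane => Z p.1 p.2) ∧
      ∀ᵐ ω ∂P, ∀ y, Z ω y = Y ω y := by
  let q := TopologicalSpace.denseSeq Plane
  -- On a measurable set of full measure the path is continuous and agrees with measurable versions
  -- on a countable dense set. Setting it to zero elsewhere leaves a Carathéodory function, which is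
  -- jointly measurable.
  have hae : ∀ᵐ ω ∂P, Continuous (Y ω) ∧ ∀ i, Y ω (q i) = (hm (q i)).mk _ ω :=
    hY.and (ae_all_iff.2 fun i => (hm (q i)).ae_eq_mk)
  obtain ⟨G, hG, hGm, hGs⟩ := hae.exists_measurable_mem
  let Z : Ω → Plane → ℝ := fun ω y => G.indicator (fun ω => Y ω y) ω
  have hcont : ∀ ω, Continuous (Z ω) := by
    intro ω
    by_cases h : ω ∈ G
    · simpa [Z, h] using (hGs ω h).1
    · simpa [Z, h] using continuous_const
  have hq : ∀ i, Measurable fun ω => Z ω (q i) := by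
    intro i
    have : (fun ω => Z ω (q i)) = G.indicator ((hm (q i)).mk _) := by
      funext ω
      by_cases h : ω ∈ G
      · simp [Z, h, (hGs ω h).2 i]
      · simp [Z, h]
    rw [this]
    exact (hm (q i)).measurable_mk.indicator hGm
  have hy : ∀ y, Measurable fun ω => Z ω y := by
    intro y
    obtain ⟨u, hu, hul⟩ := mem_closure_iff_seq_limit.1
      ((TopologicalSpace.denseRange_denseSeq Plane).closure_range ▸ mem_univ y)
    refine measurable_of_tendsto_metrizable (f := fun m ω => Z ω (u m)) (fun m => ?_)
      (tendsto_pi_nhds.2 fun ω => ((hcont ω).tendsto y).comp hul)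
    obtain ⟨i, hi⟩ := hu m
    rw [← hi]
    exact hq i
  refine ⟨Z, ?_, ?_⟩
  · have := measurable_uncurry_of_continuous_of_measurable (u := fun y ω => Z ω y) hcont hy
    exact this.comp measurable_swap
  · filter_upwards [hG] with ω hω y
    simp [Z, hω]

/-- A field of noise integrals of constant variance `v`. -/
structure IsNoiseField (P : Measure Ω) (W : Lp ℝ 2 (volume : Measure SpaceTime) → Ω → ℝ)
    (Y : Ω → Plane → ℝ) (k : Plane → SpaceTime → ℂ) (v : ℝ) : Prop where
  isNoiseIntegral : ∀ y, IsNoiseIntegral P W (fun ω => Y ω y) (k y)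
  variance : ∀ y, ∫ ω, Y ω y ^ 2 ∂P = v

namespace IsNoiseField
variable {Y : Ω → Plane → ℝ} {k : Plane → SpaceTime → ℂ} {v : ℝ}

lemma congr (h : IsNoiseField P W Y k v) {Z : Ω → Plane → ℝ}
    (hZ : ∀ᵐ ω ∂P, ∀ y, Z ω y = Y ω y) : IsNoiseField P W Z k v := by
  have h1 : ∀ y, (fun ω => Y ω y) =ᵐ[P] fun ω => Z ω y := fun y => by
    filter_upwards [hZ] with ω hω
    exact (hω y).symm
  refine ⟨fun y => (h.isNoiseIntegral y).congr (h1 y), fun y => ?_⟩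
  rw [← h.variance y]
  refine integral_congr_ae ?_
  filter_upwards [h1 y] with ω hω
  rw [hω]

lemma integral_wick (h : IsNoiseField P W Y k v) (hW : IsWhiteNoise P W) (y y' : Plane) :
    ∫ ω, (Y ω y ^ 2 - v) * (Y ω y' ^ 2 - v) ∂P =
      2 * (∫ ζ, (k y ζ * (starRingEnd ℂ) (k y' ζ)).re) ^ 2 := by
  have := (h.isNoiseIntegral y).integral_wick hW (h.isNoiseIntegral y')
  rw [h.variance, h.variance] at this
  rw [this, (h.isNoiseIntegral y).integral_mul hW (h.isNoiseIntegral y')]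

lemma memLp_wick (h : IsNoiseField P W Y k v) (hW : IsWhiteNoise P W) (y : Plane) :
    MemLp (fun ω => Y ω y ^ 2 - v) 2 P := by
  have hG := (h.isNoiseIntegral y).hasGaussianLaw hW
  have hprob := hG.isProbabilityMeasure
  refine MemLp.sub ?_ (memLp_const v)
  rw [memLp_two_iff_integrable_sq (hG.aemeasurable.pow_const 2).aestronglyMeasurable]
  refine ((h.isNoiseIntegral y).integrable_pow_four hW).congr (ae_of_all _ fun ω => ?_)
  ring

lemma integral_wick_sq (h : IsNoiseField P W Y k v) (hW : IsWhiteNoise P W) (y : Plane) :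
    ∫ ω, (Y ω y ^ 2 - v) ^ 2 ∂P = 2 * v ^ 2 := by
  have := (h.isNoiseIntegral y).integral_wick hW (h.isNoiseIntegral y)
  rw [h.variance] at this
  simp_rw [← sq] at this
  rw [this, h.variance]

/-- The mean square of the Wick square over a set of finite measure is finite. -/
lemma lintegral_wick_lt_top (h : IsNoiseField P W Y k v) (hW : IsWhiteNoise P W)
    (hY : Measurable fun p : Ω × Plane => Y p.1 p.2) {D : Set Plane} (hD : volume D ≠ ⊤) :
    ∫⁻ ω, (∫⁻ y in D, ENNReal.ofReal ((Y ω y ^ 2 - v) ^ 2)) ∂P < ⊤ := by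
  have hprob := ((h.isNoiseIntegral 0).hasGaussianLaw hW).isProbabilityMeasure
  rw [lintegral_lintegral_swap (by fun_prop)]
  have h1 : ∀ y, ∫⁻ ω, ENNReal.ofReal ((Y ω y ^ 2 - v) ^ 2) ∂P = ENNReal.ofReal (2 * v ^ 2) := by
    intro y
    rw [← ofReal_integral_eq_lintegral_ofReal (h.memLp_wick hW y).integrable_sq
      (ae_of_all _ fun _ => sq_nonneg _), h.integral_wick_sq hW]
  simp_rw [h1]
  rw [lintegral_const]
  exact ENNReal.mul_lt_top ENNReal.ofReal_lt_top (by simpa using hD.lt_top)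

/-- This justifies Fubini in the variance: by the inequality 2ab ≤ a² + b² and constancy of the
variance, the expected absolute product at (y, y') is at most 2v² |φ(y)| |φ(y')|. -/
lemma integrable_wick_prod (h : IsNoiseField P W Y k v) (hW : IsWhiteNoise P W)
    (hY : Measurable fun p : Ω × Plane => Y p.1 p.2) {φ : Plane → ℝ} (hφ : Integrable φ)
    (hφm : Measurable φ) :
    Integrable (fun p : Ω × (Plane × Plane) => ((Y p.1 p.2.1 ^ 2 - v) * φ p.2.1) *
      ((Y p.1 p.2.2 ^ 2 - v) * φ p.2.2)) (P.prod (volume.prod volume)) := by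
  have hprob := ((h.isNoiseIntegral 0).hasGaussianLaw hW).isProbabilityMeasure
  have hY1 : Measurable fun p : Ω × (Plane × Plane) => Y p.1 p.2.1 :=
    hY.comp (measurable_fst.prodMk measurable_snd.fst)
  have hY2 : Measurable fun p : Ω × (Plane × Plane) => Y p.1 p.2.2 :=
    hY.comp (measurable_fst.prodMk measurable_snd.snd)
  have hm : Measurable (fun p : Ω × (Plane × Plane) => ((Y p.1 p.2.1 ^ 2 - v) * φ p.2.1) *
      ((Y p.1 p.2.2 ^ 2 - v) * φ p.2.2)) := by fun_prop
  have hi : ∀ y y', Integrable (fun ω => (Y ω y ^ 2 - v) * (Y ω y' ^ 2 - v)) P := fun y y' =>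
    (h.memLp_wick hW y).integrable_mul (h.memLp_wick hW y')
  rw [integrable_prod_iff' hm.aestronglyMeasurable]
  refine ⟨ae_of_all _ fun p => ?_, ?_⟩
  · refine ((hi p.1 p.2).mul_const (φ p.1 * φ p.2)).congr (ae_of_all _ fun ω => ?_)
    simp only
    ring
  · refine ((hφ.norm.mul_prod hφ.norm).const_mul (2 * v ^ 2)).mono' ?_ (ae_of_all _ fun p => ?_)
    · exact (hm.norm.stronglyMeasurable.integral_prod_left' (μ := P)).aestronglyMeasurable
    · rw [Real.norm_of_nonneg (integral_nonneg fun _ => norm_nonneg _)]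
      have h1 : ∀ ω, ‖((Y ω p.1 ^ 2 - v) * φ p.1) * ((Y ω p.2 ^ 2 - v) * φ p.2)‖ ≤
          (1 / 2 * ((Y ω p.1 ^ 2 - v) ^ 2 + (Y ω p.2 ^ 2 - v) ^ 2)) * (‖φ p.1‖ * ‖φ p.2‖) := by
        intro ω
        rw [norm_mul, norm_mul, norm_mul]
        have h2 : ‖Y ω p.1 ^ 2 - v‖ * ‖Y ω p.2 ^ 2 - v‖ ≤
            1 / 2 * ((Y ω p.1 ^ 2 - v) ^ 2 + (Y ω p.2 ^ 2 - v) ^ 2) := by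
          have := two_mul_le_add_sq ‖Y ω p.1 ^ 2 - v‖ ‖Y ω p.2 ^ 2 - v‖
          rw [Real.norm_eq_abs, Real.norm_eq_abs, sq_abs, sq_abs] at this
          rw [Real.norm_eq_abs, Real.norm_eq_abs]
          linarith
        calc _ = (‖Y ω p.1 ^ 2 - v‖ * ‖Y ω p.2 ^ 2 - v‖) * (‖φ p.1‖ * ‖φ p.2‖) := by ring
          _ ≤ _ := by gcongr
      have hs := fun y => (h.memLp_wick hW y).integrable_sq
      calc _ ≤ ∫ ω, (1 / 2 * ((Y ω p.1 ^ 2 - v) ^ 2 + (Y ω p.2 ^ 2 - v) ^ 2)) *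
            (‖φ p.1‖ * ‖φ p.2‖) ∂P :=
            integral_mono_of_nonneg (ae_of_all _ fun _ => norm_nonneg _)
              ((((hs p.1).add (hs p.2)).const_mul _).mul_const _) (ae_of_all _ h1)
        _ = 2 * v ^ 2 * (‖φ p.1‖ * ‖φ p.2‖) := by
            rw [integral_mul_const, integral_const_mul, integral_add (hs p.1) (hs p.2),
              h.integral_wick_sq hW, h.integral_wick_sq hW]
            ring

lemma sq_integral_eq_integral_prod (f : Plane → ℝ) :
    (∫ y, f y) ^ 2 = ∫ p : Plane × Plane, f p.1 * f p.2 ∂(volume.prod volume) := by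
  rw [sq, integral_prod_mul f f]

/-- The variance of the Wick square tested against `φ`. -/
lemma lintegral_wick_test (h : IsNoiseField P W Y k v) (hW : IsWhiteNoise P W)
    (hY : Measurable fun p : Ω × Plane => Y p.1 p.2) {φ : Plane → ℝ} (hφ : Integrable φ)
    (hφm : Measurable φ) :
    ∫⁻ ω, ENNReal.ofReal ((∫ y, (Y ω y ^ 2 - v) * φ y) ^ 2) ∂P =
      ENNReal.ofReal (∫ p : Plane × Plane,
        2 * (∫ ζ, (k p.1 ζ * (starRingEnd ℂ) (k p.2 ζ)).re) ^ 2 * (φ p.1 * φ p.2)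
          ∂(volume.prod volume)) := by
  have hprob := ((h.isNoiseIntegral 0).hasGaussianLaw hW).isProbabilityMeasure
  have hint := h.integrable_wick_prod hW hY hφ hφm
  have hX : Integrable (fun ω => (∫ y, (Y ω y ^ 2 - v) * φ y) ^ 2) P := by
    simp_rw [sq_integral_eq_integral_prod]
    exact hint.integral_prod_left
  rw [← ofReal_integral_eq_lintegral_ofReal hX (ae_of_all _ fun _ => sq_nonneg _)]
  congr 1
  simp_rw [sq_integral_eq_integral_prod]
  rw [integral_integral_swap (f := fun ω (p : Plane × Plane) => ((Y ω p.1 ^ 2 - v) * φ p.1) *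
      ((Y ω p.2 ^ 2 - v) * φ p.2)) hint]
  congr 1
  funext p
  rw [← h.integral_wick hW, ← integral_mul_const]
  congr 1
  funext ω
  ring

end IsNoiseField

/-! ### The lower bound on the frequency side -/

/-- The kernel cos(r(y) - r(y')) is positive definite, being a sum of two products cos·cos and
sin·sin. -/
lemma sq_add_sq_eq_integral_cos {φ : Plane → ℝ} (hφ : Integrable φ) {r : Plane → ℝ}
    (hr : Continuous r) :
    Integrable (fun p : Plane × Plane => φ p.1 * φ p.2 * Real.cos (r p.1 - r p.2))
      (volume.prod volume) ∧
    ∫ p : Plane × Plane, φ p.1 * φ p.2 * Real.cos (r p.1 - r p.2) ∂(volume.prod volume) =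
      (∫ y, φ y * Real.cos (r y)) ^ 2 + (∫ y, φ y * Real.sin (r y)) ^ 2 := by
  have hc : Integrable fun y => φ y * Real.cos (r y) :=
    hφ.mul_bdd (c := 1) (Continuous.aestronglyMeasurable (by fun_prop))
      (ae_of_all _ fun y => Real.abs_cos_le_one _)
  have hs : Integrable fun y => φ y * Real.sin (r y) :=
    hφ.mul_bdd (c := 1) (Continuous.aestronglyMeasurable (by fun_prop))
      (ae_of_all _ fun y => Real.abs_sin_le_one _)
  have h1 : ∀ p : Plane × Plane, φ p.1 * φ p.2 * Real.cos (r p.1 - r p.2) =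
      (φ p.1 * Real.cos (r p.1)) * (φ p.2 * Real.cos (r p.2)) +
        (φ p.1 * Real.sin (r p.1)) * (φ p.2 * Real.sin (r p.2)) := by
    intro p
    rw [Real.cos_sub]
    ring
  simp_rw [h1]
  refine ⟨(hc.mul_prod hc).add (hs.mul_prod hs), ?_⟩
  rw [integral_add (hc.mul_prod hc) (hs.mul_prod hs),
    integral_prod_mul (fun y => φ y * Real.cos (r y)) (fun y => φ y * Real.cos (r y)),
    integral_prod_mul (fun y => φ y * Real.sin (r y)) (fun y => φ y * Real.sin (r y))]
  ring

/-- The product of cosines is half the sum of the cosines for p - q and p + q. Both give sums of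
squares; only the cosine square of p - q, the slowly oscillating phase for nearby frequencies, is
kept. -/
lemma sq_integral_cos_le {φ : Plane → ℝ} (hφ : Integrable φ) {p q : Plane → ℝ}
    (hp : Continuous p) (hq : Continuous q) :
    1 / 2 * (∫ y, φ y * Real.cos (p y - q y)) ^ 2 ≤
      ∫ z : Plane × Plane, φ z.1 * φ z.2 * (Real.cos (p z.1 - p z.2) * Real.cos (q z.1 - q z.2))
        ∂(volume.prod volume) := by
  obtain ⟨i1, e1⟩ := sq_add_sq_eq_integral_cos hφ (hp.sub hq)
  obtain ⟨i2, e2⟩ := sq_add_sq_eq_integral_cos hφ (hp.add hq)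
  simp only [Pi.sub_apply, Pi.add_apply] at i1 e1 i2 e2
  have h1 : ∀ z : Plane × Plane,
      φ z.1 * φ z.2 * (Real.cos (p z.1 - p z.2) * Real.cos (q z.1 - q z.2)) =
      1 / 2 * (φ z.1 * φ z.2 * Real.cos (p z.1 - q z.1 - (p z.2 - q z.2))) +
      1 / 2 * (φ z.1 * φ z.2 * Real.cos (p z.1 + q z.1 - (p z.2 + q z.2))) := by
    intro z
    have e3 : p z.1 - q z.1 - (p z.2 - q z.2) = (p z.1 - p z.2) - (q z.1 - q z.2) := by ring
    have e4 : p z.1 + q z.1 - (p z.2 + q z.2) = (p z.1 - p z.2) + (q z.1 - q z.2) := by ring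
    rw [e3, e4, Real.cos_sub (p z.1 - p z.2), Real.cos_add (p z.1 - p z.2)]
    ring
  simp_rw [h1]
  rw [integral_add (i1.const_mul _) (i2.const_mul _), integral_const_mul, integral_const_mul, e1,
    e2]
  nlinarith [sq_nonneg (∫ y, φ y * Real.sin (p y - q y)),
    sq_nonneg (∫ y, φ y * Real.cos (p y + q y)), sq_nonneg (∫ y, φ y * Real.sin (p y + q y))]

lemma continuous_phase_left (s : ℝ) (ζ : SpaceTime) : Continuous fun y : Plane => phase s y ζ := by
  unfold phase
  fun_prop

lemma measurable_phase : Measurable fun q : Plane × SpaceTime => phase 0 q.1 q.2 := by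
  unfold phase
  fun_prop

lemma abs_mul_abs_le_one {a b : ℝ} (ha : |a| ≤ 1) (hb : |b| ≤ 1) : |a * b| ≤ 1 := by
  rw [abs_mul]
  exact mul_le_one₀ ha (abs_nonneg _) hb

/-- Passage to the frequency side in the variance of the tested Wick square. -/
lemma frequency_lower_bound {A : SpaceTime → ℝ} (hA : Integrable A) (hA0 : ∀ ζ, 0 ≤ A ζ)
    {φ : Plane → ℝ} (hφ : Integrable φ) :
    Integrable (fun w : SpaceTime × SpaceTime => A w.1 * A w.2 *
      (∫ y, φ y * Real.cos (phase 0 y w.1 - phase 0 y w.2)) ^ 2) (volume.prod volume) ∧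
    ∫ w : SpaceTime × SpaceTime, A w.1 * A w.2 *
      (∫ y, φ y * Real.cos (phase 0 y w.1 - phase 0 y w.2)) ^ 2 ∂(volume.prod volume) ≤
    ∫ p : Plane × Plane, 2 * (∫ ζ, A ζ * Real.cos (phase 0 p.1 ζ - phase 0 p.2 ζ)) ^ 2 *
      (φ p.1 * φ p.2) ∂(volume.prod volume) := by
  have mp : ∀ {α : Type} [MeasurableSpace α] {f : α → Plane} {g : α → SpaceTime},
      Measurable f → Measurable g → Measurable fun a => phase 0 (f a) (g a) :=
    fun hf hg => measurable_phase.comp (hf.prodMk hg)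
  have hcosm : Measurable fun q : (Plane × Plane) × (SpaceTime × SpaceTime) =>
      Real.cos (phase 0 q.1.1 q.2.1 - phase 0 q.1.2 q.2.1) *
        Real.cos (phase 0 q.1.1 q.2.2 - phase 0 q.1.2 q.2.2) := by
    refine Measurable.mul ?_ ?_
    · exact Real.measurable_cos.comp ((mp (by fun_prop) (by fun_prop)).sub
        (mp (by fun_prop) (by fun_prop)))
    · exact Real.measurable_cos.comp ((mp (by fun_prop) (by fun_prop)).sub
        (mp (by fun_prop) (by fun_prop)))
  have hint : Integrable (fun q : (Plane × Plane) × (SpaceTime × SpaceTime) =>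
      ((φ q.1.1 * φ q.1.2) * (A q.2.1 * A q.2.2)) *
      (Real.cos (phase 0 q.1.1 q.2.1 - phase 0 q.1.2 q.2.1) *
        Real.cos (phase 0 q.1.1 q.2.2 - phase 0 q.1.2 q.2.2)))
      ((volume.prod volume).prod (volume.prod volume)) :=
    ((hφ.mul_prod hφ).mul_prod (hA.mul_prod hA)).mul_bdd (c := 1) hcosm.aestronglyMeasurable
      (ae_of_all _ fun q => abs_mul_abs_le_one (Real.abs_cos_le_one _) (Real.abs_cos_le_one _))
  -- The 2 of Wick's formula compensates the 1/2 of `sq_integral_cos_le`.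
  have hpt : ∀ w : SpaceTime × SpaceTime, A w.1 * A w.2 *
      (∫ y, φ y * Real.cos (phase 0 y w.1 - phase 0 y w.2)) ^ 2 ≤
      2 * ∫ p : Plane × Plane, ((φ p.1 * φ p.2) * (A w.1 * A w.2)) *
      (Real.cos (phase 0 p.1 w.1 - phase 0 p.2 w.1) *
        Real.cos (phase 0 p.1 w.2 - phase 0 p.2 w.2)) ∂(volume.prod volume) := by
    intro w
    have h1 := sq_integral_cos_le hφ (continuous_phase_left 0 w.1) (continuous_phase_left 0 w.2)
    have h2 : ∫ p : Plane × Plane, ((φ p.1 * φ p.2) * (A w.1 * A w.2)) *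
      (Real.cos (phase 0 p.1 w.1 - phase 0 p.2 w.1) *
        Real.cos (phase 0 p.1 w.2 - phase 0 p.2 w.2)) ∂(volume.prod volume) =
        A w.1 * A w.2 * ∫ p : Plane × Plane, φ p.1 * φ p.2 *
      (Real.cos (phase 0 p.1 w.1 - phase 0 p.2 w.1) *
        Real.cos (phase 0 p.1 w.2 - phase 0 p.2 w.2)) ∂(volume.prod volume) := by
      rw [← integral_const_mul]
      congr 1
      funext p
      ring
    rw [h2]
    have h3 := mul_nonneg (hA0 w.1) (hA0 w.2)
    nlinarith [mul_le_mul_of_nonneg_left h1 h3]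
  have hI := (hint.integral_prod_right).const_mul 2
  have hm : AEStronglyMeasurable (fun w : SpaceTime × SpaceTime => A w.1 * A w.2 *
      (∫ y, φ y * Real.cos (phase 0 y w.1 - phase 0 y w.2)) ^ 2) (volume.prod volume) := by
    refine (hA.mul_prod hA).aestronglyMeasurable.mul (AEStronglyMeasurable.pow ?_ 2)
    have h1 : AEStronglyMeasurable (fun q : (SpaceTime × SpaceTime) × Plane =>
        φ q.2 * Real.cos (phase 0 q.2 q.1.1 - phase 0 q.2 q.1.2))
        ((volume.prod volume).prod volume) := by
      refine (hφ.aestronglyMeasurable.comp_snd).mul (Measurable.aestronglyMeasurable ?_)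
      exact Real.measurable_cos.comp ((mp (by fun_prop) (by fun_prop)).sub
        (mp (by fun_prop) (by fun_prop)))
    exact h1.integral_prod_right'
  have hL : Integrable (fun w : SpaceTime × SpaceTime => A w.1 * A w.2 *
      (∫ y, φ y * Real.cos (phase 0 y w.1 - phase 0 y w.2)) ^ 2) (volume.prod volume) := by
    refine hI.mono' hm (ae_of_all _ fun w => ?_)
    rw [Real.norm_of_nonneg (mul_nonneg (mul_nonneg (hA0 _) (hA0 _)) (sq_nonneg _))]
    exact hpt w
  refine ⟨hL, ?_⟩
  refine (integral_mono hL hI hpt).trans (le_of_eq ?_)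
  rw [integral_const_mul, ← integral_integral_swap (f := fun (p : Plane × Plane)
    (w : SpaceTime × SpaceTime) => ((φ p.1 * φ p.2) * (A w.1 * A w.2)) *
      (Real.cos (phase 0 p.1 w.1 - phase 0 p.2 w.1) *
        Real.cos (phase 0 p.1 w.2 - phase 0 p.2 w.2))) hint, ← integral_const_mul]
  congr 1
  funext p
  rw [sq, ← integral_prod_mul (fun ζ => A ζ * Real.cos (phase 0 p.1 ζ - phase 0 p.2 ζ))
    (fun ζ => A ζ * Real.cos (phase 0 p.1 ζ - phase 0 p.2 ζ)), mul_assoc, ← integral_mul_const]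
  congr 2
  funext w
  ring

/-- A lower bound by the masses of disjoint small sets of frequencies. -/
lemma sum_sq_le_of_disjoint {A : SpaceTime → ℝ} (hA : Integrable A) (hA0 : ∀ ζ, 0 ≤ A ζ)
    {φ : Plane → ℝ} (hφ : Integrable φ) (hφ0 : ∀ y, 0 ≤ φ y) {ε : ℝ}
    (hε : ∀ y, φ y ≠ 0 → ε * (|y 0| + |y 1|) ≤ 1) {ι : Type*} (s : Finset ι)
    (Q : ι → Set SpaceTime) (hQm : ∀ i, MeasurableSet (Q i))
    (hQd : (s : Set ι).PairwiseDisjoint Q)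
    (hQε : ∀ i, ∀ ζ ∈ Q i, ∀ ζ' ∈ Q i, |ζ 1 - ζ' 1| ≤ ε ∧ |ζ 2 - ζ' 2| ≤ ε) :
    (1 / 2 * ∫ y, φ y) ^ 2 * ∑ i ∈ s, (∫ ζ in Q i, A ζ) ^ 2 ≤
      ∫ w : SpaceTime × SpaceTime, A w.1 * A w.2 *
        (∫ y, φ y * Real.cos (phase 0 y w.1 - phase 0 y w.2)) ^ 2 ∂(volume.prod volume) := by
  classical
  set κ := (1 / 2 * ∫ y, φ y) ^ 2 with hκ
  have hκ0 : 0 ≤ κ := sq_nonneg _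
  have hsum : ∀ i, (∫ ζ in Q i, A ζ) ^ 2 = ∫ w : SpaceTime × SpaceTime,
      (Q i).indicator A w.1 * (Q i).indicator A w.2 ∂(volume.prod volume) := fun i => by
    rw [integral_prod_mul, integral_indicator (hQm i), sq]
  have hi : ∀ i, Integrable (fun w : SpaceTime × SpaceTime =>
      (Q i).indicator A w.1 * (Q i).indicator A w.2) (volume.prod volume) := fun i =>
    (hA.indicator (hQm i)).mul_prod (hA.indicator (hQm i))
  simp_rw [hsum]
  rw [← integral_finsetSum s fun i _ => hi i, ← integral_const_mul]
  refine integral_mono ((integrable_finsetSum s fun i _ => hi i).const_mul κ)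
    (frequency_lower_bound hA hA0 hφ).1 fun w => ?_
  simp only
  have hRHS : 0 ≤ A w.1 * A w.2 *
      (∫ y, φ y * Real.cos (phase 0 y w.1 - phase 0 y w.2)) ^ 2 :=
    mul_nonneg (mul_nonneg (hA0 _) (hA0 _)) (sq_nonneg _)
  -- By disjointness at most one set contains both frequencies. Then the phases differ by at most 1
  -- on the support of φ, the cosine is at least 1/2, and the inner integral is at least ½∫φ.
  by_cases h : ∃ i ∈ s, w.1 ∈ Q i ∧ w.2 ∈ Q i
  · obtain ⟨i, his, h1, h2⟩ := h
    rw [Finset.sum_eq_single_of_mem i his]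
    · rw [indicator_of_mem h1, indicator_of_mem h2, mul_comm κ]
      refine mul_le_mul_of_nonneg_left ?_ (mul_nonneg (hA0 _) (hA0 _))
      have h0 : 0 ≤ ∫ y, φ y := integral_nonneg hφ0
      refine pow_le_pow_left₀ (by positivity) ?_ 2
      rw [← integral_const_mul]
      refine integral_mono (hφ.const_mul _) (hφ.mul_bdd (c := 1)
        (Continuous.aestronglyMeasurable ?_) (ae_of_all _ fun y => Real.abs_cos_le_one _))
          fun y => ?_
      · exact Real.continuous_cos.comp
          ((continuous_phase_left 0 w.1).sub (continuous_phase_left 0 w.2))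
      · simp only
        by_cases hy : φ y = 0
        · simp [hy]
        · obtain ⟨d1, d2⟩ := hQε i _ h1 _ h2
          have h3 : |phase 0 y w.1 - phase 0 y w.2| ≤ 1 := by
            have e : phase 0 y w.1 - phase 0 y w.2 =
                y 0 * (w.1 1 - w.2 1) + y 1 * (w.1 2 - w.2 2) := by
              simp only [phase]
              ring
            rw [e]
            refine (abs_add_le _ _).trans ?_
            rw [abs_mul, abs_mul]
            refine le_trans ?_ (hε y hy)
            nlinarith [mul_le_mul_of_nonneg_left d1 (abs_nonneg (y 0)),
              mul_le_mul_of_nonneg_left d2 (abs_nonneg (y 1))]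
          have h5 := Real.one_sub_sq_div_two_le_cos (x := phase 0 y w.1 - phase 0 y w.2)
          have h6 : (phase 0 y w.1 - phase 0 y w.2) ^ 2 ≤ 1 := by
            rw [← sq_abs]
            nlinarith [abs_nonneg (phase 0 y w.1 - phase 0 y w.2)]
          rw [mul_comm]
          exact mul_le_mul_of_nonneg_left (by linarith) (hφ0 y)
    · intro j hj hji
      have := hQd hj his hji
      rw [indicator_of_notMem fun h => (Set.disjoint_left.1 this h h1), zero_mul]
  · push Not at h
    rw [Finset.sum_eq_zero, mul_zero]
    · exact hRHS
    · intro i hi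
      by_cases h1 : w.1 ∈ Q i
      · rw [indicator_of_notMem (h i hi h1), mul_zero]
      · rw [indicator_of_notMem h1, zero_mul]

end Variance

/-! ### Sobolev norms -/

open TemperedDistribution

/-- Testing against a fixed function is bounded by the localized Sobolev norm. -/
lemma exists_enorm_integral_le_localSobolevNorm (s : ℝ) (D : Set Plane) (φ : 𝓢(Plane, ℂ))
    (hφ : HasCompactSupport φ) (hφD : tsupport φ ⊆ interior D) :
    ∃ C : ℝ≥0∞, C ≠ ⊤ ∧ ∀ f : Plane → ℝ,
      ‖∫ x, (f x : ℂ) * φ x‖ₑ ≤ C * localSobolevNorm s D f := by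
  -- Duality: the inverse Bessel potential is moved from the extension onto the test function. This
  -- produces a Schwartz function for every order `s`, and Cauchy–Schwarz applies.
  set χ : 𝓢(Plane, ℂ) := 𝓕 (SchwartzMap.smulLeftCLM ℂ
    (fun x : Plane => (((1 + ‖x‖ ^ 2) ^ (-s / 2) : ℝ) : ℂ)) (𝓕⁻ φ)) with hχ
  have hC : eLpNorm χ 2 volume + 1 ≠ ⊤ := by simpa using (χ.memLp 2 volume).eLpNorm_ne_top
  -- Adding 1 makes the constant nonzero, so that multiplication by it commutes with infima that may
  -- be infinite.
  have hC0 : eLpNorm χ 2 volume + 1 ≠ 0 := by simp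
  refine ⟨eLpNorm χ 2 volume + 1, hC, fun f => ?_⟩
  unfold localSobolevNorm sobolevNorm
  simp_rw [ENNReal.mul_iInf_of_ne hC0 hC]
  refine le_iInf fun g => le_iInf fun hg => le_iInf fun k => le_iInf fun hk => ?_
  rw [← hg φ hφ hφD]
  have h1 : g = besselPotential Plane ℂ (-s) (k : 𝓢'(Plane, ℂ)) :=
    ((besselPotential_neg_apply_eq_iff s _ _).2 hk).symm
  have h2 : g φ = ∫ x, χ x • k x := by
    rw [h1, besselPotential, fourierMultiplierCLM_apply_apply, Lp.toTemperedDistribution_apply]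
  rw [h2]
  refine (enorm_integral_le_lintegral_enorm _).trans ?_
  have h3 := eLpNorm_smul_le_mul_eLpNorm (p := 2) (q := 2) (r := 1) (Lp.aestronglyMeasurable k)
    (χ.memLp 2 volume).aestronglyMeasurable
  rw [eLpNorm_one_eq_lintegral_enorm, ← Lp.enorm_def] at h3
  refine h3.trans ?_
  gcongr
  exact le_self_add

/-- The localized Sobolev norm of nonpositive order is bounded by the `L²` norm. -/
lemma localSobolevNorm_sq_le {s : ℝ} (hs : s ≤ 0) {D : Set Plane} (hD : IsCompact D)
    {f : Plane → ℝ} (hf : Continuous f) :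
    localSobolevNorm s D f ^ 2 ≤ ∫⁻ y in D, ENNReal.ofReal (f y ^ 2) := by
  -- Extension by zero is one admissible competitor in the infimum; for s ≤ 0 the Bessel multiplier
  -- is at most 1, so its Sobolev norm is at most its L² norm.
  set F : Plane → ℂ := D.indicator fun y => (f y : ℂ) with hF
  have hFc : Continuous fun y => (f y : ℂ) := by fun_prop
  have hFm : MemLp F 2 (volume : Measure Plane) := by
    rw [hF, memLp_indicator_iff_restrict hD.measurableSet]
    obtain ⟨C, hC⟩ := hD.exists_bound_of_continuousOn hFc.continuousOn
    have : IsFiniteMeasure (volume.restrict D : Measure Plane) := ⟨by simpa using hD.measure_lt_top⟩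
    exact MemLp.of_bound hFc.aestronglyMeasurable C
      ((ae_restrict_mem hD.measurableSet).mono fun y hy => hC y hy)
  set G : Lp ℂ 2 (volume : Measure Plane) := hFm.toLp F with hG
  have hagree : AgreesOn D (G : 𝓢'(Plane, ℂ)) f := by
    intro φ hφ hφD
    rw [Lp.toTemperedDistribution_apply]
    refine integral_congr_ae ?_
    filter_upwards [hFm.coeFn_toLp] with y hy
    rw [hG, hy, smul_eq_mul, mul_comm]
    by_cases hyD : y ∈ D
    · rw [hF, indicator_of_mem hyD]
    · have : φ y = 0 := by
        by_contra h
        exact hyD (interior_subset (hφD (subset_tsupport _ h)))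
      rw [this, mul_zero, mul_zero]
  have hm1 : ∀ x : Plane, ‖(((1 + ‖x‖ ^ 2) ^ (s / 2) : ℝ) : ℂ)‖ ≤ 1 := by
    intro x
    rw [Complex.norm_real, Real.norm_of_nonneg (by positivity)]
    exact Real.rpow_le_one_of_one_le_of_nonpos (by simp) (by linarith)
  have hmt : (fun x : Plane => (((1 + ‖x‖ ^ 2) ^ (s / 2) : ℝ) : ℂ)).HasTemperateGrowth := by
    fun_prop
  have hmm : MemLp (fun x : Plane => (((1 + ‖x‖ ^ 2) ^ (s / 2) : ℝ) : ℂ)) ∞ volume :=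
    memLp_top_of_bound hmt.1.continuous.aestronglyMeasurable 1 (ae_of_all _ hm1)
  set k : Lp ℂ 2 (volume : Measure Plane) := 𝓕⁻ (hmm.toLp _ • 𝓕 G) with hk
  have hkG : besselPotential Plane ℂ s (G : 𝓢'(Plane, ℂ)) = (k : 𝓢'(Plane, ℂ)) := by
    rw [besselPotential, TemperedDistribution.fourierMultiplierCLM_apply, hk,
      ← Lp.fourierInv_toTemperedDistribution_eq, Lp.toTemperedDistribution_smul_eq hmt,
      Lp.fourier_toTemperedDistribution_eq]
  have hnorm : ‖k‖ ≤ ‖G‖ := by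
    rw [hk, ← Lp.norm_fourier_eq, FourierTransform.fourier_fourierInv_eq]
    refine (Lp.norm_smul_le _ _).trans ?_
    rw [Lp.norm_fourier_eq]
    refine mul_le_of_le_one_left (norm_nonneg _) ?_
    rw [Lp.norm_toLp]
    refine ENNReal.toReal_le_of_le_ofReal zero_le_one ?_
    rw [ENNReal.ofReal_one]
    simpa using eLpNorm_le_of_ae_bound (p := ∞) (μ := volume) (ae_of_all _ hm1)
  have hle : localSobolevNorm s D f ≤ ‖G‖ₑ := by
    refine (iInf₂_le (G : 𝓢'(Plane, ℂ)) hagree).trans ((iInf₂_le k hkG).trans ?_)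
    rw [← ofReal_norm, ← ofReal_norm]
    exact ENNReal.ofReal_le_ofReal hnorm
  refine (pow_le_pow_left' hle 2).trans (le_of_eq ?_)
  rw [hG, Lp.enorm_toLp, hF, eLpNorm_indicator_eq_eLpNorm_restrict hD.measurableSet]
  have h2 := eLpNorm_nnreal_pow_eq_lintegral (f := fun y => (f y : ℂ))
    (μ := volume.restrict D) (p := 2) (by norm_num)
  norm_num at h2
  rw [h2]
  refine lintegral_congr fun y => ?_
  rw [← ofReal_norm, ← ENNReal.ofReal_pow (norm_nonneg _), Complex.norm_real, Real.norm_eq_abs, sq_abs]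

/-! ### Divergence of the sum over resonant cubes -/

lemma norm_harmonizableDeriv_zero (h : ℝ) {u : ℝ} (hu : 0 < u) :
    ‖harmonizableDeriv h 0 u‖ = u ^ (1 / 2 - h) := by
  have h1 : ‖harmonizableDeriv h 0 u‖ = u / u ^ (h + 1 / 2) := by
    rw [harmonizableDeriv, norm_div, Complex.norm_real]
    simp [abs_of_pos hu, abs_of_pos (Real.rpow_pos_of_pos hu _)]
  rw [h1, div_eq_iff (by positivity), ← Real.rpow_add hu]
  ring_nf
  rw [Real.rpow_one]

/-- The ratio u/x lies in [1/2, 3], so its powers with exponent in [-1, 1] are at least 1/3; the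
sign of the exponent is immaterial. -/
lemma rpow_div_three_le {x u e : ℝ} (hx : 0 < x) (h1 : x / 2 ≤ u) (h2 : u ≤ 3 * x)
    (he : |e| ≤ 1) : x ^ e / 3 ≤ u ^ e := by
  have hu : 0 < u := by linarith
  obtain ⟨he1, he2⟩ := abs_le.1 he
  have hr : u = x * (u / x) := by field_simp
  have hr0 : 0 < u / x := by positivity
  rw [hr, Real.mul_rpow hx.le hr0.le, div_eq_mul_inv]
  refine mul_le_mul_of_nonneg_left ?_ (by positivity)
  rcases le_total 1 (u / x) with h | h
  · calc (3 : ℝ)⁻¹ ≤ (u / x)⁻¹ := inv_anti₀ hr0 (by rw [div_le_iff₀ hx]; exact h2)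
      _ = (u / x) ^ (-1 : ℝ) := (Real.rpow_neg_one _).symm
      _ ≤ _ := Real.rpow_le_rpow_of_exponent_le h he1
  · calc (3 : ℝ)⁻¹ ≤ u / x := by rw [le_div_iff₀ hx]; linarith
      _ = (u / x) ^ (1 : ℝ) := (Real.rpow_one _).symm
      _ ≤ _ := Real.rpow_le_rpow_of_exponent_ge hr0 h he2

/-- Size of the symbol of the solution near the light cone. -/
lemma norm_sq_symbol_ge {H : Fin 3 → ℝ} (hH : ∀ i, H i ∈ Ioo (0 : ℝ) 1)
    (hsum : H 0 + H 1 + H 2 ≤ 1) {n : ℕ} {t x : ℝ} (ht : 0 < t) (hx : 1 ≤ x) (hxt : 8 / t ≤ x)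
    (hn : 3 * x ≤ 2 ^ n) {ζ : SpaceTime} (h0 : ζ 0 ∈ Icc (x / 2) (3 * x))
    (h1 : ζ 1 ∈ Icc x (2 * x)) (h2 : ζ 2 ∈ Icc x (2 * x))
    (hres : |ζ 0 - Real.sqrt (ζ 1 ^ 2 + ζ 2 ^ 2)| * t ≤ 1) :
    (t / 648) ^ 2 / x ≤ ‖sheetSymbol H n ζ * waveMultiplier t ζ‖ ^ 2 := by
  have hx0 : 0 < x := by linarith
  set ρ := Real.sqrt (ζ 1 ^ 2 + ζ 2 ^ 2) with hρ
  have hρ2 : ρ ^ 2 = ζ 1 ^ 2 + ζ 2 ^ 2 := Real.sq_sqrt (by positivity)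
  have hρx : x ≤ ρ := by
    refine Real.le_sqrt_of_sq_le ?_
    nlinarith [h1.1, sq_nonneg (ζ 2)]
  have hρx3 : ρ ≤ 3 * x := by
    refine Real.sqrt_le_iff.2 ⟨by positivity, ?_⟩
    nlinarith [h1.1, h1.2, h2.1, h2.2]
  have hρ0 : 0 < ρ := by linarith
  -- The bound t/(8ρ) with ρ ≤ 3x. Together with the factor 27 = 3³ from the three coordinates this
  -- gives 648 = 27 · 24.
  have hγ : t / (24 * x) ≤ ‖waveMultiplier t ζ‖ := by
    rw [waveMultiplier_eq_duhamel ht ζ hρ0.ne' hρ2]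
    refine le_trans ?_ (norm_duhamel_ge ht (hxt.trans hρx) (by linarith [h0.1]) hres)
    exact div_le_div_of_nonneg_left ht.le (by positivity) (by linarith)
  have hcut : ζ ∈ freqCutoff n := by
    refine ⟨?_, hρx3.trans hn⟩
    rw [abs_of_nonneg (by linarith [h0.1])]
    exact h0.2.trans hn
  have hfac : ∀ i, x / 2 ≤ ζ i → ζ i ≤ 3 * x →
      x ^ (1 / 2 - H i) / 3 ≤ ‖harmonizableDeriv (H i) 0 (ζ i)‖ := by
    intro i hi1 hi2
    rw [norm_harmonizableDeriv_zero _ (by linarith)]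
    exact rpow_div_three_le hx0 hi1 hi2 (abs_le.2 ⟨by linarith [(hH i).2], by linarith [(hH i).1]⟩)
  -- The critical condition enters here: the total exponent 3/2 - (H₀+H₁+H₂) is at least 1/2, and x
  -- ≥ 1.
  have hS : Real.sqrt x / 27 ≤ ‖sheetSymbol H n ζ‖ := by
    rw [sheetSymbol, indicator_of_mem hcut, norm_mul, norm_mul]
    calc Real.sqrt x / 27 ≤ x ^ (1 / 2 - H 0 + (1 / 2 - H 1) + (1 / 2 - H 2)) / 27 := by
          gcongr
          rw [Real.sqrt_eq_rpow]
          exact Real.rpow_le_rpow_of_exponent_le hx (by linarith)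
      _ = x ^ (1 / 2 - H 0) / 3 * (x ^ (1 / 2 - H 1) / 3) * (x ^ (1 / 2 - H 2) / 3) := by
          rw [Real.rpow_add hx0, Real.rpow_add hx0]
          ring
      _ ≤ _ := by
          gcongr
          · exact hfac 0 h0.1 h0.2
          · exact hfac 1 (by linarith [h1.1]) (by linarith [h1.2])
          · exact hfac 2 (by linarith [h2.1]) (by linarith [h2.2])
  rw [norm_mul]
  calc (t / 648) ^ 2 / x = (Real.sqrt x / 27 * (t / (24 * x))) ^ 2 := by
        have : Real.sqrt x ^ 2 = x := Real.sq_sqrt hx0.le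
        field_simp
        rw [this]
        ring
    _ ≤ _ := by gcongr

/-- A cube of side `h` touching the light cone. -/
def resonantCube (h : ℝ) (p : ℕ × ℕ) : Set SpaceTime :=
  {ζ | ζ 0 ∈ Ico (Real.sqrt ((p.1 * h) ^ 2 + (p.2 * h) ^ 2) - h)
      (Real.sqrt ((p.1 * h) ^ 2 + (p.2 * h) ^ 2)) ∧
    ζ 1 ∈ Ico (p.1 * h) ((p.1 + 1) * h) ∧ ζ 2 ∈ Ico (p.2 * h) ((p.2 + 1) * h)}

lemma measurableSet_resonantCube (h : ℝ) (p : ℕ × ℕ) : MeasurableSet (resonantCube h p) :=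
  (measurable_coord 0 measurableSet_Ico).inter
    ((measurable_coord 1 measurableSet_Ico).inter (measurable_coord 2 measurableSet_Ico))

lemma volume_resonantCube {h : ℝ} (hh : 0 ≤ h) (p : ℕ × ℕ) :
    volume.real (resonantCube h p) = h ^ 3 := by
  set r := Real.sqrt ((p.1 * h) ^ 2 + (p.2 * h) ^ 2)
  have e : resonantCube h p = WithLp.ofLp ⁻¹' (Set.univ.pi
      ![Ico (r - h) r, Ico (p.1 * h) ((p.1 + 1) * h), Ico (p.2 * h) ((p.2 + 1) * h)]) := by
    ext ζ
    simp [resonantCube, Set.mem_pi, Fin.forall_fin_succ, r]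
  rw [measureReal_def, e, (PiLp.volume_preserving_ofLp (Fin 3)).measure_preimage
    (MeasurableSet.univ_pi fun i => by fin_cases i <;> exact measurableSet_Ico).nullMeasurableSet,
    volume_pi_pi]
  simp only [Fin.prod_univ_three]
  simp [Real.volume_Ico, add_mul, hh]
  ring

lemma Ico_mul_natCast_eq {h u : ℝ} (hh : 0 < h) {j k : ℕ} (hj : u ∈ Ico (j * h) ((j + 1) * h))
    (hk : u ∈ Ico (k * h) ((k + 1) * h)) : j = k := by
  have h1 : (j : ℝ) < k + 1 := lt_of_mul_lt_mul_right (hj.1.trans_lt hk.2) hh.le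
  have h2 : (k : ℝ) < j + 1 := lt_of_mul_lt_mul_right (hk.1.trans_lt hj.2) hh.le
  have h3 : j < k + 1 := by exact_mod_cast h1
  have h4 : k < j + 1 := by exact_mod_cast h2
  omega

lemma disjoint_resonantCube {h : ℝ} (hh : 0 < h) {p q : ℕ × ℕ} (hpq : p ≠ q) :
    Disjoint (resonantCube h p) (resonantCube h q) := by
  rw [Set.disjoint_left]
  intro ζ hp hq
  exact hpq (Prod.ext (Ico_mul_natCast_eq hh hp.2.1 hq.2.1) (Ico_mul_natCast_eq hh hp.2.2 hq.2.2))

lemma abs_sub_le_of_mem_resonantCube {h : ℝ} {p : ℕ × ℕ} {ζ ζ' : SpaceTime}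
    (hζ : ζ ∈ resonantCube h p) (hζ' : ζ' ∈ resonantCube h p) :
    |ζ 1 - ζ' 1| ≤ h ∧ |ζ 2 - ζ' 2| ≤ h := by
  obtain ⟨-, h1, h2⟩ := hζ
  obtain ⟨-, h1', h2'⟩ := hζ'
  simp only [mem_Ico, add_mul, one_mul] at h1 h2 h1' h2'
  constructor <;> rw [abs_le] <;> constructor <;> linarith [h1.1, h1.2, h2.1, h2.2]

/-- Size of the symbol of the solution on a resonant cube. -/
lemma norm_sq_symbol_ge_of_mem_resonantCube {H : Fin 3 → ℝ} (hH : ∀ i, H i ∈ Ioo (0 : ℝ) 1)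
    (hsum : H 0 + H 1 + H 2 ≤ 1) {n : ℕ} {t h : ℝ} (ht : 0 < t) (hh : 0 < h) (hht : 3 * h * t ≤ 1)
    {p : ℕ × ℕ} (hp2 : 2 ≤ p.1) (hp : p.1 ≤ p.2) (hp' : p.2 < 2 * p.1) (hx : 1 ≤ p.1 * h)
    (hxt : 8 / t ≤ p.1 * h) (hn : 3 * (p.1 * h) ≤ 2 ^ n) {ζ : SpaceTime}
    (hζ : ζ ∈ resonantCube h p) :
    (t / 648) ^ 2 / (p.1 * h) ≤ ‖sheetSymbol H n ζ * waveMultiplier t ζ‖ ^ 2 := by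
  obtain ⟨h0, h1, h2⟩ := hζ
  set r := Real.sqrt ((p.1 * h) ^ 2 + (p.2 * h) ^ 2) with hr
  set x := (p.1 : ℝ) * h with hxd
  have hx0 : 0 < x := by linarith
  have hp2' : 2 * h ≤ x := by
    have : (2 : ℝ) ≤ p.1 := by exact_mod_cast hp2
    exact mul_le_mul_of_nonneg_right this hh.le
  have hkx : x ≤ p.2 * h := mul_le_mul_of_nonneg_right (by exact_mod_cast hp) hh.le
  have hkx2 : (p.2 + 1) * h ≤ 2 * x := by
    have : (p.2 : ℝ) + 1 ≤ 2 * p.1 := by exact_mod_cast hp'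
    calc _ ≤ 2 * p.1 * h := mul_le_mul_of_nonneg_right this hh.le
      _ = _ := by rw [hxd]; ring
  simp only [mem_Ico, add_mul, one_mul] at h0 h1 h2 hkx2
  set y := (p.2 : ℝ) * h
  have hr2 : r ^ 2 = x ^ 2 + y ^ 2 := Real.sq_sqrt (by positivity)
  have hr0 : 0 ≤ r := Real.sqrt_nonneg _
  have hrx : x ≤ r := Real.le_sqrt_of_sq_le (by nlinarith [sq_nonneg y])
  have hrx3 : r ≤ 3 * x := Real.sqrt_le_iff.2 ⟨by positivity, by nlinarith⟩
  refine norm_sq_symbol_ge hH hsum ht hx hxt hn ⟨by linarith [h0.1], by linarith [h0.2]⟩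
    ⟨h1.1, by linarith [h1.2]⟩ ⟨by linarith [h2.1], by linarith [h2.2]⟩ ?_
  -- On the cube |η| lies in [r, r + 2h] and ξ in [r - h, r), so the distance to the light cone is
  -- at most 3h.
  have l1 : r ≤ Real.sqrt (ζ 1 ^ 2 + ζ 2 ^ 2) := by
    refine Real.sqrt_le_sqrt ?_
    have := h1.1
    have := h2.1
    gcongr
  have l2 : Real.sqrt (ζ 1 ^ 2 + ζ 2 ^ 2) ≤ r + 2 * h := by
    refine Real.sqrt_le_iff.2 ⟨by positivity, ?_⟩
    have hyr : y ≤ r := Real.le_sqrt_of_sq_le (by nlinarith [sq_nonneg x])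
    have e1 : ζ 1 ^ 2 ≤ (x + h) ^ 2 := pow_le_pow_left₀ (by linarith [h1.1]) h1.2.le 2
    have e2 : ζ 2 ^ 2 ≤ (y + h) ^ 2 := pow_le_pow_left₀ (by linarith [h2.1]) h2.2.le 2
    nlinarith
  calc |ζ 0 - Real.sqrt (ζ 1 ^ 2 + ζ 2 ^ 2)| * t ≤ 3 * h * t := by
        gcongr
        rw [abs_le]
        constructor <;> linarith [h0.1, h0.2]
    _ ≤ 1 := hht

/-- Divergence of the sum of the squared masses of the resonant cubes. -/
lemma exists_finset_resonantCube {H : Fin 3 → ℝ} (hH : ∀ i, H i ∈ Ioo (0 : ℝ) 1)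
    (hsum : H 0 + H 1 + H 2 ≤ 1) {t h c : ℝ} (ht : 0 < t) (hh : 0 < h) (hht : 3 * h * t ≤ 1)
    (hc : c ≠ 0) (M : ℝ) :
    ∃ s : Finset (ℕ × ℕ), ∀ᶠ n : ℕ in atTop, ∀ A : SpaceTime → ℝ, Integrable A →
      (∀ ζ, A ζ = c ^ 2 * ‖sheetSymbol H n ζ * waveMultiplier t ζ‖ ^ 2) →
      M ≤ ∑ p ∈ s, (∫ ζ in resonantCube h p, A ζ) ^ 2 := by
  -- From index `J` on the cubes satisfy the size conditions: J ≥ 2 keeps ξ ≥ x/2, and Jh ≥ max(1,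
  -- 8/t) gives the bounds for the symbol and the multiplier.
  obtain ⟨J, hJ⟩ := exists_nat_ge (max 2 (max 1 (8 / t) / h))
  have hJ2 : 2 ≤ J := by exact_mod_cast (le_max_left _ _).trans hJ
  have hJh : max 1 (8 / t) ≤ J * h := (div_le_iff₀ hh).1 ((le_max_right _ _).trans hJ)
  set κ : ℝ := c ^ 2 * (t / 648) ^ 2 * h ^ 2 with hκ
  have hκ0 : 0 < κ := by positivity
  have hdiv : Tendsto (fun N : ℕ => κ ^ 2 * ∑ j ∈ Finset.Ico J N, (1 / (j : ℝ))) atTop atTop := by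
    refine Tendsto.const_mul_atTop (by positivity) ?_
    have h1 := tendsto_atTop_add_const_right _ (-∑ j ∈ Finset.range J, (1 / (j : ℝ)))
      (not_summable_iff_tendsto_nat_atTop_of_nonneg (fun j => by positivity) |>.1
        Real.not_summable_one_div_natCast)
    refine h1.congr' ?_
    filter_upwards [eventually_ge_atTop J] with N hN
    rw [Finset.sum_Ico_eq_sub _ hN, sub_eq_add_neg]
  obtain ⟨N, hN⟩ := (hdiv.eventually_ge_atTop M).exists
  -- The cone j ≤ k < 2j keeps all frequencies comparable to jh and provides exactly `j` cubes for
  -- each `j`.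
  refine ⟨(Finset.Ico J N ×ˢ Finset.range (2 * N)).filter fun p => p.1 ≤ p.2 ∧ p.2 < 2 * p.1, ?_⟩
  have hpow : Tendsto (fun n : ℕ => (2 : ℝ) ^ n) atTop atTop :=
    tendsto_pow_atTop_atTop_of_one_lt (by norm_num)
  filter_upwards [hpow.eventually_ge_atTop (3 * (N * h))] with n hn A hA hAe
  refine hN.trans ?_
  rw [Finset.sum_filter, Finset.sum_product, Finset.mul_sum]
  refine Finset.sum_le_sum fun j hj => ?_
  obtain ⟨hjJ, hjN⟩ := Finset.mem_Ico.1 hj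
  have hj0 : (0 : ℝ) < j := by exact_mod_cast (by omega : 0 < j)
  rw [← Finset.sum_filter]
  have hfil : (Finset.range (2 * N)).filter (fun k => j ≤ k ∧ k < 2 * j) = Finset.Ico j (2 * j) := by
    ext k
    simp only [Finset.mem_filter, Finset.mem_range, Finset.mem_Ico]
    omega
  simp only
  rw [hfil]
  -- The volume h³ times the density bound c² (t/648)²/(jh) gives κ/j; summing its square over `j`
  -- values of `k` leaves κ²/j.
  have hterm : ∀ k ∈ Finset.Ico j (2 * j), (κ / j) ^ 2 ≤ (∫ ζ in resonantCube h (j, k), A ζ) ^ 2 := by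
    intro k hk
    obtain ⟨hk1, hk2⟩ := Finset.mem_Ico.1 hk
    have hJj : (J : ℝ) * h ≤ j * h := mul_le_mul_of_nonneg_right (by exact_mod_cast hjJ) hh.le
    have hjn : 3 * ((j : ℝ) * h) ≤ 2 ^ n := by
      refine le_trans ?_ hn
      gcongr
    refine pow_le_pow_left₀ (by positivity) ?_ 2
    have hlow : ∀ ζ ∈ resonantCube h (j, k), c ^ 2 * ((t / 648) ^ 2 / (j * h)) ≤ A ζ := by
      intro ζ hζ
      rw [hAe]
      refine mul_le_mul_of_nonneg_left ?_ (sq_nonneg c)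
      exact norm_sq_symbol_ge_of_mem_resonantCube hH hsum ht hh hht (p := (j, k)) (hJ2.trans hjJ)
        hk1 hk2 (((le_max_left _ _).trans hJh).trans hJj)
        (((le_max_right _ _).trans hJh).trans hJj) hjn hζ
    have hvol := volume_resonantCube hh.le (j, k)
    have hfin : volume (resonantCube h (j, k)) ≠ ⊤ := by
      intro htop
      rw [measureReal_def, htop, ENNReal.toReal_top] at hvol
      exact (pow_pos hh 3).ne hvol
    have := setIntegral_ge_of_const_le_real (measurableSet_resonantCube h (j, k)) hfin hlow
      hA.integrableOn
    rw [hvol] at this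
    refine le_trans (le_of_eq ?_) this
    rw [hκ]
    field_simp
  calc κ ^ 2 * (1 / (j : ℝ)) = ∑ k ∈ Finset.Ico j (2 * j), (κ / j) ^ 2 := by
        rw [Finset.sum_const, Nat.card_Ico, nsmul_eq_mul]
        have : ((2 * j - j : ℕ) : ℝ) = j := by
          congr 1
          omega
        rw [this]
        field_simp
    _ ≤ _ := Finset.sum_le_sum hterm

/-! ### The field of solutions -/

lemma norm_exp_I_mul_ofReal (x : ℝ) : ‖Complex.exp (Complex.I * (x : ℂ))‖ = 1 := by
  rw [mul_comm, Complex.norm_exp_ofReal_mul_I]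

/-- It puts the covariance of the solution field in the form ∫ A cos(phase difference) required by
`frequency_lower_bound`. -/
lemma mul_conj_exp_re (a : ℂ) (u v : ℝ) :
    (a * Complex.exp (Complex.I * (u : ℂ)) *
      (starRingEnd ℂ) (a * Complex.exp (Complex.I * (v : ℂ)))).re = ‖a‖ ^ 2 * Real.cos (u - v) := by
  have h1 : a * Complex.exp (Complex.I * (u : ℂ)) *
      (starRingEnd ℂ) (a * Complex.exp (Complex.I * (v : ℂ))) =
      ((‖a‖ ^ 2 : ℝ) : ℂ) * Complex.exp (((u - v : ℝ) : ℂ) * Complex.I) := by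
    rw [map_mul, ← Complex.exp_conj, map_mul, Complex.conj_I, Complex.conj_ofReal,
      mul_mul_mul_comm, Complex.mul_conj, ← Complex.exp_add, Complex.normSq_eq_norm_sq]
    congr 2
    push_cast
    ring
  rw [h1, Complex.re_ofReal_mul, Complex.exp_ofReal_mul_I_re]

/-- The symbol of the solution at the time `t`. -/
def solutionSymbol (c : ℝ) (H : Fin 3 → ℝ) (n : ℕ) (t : ℝ) (ζ : SpaceTime) : ℂ :=
  c * sheetSymbol H n ζ * waveMultiplier t ζ

lemma norm_sq_solutionSymbol (c : ℝ) (H : Fin 3 → ℝ) (n : ℕ) (t : ℝ) (ζ : SpaceTime) :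
    ‖solutionSymbol c H n t ζ‖ ^ 2 = c ^ 2 * ‖sheetSymbol H n ζ * waveMultiplier t ζ‖ ^ 2 := by
  rw [solutionSymbol, mul_assoc, norm_mul, mul_pow, Complex.norm_real, Real.norm_eq_abs, sq_abs]

section Field
variable {Ω : Type*} [MeasurableSpace Ω] {P : Measure Ω}
  {W : Lp ℝ 2 (volume : Measure SpaceTime) → Ω → ℝ} {c T : ℝ} {H : Fin 3 → ℝ}
  {hH : ∀ i, H i ∈ Ioo (0 : ℝ) 1} {n : ℕ} {b ψ : Ω → ℝ → Plane → ℝ}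

/-- The solution at a fixed time is a stationary noise field. -/
lemma IsSheetApproximation.isNoiseField (hb : IsSheetApproximation P W c H hH n T b)
    (hW : IsWhiteNoise P W) (hc : c ≠ 0)
    (hψ : ∀ᵐ ω ∂P, IsWaveSolution T (mixedDeriv T (b ω)) (ψ ω)) {t : ℝ} (ht : t ∈ Ioc 0 T) :
    IsNoiseField P W (fun ω => ψ ω t)
      (fun y ζ => solutionSymbol c H n t ζ * Complex.exp (Complex.I * (phase 0 y ζ : ℂ)))
      (∫ ζ, ‖solutionSymbol c H n t ζ‖ ^ 2) := by
  have h := hb.solution_isNoiseIntegral hW hc hψ ht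
  refine ⟨h, fun y => ?_⟩
  rw [(h y).integral_sq hW]
  congr 1
  funext ζ
  rw [norm_mul, norm_exp_I_mul_ofReal, mul_one, solutionSymbol]

lemma IsSheetApproximation.integrable_symbol (hb : IsSheetApproximation P W c H hH n T b)
    (hW : IsWhiteNoise P W) (hc : c ≠ 0)
    (hψ : ∀ᵐ ω ∂P, IsWaveSolution T (mixedDeriv T (b ω)) (ψ ω)) {t : ℝ} (ht : t ∈ Ioc 0 T) :
    Integrable fun ζ => ‖solutionSymbol c H n t ζ‖ ^ 2 := by
  have h := (hb.solution_isNoiseIntegral hW hc hψ ht 0).1.norm.integrable_sq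
  simpa [solutionSymbol, norm_exp_I_mul_ofReal, phase] using h

lemma wickSquare_eq (hb : IsSheetApproximation P W c H hH n T b)
    (hW : IsWhiteNoise P W) (hc : c ≠ 0)
    (hψ : ∀ᵐ ω ∂P, IsWaveSolution T (mixedDeriv T (b ω)) (ψ ω)) {t : ℝ} (ht : t ∈ Ioc 0 T) (ω : Ω) :
    wickSquare P ψ ω t = fun y => ψ ω t y ^ 2 - ∫ ζ, ‖solutionSymbol c H n t ζ‖ ^ 2 := by
  funext y
  rw [wickSquare, (hb.isNoiseField hW hc hψ ht).variance y]

lemma ae_continuous_solution {f : Ω → ℝ → Plane → ℝ} (hψ : ∀ᵐ ω ∂P, IsWaveSolution T (f ω) (ψ ω))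
    {t : ℝ} (ht : t ∈ Ioc 0 T) : ∀ᵐ ω ∂P, Continuous (ψ ω t) := by
  filter_upwards [hψ] with ω hω
  have h1 : Continuous fun y : Plane => ((t, y) : ℝ × Plane) := by fun_prop
  exact hω.regular.continuousOn.comp_continuous h1 fun y => ⟨Ioc_subset_Icc_self ht, mem_univ y⟩

lemma exists_modification (hb : IsSheetApproximation P W c H hH n T b)
    (hW : IsWhiteNoise P W) (hc : c ≠ 0)
    (hψ : ∀ᵐ ω ∂P, IsWaveSolution T (mixedDeriv T (b ω)) (ψ ω)) {t : ℝ} (ht : t ∈ Ioc 0 T) :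
    ∃ Z : Ω → Plane → ℝ, Measurable (fun p : Ω × Plane => Z p.1 p.2) ∧
      (∀ᵐ ω ∂P, Z ω = ψ ω t) ∧ IsNoiseField P W Z
      (fun y ζ => solutionSymbol c H n t ζ * Complex.exp (Complex.I * (phase 0 y ζ : ℂ)))
      (∫ ζ, ‖solutionSymbol c H n t ζ‖ ^ 2) := by
  have hF := hb.isNoiseField hW hc hψ ht
  obtain ⟨Z, hZ, hZψ⟩ := exists_measurable_modification (ae_continuous_solution hψ ht)
    fun y => (hF.isNoiseIntegral y).aemeasurable hW
  exact ⟨Z, hZ, hZψ.mono fun ω h => funext h, hF.congr hZψ⟩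

/-- The mean square of the localized norm of the Wick square is finite. -/
lemma lintegral_localSobolevNorm_lt_top (hb : IsSheetApproximation P W c H hH n T b)
    (hW : IsWhiteNoise P W) (hc : c ≠ 0)
    (hψ : ∀ᵐ ω ∂P, IsWaveSolution T (mixedDeriv T (b ω)) (ψ ω)) {t : ℝ} (ht : t ∈ Ioc 0 T)
    {D : Set Plane} (hD : IsCompact D) {s : ℝ} (hs : s ≤ 0) :
    ∫⁻ ω, localSobolevNorm s D (wickSquare P ψ ω t) ^ 2 ∂P < ⊤ := by
  -- Tonelli needs joint measurability, which the given field need not have; the modification has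
  -- almost surely the same paths.
  obtain ⟨Z, hZ, hZψ, hF⟩ := exists_modification hb hW hc hψ ht
  refine (lintegral_mono_ae ?_).trans_lt (hF.lintegral_wick_lt_top hW hZ hD.measure_ne_top)
  filter_upwards [hZψ, ae_continuous_solution hψ ht] with ω hω hc'
  rw [wickSquare_eq hb hW hc hψ ht, hω]
  exact localSobolevNorm_sq_le hs hD (by fun_prop)

/-- Lower bound of the variance of the Wick square tested against `φ` by the masses of disjoint
small sets of frequencies. -/
lemma ofReal_le_lintegral_wick_test (hb : IsSheetApproximation P W c H hH n T b)
    (hW : IsWhiteNoise P W) (hc : c ≠ 0)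
    (hψ : ∀ᵐ ω ∂P, IsWaveSolution T (mixedDeriv T (b ω)) (ψ ω)) {t : ℝ} (ht : t ∈ Ioc 0 T)
    {φ : Plane → ℝ} (hφc : Continuous φ) (hφ : Integrable φ) (hφ0 : ∀ y, 0 ≤ φ y) {ε : ℝ}
    (hε : ∀ y, φ y ≠ 0 → ε * (|y 0| + |y 1|) ≤ 1) {ι : Type*} (s : Finset ι)
    (Q : ι → Set SpaceTime) (hQm : ∀ i, MeasurableSet (Q i))
    (hQd : (s : Set ι).PairwiseDisjoint Q)
    (hQε : ∀ i, ∀ ζ ∈ Q i, ∀ ζ' ∈ Q i, |ζ 1 - ζ' 1| ≤ ε ∧ |ζ 2 - ζ' 2| ≤ ε) :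
    ENNReal.ofReal ((1 / 2 * ∫ y, φ y) ^ 2 *
        ∑ i ∈ s, (∫ ζ in Q i, ‖solutionSymbol c H n t ζ‖ ^ 2) ^ 2) ≤
      ∫⁻ ω, ‖∫ y, ((wickSquare P ψ ω t y : ℝ) : ℂ) * ((φ y : ℝ) : ℂ)‖ₑ ^ 2 ∂P := by
  obtain ⟨Z, hZ, hZψ, hF⟩ := exists_modification hb hW hc hψ ht
  have hA := hb.integrable_symbol hW hc hψ ht
  have hA0 : ∀ ζ, 0 ≤ ‖solutionSymbol c H n t ζ‖ ^ 2 := fun ζ => sq_nonneg _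
  have h1 := (sum_sq_le_of_disjoint hA hA0 hφ hφ0 hε s Q hQm hQd hQε).trans
    (frequency_lower_bound hA hA0 hφ).2
  have h2 := hF.lintegral_wick_test hW hZ hφ hφc.measurable
  simp only [mul_conj_exp_re] at h2
  refine (ENNReal.ofReal_le_ofReal h1).trans (h2.symm.le.trans (lintegral_mono_ae ?_))
  filter_upwards [hZψ] with ω hω
  rw [wickSquare_eq hb hW hc hψ ht, hω]
  simp_rw [← Complex.ofReal_mul]
  rw [integral_complex_ofReal, ← ofReal_norm, ← ENNReal.ofReal_pow (norm_nonneg _),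
    Complex.norm_real, Real.norm_eq_abs, sq_abs]

end Field

/-- A nonnegative test function supported in an open set. -/
lemma exists_test_function {U : Set Plane} (hU : IsOpen U) (hne : U.Nonempty) :
    ∃ φ : Plane → ℝ, ContDiff ℝ ((⊤ : ℕ∞) : WithTop ℕ∞) φ ∧ HasCompactSupport φ ∧ tsupport φ ⊆ U ∧
      (∀ y, 0 ≤ φ y) ∧ 0 < ∫ y, φ y := by
  obtain ⟨x, hx⟩ := hne
  obtain ⟨φ, h1, h2, h3, h4, h5⟩ := exists_contDiff_tsupport_subset (n := (⊤ : ℕ∞))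
    (hU.mem_nhds hx)
  have h0 : ∀ y, 0 ≤ φ y := fun y => (h4 (mem_range_self y)).1
  exact ⟨φ, h3, h2, h1, h0, h3.continuous.integral_pos_of_hasCompactSupport_nonneg_nonzero h2 h0
    (x := x) (by rw [h5]; norm_num)⟩

lemma exists_bound_support {φ : Plane → ℝ} (hφ : HasCompactSupport φ) :
    ∃ R, 0 ≤ R ∧ ∀ y, φ y ≠ 0 → |y 0| + |y 1| ≤ R := by
  obtain ⟨R, hR⟩ := hφ.isCompact.exists_bound_of_continuousOn
    (f := fun y : Plane => |y 0| + |y 1|) (by fun_prop)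
  refine ⟨max R 0, le_max_right _ _, fun y hy => ?_⟩
  exact ((le_abs_self _).trans (hR y (subset_tsupport _ hy))).trans (le_max_left _ _)

end FractionalWave

end

/-! ### The proposition -/

open FractionalWave

theorem proposition1p2 {Ω : Type*} [MeasurableSpace Ω] (P : Measure Ω) [IsProbabilityMeasure P]
    (W : Lp ℝ 2 (volume : Measure SpaceTime) → Ω → ℝ) (hW : IsWhiteNoise P W)
    (c : ℝ) (hc : 0 < c)
    (H : Fin 3 → ℝ) (hH : ∀ i, H i ∈ Ioo (0 : ℝ) 1) (hsum : H 0 + H 1 + H 2 ≤ 1)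
    (T : ℝ) (hT : 0 < T)
    (B : ℕ → Ω → ℝ → Plane → ℝ)
    (hB : ∀ n, 1 ≤ n → IsSheetApproximation P W c H hH n T (B n))
    (Ψ : ℕ → Ω → ℝ → Plane → ℝ)
    (hΨ : ∀ n, 1 ≤ n → ∀ᵐ ω ∂P, IsWaveSolution T (mixedDeriv T (B n ω)) (Ψ n ω))
    (D : Set Plane) (hD : IsCompact D) (hDint : (interior D).Nonempty)
    (α : ℝ) (hα : 0 < α) (t : ℝ) (ht : t ∈ Ioc 0 T) :
    (∀ n, 1 ≤ n →
      ∫⁻ ω, localSobolevNorm (-(2 * α)) D (wickSquare P (Ψ n) ω t) ^ 2 ∂P < ⊤) ∧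
    Tendsto
      (fun n => ∫⁻ ω, localSobolevNorm (-(2 * α)) D (wickSquare P (Ψ n) ω t) ^ 2 ∂P)
      atTop (𝓝 ⊤) := by
  refine ⟨fun n hn => lintegral_localSobolevNorm_lt_top (hB n hn) hW hc.ne' (hΨ n hn) ht hD
    (by linarith), ?_⟩
  obtain ⟨φ, hφs, hφc, hφD, hφ0, hφI⟩ := exists_test_function isOpen_interior hDint
  obtain ⟨R, hR0, hR⟩ := exists_bound_support hφc
  -- The side is small enough both for resonance, 3ht ≤ 1, and for non-oscillation on the support of
  -- φ, hR ≤ 1. It does not depend on `n`.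
  set h : ℝ := 1 / (1 + R + 3 * t) with hh
  have ht0 := ht.1
  have hden : 0 < 1 + R + 3 * t := by positivity
  have hh0 : 0 < h := by positivity
  have hht : 3 * h * t ≤ 1 := by
    rw [hh, mul_one_div, div_mul_eq_mul_div, div_le_one hden]
    linarith
  have hε : ∀ y, φ y ≠ 0 → h * (|y 0| + |y 1|) ≤ 1 := by
    intro y hy
    rw [hh, div_mul_eq_mul_div, div_le_one hden]
    linarith [hR y hy]
  have hφc' : HasCompactSupport fun y => ((φ y : ℝ) : ℂ) := hφc.comp_left Complex.ofReal_zero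
  have hφs' : ContDiff ℝ ((⊤ : ℕ∞) : WithTop ℕ∞) fun y => ((φ y : ℝ) : ℂ) :=
    Complex.ofRealCLM.contDiff.comp hφs
  have hsupp : tsupport (hφc'.toSchwartzMap hφs') ⊆ interior D :=
    (closure_mono fun y hy => by simpa using hy).trans hφD
  obtain ⟨C, hC, hCle⟩ := exists_enorm_integral_le_localSobolevNorm (-(2 * α)) D
    (hφc'.toSchwartzMap hφs') hφc' hsupp
  rw [ENNReal.tendsto_nhds_top_iff_nnreal]
  intro x
  have hCx : C ^ 2 * x ≠ ⊤ := ENNReal.mul_ne_top (ENNReal.pow_ne_top hC) ENNReal.coe_ne_top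
  have hκ : 0 < (1 / 2 * ∫ y, φ y) ^ 2 := by positivity
  -- The target mass is chosen so that the tested variance is at least C²x + 1; the extra 1 yields
  -- the strict inequality needed after cancelling C².
  obtain ⟨s, hs⟩ := exists_finset_resonantCube hH hsum ht0 hh0 hht hc.ne'
    (((C ^ 2 * x).toReal + 1) / (1 / 2 * ∫ y, φ y) ^ 2)
  filter_upwards [hs, eventually_ge_atTop 1] with n hn hn1
  have h1 := hn _ ((hB n hn1).integrable_symbol hW hc.ne' (hΨ n hn1) ht)
    (norm_sq_solutionSymbol c H n t)
  rw [div_le_iff₀' hκ] at h1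
  have h2 := ofReal_le_lintegral_wick_test (hB n hn1) hW hc.ne' (hΨ n hn1) ht hφs.continuous
    (hφs.continuous.integrable_of_hasCompactSupport hφc) hφ0 hε s (resonantCube h)
    (measurableSet_resonantCube h) (fun p _ q _ hpq => disjoint_resonantCube hh0 hpq)
    (fun p ζ hζ ζ' hζ' => abs_sub_le_of_mem_resonantCube hζ hζ')
  have h3 : ∫⁻ ω, ‖∫ y, ((wickSquare P (Ψ n) ω t y : ℝ) : ℂ) * ((φ y : ℝ) : ℂ)‖ₑ ^ 2 ∂P ≤
      C ^ 2 * ∫⁻ ω, localSobolevNorm (-(2 * α)) D (wickSquare P (Ψ n) ω t) ^ 2 ∂P := by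
    -- Finiteness of the constant replaces measurability of the Sobolev norm in ω.
    rw [← lintegral_const_mul' _ _ (ENNReal.pow_ne_top hC)]
    refine lintegral_mono fun ω => ?_
    rw [← mul_pow]
    exact pow_le_pow_left' (hCle _) 2
  have h4 : C ^ 2 * x < ENNReal.ofReal ((C ^ 2 * x).toReal + 1) := by
    rw [← ENNReal.ofReal_toReal hCx, ENNReal.toReal_ofReal ENNReal.toReal_nonneg]
    exact (ENNReal.ofReal_lt_ofReal_iff (by positivity)).2 (lt_add_one _)
  exact lt_of_mul_lt_mul_left' ((h4.trans_le (ENNReal.ofReal_le_ofReal h1)).trans_le (h2.trans h3))
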